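/- Let $V=V_0\oplus V_1$ be an oriented symplectic supervector space of dimension $(m,n)$: $V_0,V_1$ are real vector spaces of dimensions $m,n$; $B$ is an even bilinear form on $V$ ($V_0\perp V_1$) which is alternating and non-degenerate on $V_0$ and symmetric and non-degenerate on $V_1$. A symplectic basis of $V_0$ is a basis consisting of $m/2$ mutually orthogonal pairs $(e,e')$ with $B(e,e')=1$; a symplectic basis of $V_1$ is a basis $(f_1,\dots,f_n)$ of $V_1\otimes\mathbb C$, orthonormal for $B$, with $f_i\in V_1\cup iV_1$; an orientation is the choice of an element of $\Lambda^n(V_1^*)\otimes\mathbb C$ of the form $\xi^1\cdots\xi^n$, where $(\xi^i)$ is the dual basis of a symplectic basis of $V_1$, and a symplectic basis of $V_1$ is oriented if $\xi^1\cdots\xi^n$ is the orientation. In the coordinates $(x,\xi)$ dual to an oriented symplectic basis the Liouville integral of a function $\phi$ on $V$ is $$\int_V d_V(v)\,\phi(v)=\frac1{(2\pi)^{m/2}}\int_{\mathbb R^m}|dx^1\cdots dx^m|\,\Big(\frac{\partial}{\partial\xi^1}\cdots\frac{\partial}{\partial\xi^n}\phi\Big)\Big|_{\xi=0}.$$ Let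 $\mathfrak{spo}(V)$ be the Lie superalgebra of endomorphisms leaving $B$ invariant, so that $\mathfrak{spo}(V)_0=\mathfrak{sp}(V_0)\oplus\mathfrak{so}(V_1)$, and let $\mathcal V^+=\mathcal U^+\times\mathfrak{so}(V_1)$, where $\mathcal U^+$ is the set of $X\in\mathfrak{sp}(V_0)$ for which the quadratic form $v\mapsto B(v,Xv)$ on $V_0$ is positive definite. A near superalgebra is a finite-dimensional supercommutative real superalgebra $\mathcal P$ which is local with residue field $\mathbb R$; a $\mathcal P$-point of a supervector space $E$ is an element of $(E\otimes\mathcal P)_0$; its body is its image in $E_0$; and the value $\phi(X)\in\mathcal P\otimes\mathbb C$ at a $\mathcal P$-point $X$ of a function $\phi$ on the supermanifold $E$ is defined by Taylor's formula at the body and by substitution for the odd coordinates. (1) There is a unique analytic function $\operatorname{Spf}\in\mathcal C^\omega(\mathcal V^+,\mathbb C)\otimes\Lambda(\mathfrak{spo}(V)_1^*)$ on the supermanifold $\mathfrak{spo}(V)$, defined in $\mathcal V^+$, such that for every near superalgebra $\mathcal P$ and every $\mathcal P$-point $X$ of $\mathfrak{spo}(V)$ with body in $\mathcal V^+$ the following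 integral converges and $$\operatorname{Spf}(X)=\int_V d_V(v)\exp\big(-\tfrac12B(v,Xv)\big),$$ in every oriented symplectic basis. (2) $\operatorname{Spf}$ extends to a holomorphic function on the complexification of $\mathfrak{spo}(V)$, defined in the tube $\mathcal V^+\times i\,\mathfrak{spo}(V)_0=\{X\in\mathfrak{spo}(V)_0\otimes\mathbb C:\operatorname{Re}X\in\mathcal V^+\}$, whose value at every $\mathcal P$-point $X\in(\mathfrak{spo}(V)\otimes\mathcal P\otimes\mathbb C)_0$ with body in this tube is given by the same convergent integral. -/

import Mathlib

open scoped TensorProduct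

noncomputable section

/-! ### Near superalgebras and their complexification -/

/-- A near superalgebra: a `ℤ/2`-graded, supercommutative, finite dimensional real algebra `P` which
is local with residue field `ℝ`.  The projection onto the residue field is the `body`
(an algebra morphism from a local algebra onto a field is automatically that projection). -/
structure NearSuperalgebra {P : Type*} [Ring P] [Algebra ℝ P]
    (𝒜 : ZMod 2 → Submodule ℝ P) [GradedAlgebra 𝒜] where
  finite : Module.Finite ℝ P
  isLocal : IsLocalRing P
  comm : ∀ (i j : ZMod 2) (a b : P), a ∈ 𝒜 i → b ∈ 𝒜 j → a * b = (-1 : ℤˣ) ^ (i * j) • (b * a)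
  body : P →ₐ[ℝ] ℝ

/-- The grading of the complexification `P_ℂ = ℂ ⊗ P`. -/
abbrev cpxGrading {P : Type*} [Ring P] [Algebra ℝ P] (𝒜 : ZMod 2 → Submodule ℝ P) :
    ZMod 2 → Submodule ℂ (ℂ ⊗[ℝ] P) :=
  fun i => (𝒜 i).baseChange ℂ

instance cpxGrading.gradedAlgebra {P : Type*} [Ring P] [Algebra ℝ P]
    (𝒜 : ZMod 2 → Submodule ℝ P) [GradedAlgebra 𝒜] : GradedAlgebra (cpxGrading 𝒜) :=
  GradedAlgebra.baseChange 𝒜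

/-- The `ℝ`-linear embedding `p ↦ 1 ⊗ p` of `P_i` in `(P_ℂ)_i`. -/
def toCpxGrading {P : Type*} [Ring P] [Algebra ℝ P] (𝒜 : ZMod 2 → Submodule ℝ P) (i : ZMod 2) :
    𝒜 i →ₗ[ℝ] cpxGrading 𝒜 i :=
  ((𝒜 i).toBaseChange ℂ).restrictScalars ℝ ∘ₗ TensorProduct.mk ℝ ℂ (𝒜 i) 1

namespace NearSuperalgebra

variable {P : Type*} [Ring P] [Algebra ℝ P] {𝒜 : ZMod 2 → Submodule ℝ P} [GradedAlgebra 𝒜]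

/-- The body `P_ℂ → ℂ`. -/
def bodyC (h : NearSuperalgebra 𝒜) : ℂ ⊗[ℝ] P →ₗ[ℂ] ℂ :=
  (TensorProduct.AlgebraTensorModule.rid ℝ ℂ ℂ).toLinearMap ∘ₗ
    h.body.toLinearMap.baseChange ℂ

theorem odd_anticomm (h : NearSuperalgebra 𝒜) {a b : ℂ ⊗[ℝ] P}
    (ha : a ∈ cpxGrading 𝒜 1) (hb : b ∈ cpxGrading 𝒜 1) : a * b = -(b * a) := by
  simp only [cpxGrading, Submodule.baseChange_eq_span] at ha hb
  induction ha using Submodule.span_induction with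
  | zero => simp
  | add x y _ _ hx hy => rw [add_mul, mul_add, hx, hy]; abel
  | smul c x _ hx => rw [smul_mul_assoc, mul_smul_comm, hx, smul_neg]
  | mem x hx =>
    obtain ⟨p, hp, rfl⟩ := hx
    induction hb using Submodule.span_induction with
    | zero => simp
    | add x y _ _ hx hy => rw [add_mul, mul_add, hx, hy]; abel
    | smul c x _ hx => rw [smul_mul_assoc, mul_smul_comm, hx, smul_neg]
    | mem y hy =>
      obtain ⟨q, hq, rfl⟩ := hy
      have := h.comm 1 1 p q hp hq
      simp at this
      simp [this, TensorProduct.tmul_neg]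

theorem odd_sq (h : NearSuperalgebra 𝒜) {a : ℂ ⊗[ℝ] P}
    (ha : a ∈ cpxGrading 𝒜 1) : a * a = 0 := by
  have h1 := h.odd_anticomm ha ha
  have h2 : (2 : ℂ) • (a * a) = 0 := by
    rw [two_smul]; nth_rewrite 1 [h1]; simp
  simpa using h2

end NearSuperalgebra

/-! ### Points of a supervector space with values in a near superalgebra -/

section Points

variable {E M : Type*} [AddCommGroup E] [Module ℝ E] [AddCommGroup M] [Module ℝ M]

/-- The value `ℓ(Σ v_i p^i) = Σ ℓ(v_i) p^i` of a linear form at a point. -/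
def pointCoord (ℓ : E →ₗ[ℝ] ℝ) : E ⊗[ℝ] M →ₗ[ℝ] M :=
  (TensorProduct.lid ℝ M).toLinearMap ∘ₗ ℓ.rTensor M

variable (E₀ E₁ : Type*) [AddCommGroup E₀] [Module ℝ E₀] [AddCommGroup E₁] [Module ℝ E₁]
variable {P : Type*} [Ring P] [Algebra ℝ P] (𝒜 : ZMod 2 → Submodule ℝ P)

/-- Points of the supervector space `E = E₀ ⊕ E₁` with values in `P`:
`(E ⊗ P)₀ = E₀ ⊗ P₀ ⊕ E₁ ⊗ P₁`. -/
abbrev SuperPoint := (E₀ ⊗[ℝ] 𝒜 0) × (E₁ ⊗[ℝ] 𝒜 1)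

/-- Points of the complexification of `E = E₀ ⊕ E₁` with values in `P`:
`(E ⊗ P_ℂ)₀ = E₀ ⊗ (P_ℂ)₀ ⊕ E₁ ⊗ (P_ℂ)₁`, where the tensor products are over `ℝ`. -/
abbrev SuperPointC := (E₀ ⊗[ℝ] cpxGrading 𝒜 0) × (E₁ ⊗[ℝ] cpxGrading 𝒜 1)

variable {E₀ E₁ 𝒜}

/-- A `P`-point of `E` seen as a `P`-point of the complexification of `E`. -/
def SuperPoint.toC (X : SuperPoint E₀ E₁ 𝒜) : SuperPointC E₀ E₁ 𝒜 :=
  ((toCpxGrading 𝒜 0).lTensor E₀ X.1, (toCpxGrading 𝒜 1).lTensor E₁ X.2)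

variable [GradedAlgebra 𝒜]

/-- The body `b(X) ∈ E₀` of a `P`-point (odd elements of `P` have body `0`). -/
def SuperPoint.body (h : NearSuperalgebra 𝒜) (X : SuperPoint E₀ E₁ 𝒜) : E₀ :=
  TensorProduct.rid ℝ E₀ ((h.body.toLinearMap ∘ₗ (𝒜 0).subtype).lTensor E₀ X.1)

/-- The body `b(X) ∈ E₀ ⊗ ℂ` of a `P`-point of the complexification. -/
def SuperPointC.body (h : NearSuperalgebra 𝒜) (X : SuperPointC E₀ E₁ 𝒜) : E₀ ⊗[ℝ] ℂ :=
  ((h.bodyC ∘ₗ (cpxGrading 𝒜 0).subtype).restrictScalars ℝ).lTensor E₀ X.1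

end Points

/-! ### Functions on a supervector space, and their values at points -/

/-- The algebra `Λ(E₁^*) ⊗ ℂ`, as the complex exterior algebra of `E₁^* ⊗ ℂ = Hom_ℝ(E₁, ℂ)`. -/
abbrev CForms (E₁ : Type*) [AddCommGroup E₁] [Module ℝ E₁] : Type _ :=
  ExteriorAlgebra ℂ (E₁ →ₗ[ℝ] ℂ)

/-- The `ℤ/2`-grading of `Λ(E₁^*) ⊗ ℂ`. -/
abbrev formGrading (E₁ : Type*) [AddCommGroup E₁] [Module ℝ E₁] :
    ZMod 2 → Submodule ℂ (CForms E₁) :=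
  CliffordAlgebra.evenOdd (0 : QuadraticForm ℂ (E₁ →ₗ[ℝ] ℂ))

section Functions

variable {E₀ E₁ : Type*} [AddCommGroup E₀] [Module ℝ E₀] [Module.Finite ℝ E₀]
  [AddCommGroup E₁] [Module ℝ E₁] [Module.Finite ℝ E₁]

/-- The element of `E₀` with given real coordinates in a fixed basis of `E₀`. -/
def ofCoord (E₀ : Type*) [AddCommGroup E₀] [Module ℝ E₀] [Module.Finite ℝ E₀]
    (t : Fin (Module.finrank ℝ E₀) → ℝ) : E₀ :=
  ∑ a, t a • Module.finBasis ℝ E₀ a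

/-- The element of the complexification of `E₀` with given complex coordinates in the same basis. -/
def ofCoordC (E₀ : Type*) [AddCommGroup E₀] [Module ℝ E₀] [Module.Finite ℝ E₀]
    (t : Fin (Module.finrank ℝ E₀) → ℂ) : E₀ ⊗[ℝ] ℂ :=
  ∑ a, Module.finBasis ℝ E₀ a ⊗ₜ[ℝ] t a

/-- `F ∈ C^ω(U, ℂ) ⊗ Λ(E₁^*)`: `F` is an analytic complex valued function on the supermanifold
`E₀ ⊕ E₁` defined in `U ⊆ E₀`.  Only the values of `F` on `U` matter. -/
def IsAnalyticSuper (U : Set E₀) (F : E₀ → CForms E₁) : Prop :=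
  ∀ ℓ : CForms E₁ →ₗ[ℂ] ℂ,
    AnalyticOnNhd ℝ (fun t => ℓ (F (ofCoord E₀ t))) {t | ofCoord E₀ t ∈ U}

/-- `F ∈ H(U) ⊗ Λ(E₁^*)`: `F` is a holomorphic function on the complexification of the supervector
space `E₀ ⊕ E₁` defined in the open set `U ⊆ E₀ ⊗ ℂ`. -/
def IsHolomorphicSuper (U : Set (E₀ ⊗[ℝ] ℂ)) (F : E₀ ⊗[ℝ] ℂ → CForms E₁) : Prop :=
  ∀ ℓ : CForms E₁ →ₗ[ℂ] ℂ,
    DifferentiableOn ℂ (fun t => ℓ (F (ofCoordC E₀ t))) {t | ofCoordC E₀ t ∈ U}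

/-- Taylor's formula `g(x + s) = Σ_k (1/k!) D^k g(x)(s, …, s)`, where `s = (s_1, …, s_d)` are
(commuting, nilpotent) elements of an algebra; the sum is finite. -/
def taylorValue (𝕜 : Type*) [NontriviallyNormedField 𝕜] [NormedSpace 𝕜 ℂ]
    {A : Type*} [Ring A] [Algebra ℂ A] {d : ℕ}
    (g : (Fin d → 𝕜) → ℂ) (x : Fin d → 𝕜) (s : Fin d → A) : A :=
  ∑ᶠ k : ℕ, ((k.factorial : ℂ)⁻¹) • ∑ a : Fin k → Fin d,
    iteratedFDeriv 𝕜 k g x (fun i => Pi.single (a i) 1) • (List.ofFn fun i => s (a i)).prod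

/-- The same formula for a function `g` with values in the finite dimensional algebra `A`. -/
def taylorValueAlg (𝕜 : Type*) [NontriviallyNormedField 𝕜] [NormedSpace 𝕜 ℂ]
    {A : Type*} [Ring A] [Algebra ℂ A] [Module.Finite ℂ A] {d : ℕ}
    (g : (Fin d → 𝕜) → A) (x : Fin d → 𝕜) (s : Fin d → A) : A :=
  ∑ r, Module.finBasis ℂ A r *
    taylorValue 𝕜 (fun t => (Module.finBasis ℂ A).coord r (g t)) x s

variable {P : Type*} [Ring P] [Algebra ℝ P] {𝒜 : ZMod 2 → Submodule ℝ P} [GradedAlgebra 𝒜]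

/-- The value `ζ(Z) = Σ ζ(H_b) z^b ∈ (P_ℂ)₁` of `ζ ∈ E₁^* ⊗ ℂ` at an odd point `Z = Σ H_b z^b`. -/
def oddCoord (Z : E₁ ⊗[ℝ] cpxGrading 𝒜 1) : (E₁ →ₗ[ℝ] ℂ) →ₗ[ℂ] ℂ ⊗[ℝ] P where
  toFun ζ := ∑ b, ζ (Module.finBasis ℝ E₁ b) •
    ((pointCoord ((Module.finBasis ℝ E₁).coord b) Z : cpxGrading 𝒜 1) : ℂ ⊗[ℝ] P)
  map_add' ζ ζ' := by simp [add_smul, Finset.sum_add_distrib]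
  map_smul' c ζ := by simp [mul_smul, Finset.smul_sum]

theorem oddCoord_mem (Z : E₁ ⊗[ℝ] cpxGrading 𝒜 1) (ζ : E₁ →ₗ[ℝ] ℂ) :
    oddCoord Z ζ ∈ cpxGrading 𝒜 1 := by
  simp only [oddCoord, LinearMap.coe_mk, AddHom.coe_mk]
  exact Submodule.sum_mem _ fun b _ => Submodule.smul_mem _ _ (SetLike.coe_mem _)

/-- The algebra morphism `Λ(E₁^*) ⊗ ℂ → P_ℂ`, `ω ↦ ω(Z)`. -/
def oddValue (h : NearSuperalgebra 𝒜) (Z : E₁ ⊗[ℝ] cpxGrading 𝒜 1) :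
    CForms E₁ →ₐ[ℂ] ℂ ⊗[ℝ] P :=
  ExteriorAlgebra.lift ℂ ⟨oddCoord Z, fun ζ => h.odd_sq (oddCoord_mem Z ζ)⟩

/-- The coordinates `y^a ∈ P_ℂ` of the even part of a point. -/
def evenCoord (X : SuperPointC E₀ E₁ 𝒜) (a : Fin (Module.finrank ℝ E₀)) : ℂ ⊗[ℝ] P :=
  (pointCoord ((Module.finBasis ℝ E₀).coord a) X.1 : cpxGrading 𝒜 0)

/-- The souls `y^a - b(y^a)` of the coordinates of the even part of a point. -/
def evenSoul (h : NearSuperalgebra 𝒜) (X : SuperPointC E₀ E₁ 𝒜)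
    (a : Fin (Module.finrank ℝ E₀)) : ℂ ⊗[ℝ] P :=
  evenCoord X a - algebraMap ℂ _ (h.bodyC (evenCoord X a))

/-- The value `F(X) ∈ P_ℂ` at a `P`-point `X` of a (real) analytic function `F` on the
supermanifold `E₀ ⊕ E₁`. -/
def superValue (h : NearSuperalgebra 𝒜) (F : E₀ → CForms E₁) (X : SuperPoint E₀ E₁ 𝒜) :
    ℂ ⊗[ℝ] P :=
  haveI := h.finite
  taylorValueAlg ℝ (fun t => oddValue h X.toC.2 (F (ofCoord E₀ t)))
    (fun a => (Module.finBasis ℝ E₀).coord a (X.body h)) (evenSoul h X.toC)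

/-- The value `F(X) ∈ P_ℂ` at a `P`-point `X` of the complexification of a holomorphic function
`F`. -/
def superValueC (h : NearSuperalgebra 𝒜) (F : E₀ ⊗[ℝ] ℂ → CForms E₁)
    (X : SuperPointC E₀ E₁ 𝒜) : ℂ ⊗[ℝ] P :=
  haveI := h.finite
  taylorValueAlg ℂ (fun t => oddValue h X.2 (F (ofCoordC E₀ t)))
    (fun a => h.bodyC (evenCoord X a)) (evenSoul h X)

end Functions

/-! ### The superalgebra `Λ(V₁^*) ⊗ P_ℂ` -/

section FormsWithValues

variable {V₁ : Type*} [AddCommGroup V₁] [Module ℝ V₁]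
variable {P : Type*} [Ring P] [Algebra ℝ P] {𝒜 : ZMod 2 → Submodule ℝ P} [GradedAlgebra 𝒜]

variable (V₁ 𝒜) in
/-- `Λ(V₁^*) ⊗ P_ℂ`, with the product given by the rule of signs.  A smooth function on the
supermanifold `V₀ ⊕ V₁` with values in `P_ℂ` is a map from `V₀` to this algebra. -/
abbrev PForms : Type _ := GradedTensorProduct ℂ (formGrading V₁) (cpxGrading 𝒜)

/-- The projection `Λ(V₁^*) ⊗ P_ℂ → ℂ` with nilpotent kernel. -/
def PForms.body (h : NearSuperalgebra 𝒜) : PForms V₁ 𝒜 →ₗ[ℂ] ℂ :=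
  (TensorProduct.lid ℂ ℂ).toLinearMap ∘ₗ
    TensorProduct.map (ExteriorAlgebra.algebraMapInv (R := ℂ)).toLinearMap h.bodyC ∘ₗ
      (GradedTensorProduct.of ℂ (formGrading V₁) (cpxGrading 𝒜)).symm.toLinearMap

/-- `exp(r) = e^{b(r)} Σ_k (r - b(r))^k / k!` (for `r` even, `r - b(r)` is nilpotent and the sum is
finite). -/
def PForms.exp (h : NearSuperalgebra 𝒜) (r : PForms V₁ 𝒜) : PForms V₁ 𝒜 :=
  Complex.exp (PForms.body h r) •
    ∑ᶠ k : ℕ, ((k.factorial : ℂ)⁻¹) • (r - algebraMap ℂ (PForms V₁ 𝒜) (PForms.body h r)) ^ k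

/-- A complex valued linear form on `V₁`, as an odd element of `Λ(V₁^*) ⊗ P_ℂ`. -/
def PForms.ofForm (𝒜 : ZMod 2 → Submodule ℝ P) [GradedAlgebra 𝒜] (η : V₁ →ₗ[ℝ] ℂ) :
    PForms V₁ 𝒜 :=
  GradedTensorProduct.includeLeft (formGrading V₁) (cpxGrading 𝒜) (ExteriorAlgebra.ι ℂ η)

/-- An element of `P_ℂ`, as an element of `Λ(V₁^*) ⊗ P_ℂ`. -/
def PForms.ofScalar (V₁ : Type*) [AddCommGroup V₁] [Module ℝ V₁]
    (𝒜 : ZMod 2 → Submodule ℝ P) [GradedAlgebra 𝒜] (p : ℂ ⊗[ℝ] P) : PForms V₁ 𝒜 :=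
  GradedTensorProduct.includeRight (formGrading V₁) (cpxGrading 𝒜) p

end FormsWithValues

/-! ### Oriented symplectic supervector spaces -/

section Symplectic

variable {V₀ V₁ : Type*} [AddCommGroup V₀] [Module ℝ V₀] [AddCommGroup V₁] [Module ℝ V₁]

/-- A symplectic basis `(f_1, …, f_n)` of the quadratic space `V₁`: an orthonormal basis of
`V₁ ⊗ ℂ` with `f_i ∈ V₁` or `f_i ∈ i V₁`.  We write `f_i = c_i u_i` with `c_i ∈ {1, i}` and
`u_i ∈ V₁`. -/
structure OddSymplecticBasis (B₁ : LinearMap.BilinForm ℝ V₁) (n : ℕ) where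
  u : Module.Basis (Fin n) ℝ V₁
  c : Fin n → ℂ
  c_eq : ∀ i, c i = 1 ∨ c i = Complex.I
  orthonormal : ∀ i j, c i * c j * (B₁ (u i) (u j) : ℂ) = if i = j then 1 else 0

namespace OddSymplecticBasis

variable {B₁ : LinearMap.BilinForm ℝ V₁} {n : ℕ}

/-- The dual coordinates `ξ^i`. -/
def ξ (f : OddSymplecticBasis B₁ n) (i : Fin n) : V₁ →ₗ[ℝ] ℂ :=
  (f.c i)⁻¹ • (Complex.ofRealCLM.toLinearMap ∘ₗ f.u.coord i)

/-- The element `ξ^1 ⋯ ξ^n` of `Λ(V₁^*) ⊗ ℂ`. -/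
def volume (f : OddSymplecticBasis B₁ n) : CForms V₁ :=
  (List.ofFn fun i => ExteriorAlgebra.ι ℂ (f.ξ i)).prod

/-- Evaluation at `f_i`, a linear form on `V₁^* ⊗ ℂ`. -/
def evalAt (f : OddSymplecticBasis B₁ n) (i : Fin n) : Module.Dual ℂ (V₁ →ₗ[ℝ] ℂ) where
  toFun η := f.c i * η (f.u i)
  map_add' _ _ := by simp [mul_add]
  map_smul' _ _ := by simp; ring

/-- The odd derivation `∂/∂ξ^i` of `Λ(V₁^*) ⊗ ℂ`. -/
def deriv (f : OddSymplecticBasis B₁ n) (i : Fin n) : Module.End ℂ (CForms V₁) :=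
  CliffordAlgebra.contractLeft (Q := (0 : QuadraticForm ℂ (V₁ →ₗ[ℝ] ℂ))) (f.evalAt i)

/-- The Berezin integral `d_ξ` on `V₁`: the term of degree `0` of `∂/∂ξ^1 ⋯ ∂/∂ξ^n φ`. -/
def berezin (f : OddSymplecticBasis B₁ n) : CForms V₁ →ₗ[ℂ] ℂ :=
  (ExteriorAlgebra.algebraMapInv (R := ℂ)).toLinearMap ∘ₗ (List.ofFn fun i => f.deriv i).prod

/-- The Berezin integral of `P_ℂ`-valued functions on `V₁` (coefficients are written on the right
of the `ξ^i`). -/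
def berezinP (f : OddSymplecticBasis B₁ n) {P : Type*} [Ring P] [Algebra ℝ P]
    (𝒜 : ZMod 2 → Submodule ℝ P) [GradedAlgebra 𝒜] : PForms V₁ 𝒜 →ₗ[ℂ] ℂ ⊗[ℝ] P :=
  (TensorProduct.lid ℂ (ℂ ⊗[ℝ] P)).toLinearMap ∘ₗ
    f.berezin.rTensor (ℂ ⊗[ℝ] P) ∘ₗ
      (GradedTensorProduct.of ℂ (formGrading V₁) (cpxGrading 𝒜)).symm.toLinearMap

end OddSymplecticBasis

variable (V₀ V₁) in
/-- An oriented symplectic supervector space `V = V₀ ⊕ V₁` of dimension `(m, n)`: the symplectic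
form is `B₀` on `V₀`, `B₁` on `V₁`, and `V₀` and `V₁` are orthogonal.  The orientation is a choice
of one of the two elements `± ξ^1 ⋯ ξ^n`. -/
structure OrientedSymplecticSuperspace (m n : ℕ) where
  finrank_even : Module.finrank ℝ V₀ = m
  finrank_odd : Module.finrank ℝ V₁ = n
  B₀ : LinearMap.BilinForm ℝ V₀
  B₁ : LinearMap.BilinForm ℝ V₁
  alt : B₀.IsAlt
  symm : B₁.IsSymm
  nondegenerate_even : B₀.Nondegenerate
  nondegenerate_odd : B₁.Nondegenerate
  orientation : CForms V₁
  exists_basis : ∃ f : OddSymplecticBasis B₁ n, f.volume = orientation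

namespace OrientedSymplecticSuperspace

variable {m n : ℕ} (V : OrientedSymplecticSuperspace V₀ V₁ m n)

/-- The even part `sp(V₀) ⊕ so(V₁)` of the Lie superalgebra `spo(V)`. -/
def spoEven : Submodule ℝ (Module.End ℝ V₀ × Module.End ℝ V₁) where
  carrier := {G | (∀ x y, V.B₀ (G.1 x) y + V.B₀ x (G.1 y) = 0) ∧
    ∀ x y, V.B₁ (G.2 x) y + V.B₁ x (G.2 y) = 0}
  zero_mem' := by simp
  add_mem' := by
    rintro G H ⟨h1, h2⟩ ⟨h3, h4⟩
    refine ⟨fun x y => ?_, fun x y => ?_⟩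
    · have := h1 x y; have := h3 x y; simp; linarith
    · have := h2 x y; have := h4 x y; simp; linarith
  smul_mem' := by
    rintro c G ⟨h1, h2⟩
    refine ⟨fun x y => ?_, fun x y => ?_⟩
    · have := h1 x y; simp [← mul_add, this]
    · have := h2 x y; simp [← mul_add, this]

/-- The odd part of `spo(V)`: the odd endomorphisms `H = (C : V₀ → V₁, D : V₁ → V₀)` with
`B(Hx, y) + (-1)^{p(x)} B(x, Hy) = 0`. -/
def spoOdd : Submodule ℝ ((V₀ →ₗ[ℝ] V₁) × (V₁ →ₗ[ℝ] V₀)) where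
  carrier := {H | (∀ x y, V.B₁ (H.1 x) y + V.B₀ x (H.2 y) = 0) ∧
    ∀ x y, V.B₀ (H.2 x) y - V.B₁ x (H.1 y) = 0}
  zero_mem' := by simp
  add_mem' := by
    rintro G H ⟨h1, h2⟩ ⟨h3, h4⟩
    refine ⟨fun x y => ?_, fun x y => ?_⟩
    · have := h1 x y; have := h3 x y; simp; linarith
    · have := h2 x y; have := h4 x y; simp; linarith
  smul_mem' := by
    rintro c G ⟨h1, h2⟩
    refine ⟨fun x y => ?_, fun x y => ?_⟩
    · have := h1 x y; simp [← mul_add, this]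
    · have := h2 x y; simp [← mul_sub, this]

/-- The open convex cone `𝒱⁺ = 𝒰⁺ × so(V₁)`: `v ↦ B(v, Xv)` is positive definite on `V₀`. -/
def posCone : Set V.spoEven :=
  {X | ∀ v : V₀, v ≠ 0 → 0 < V.B₀ v (X.1.1 v)}

/-- The tube `𝒱⁺ × i spo(V)₀` in `spo(V)₀ ⊗ ℂ`: the elements with real part in `𝒱⁺`. -/
def posTube : Set (V.spoEven ⊗[ℝ] ℂ) :=
  {X | TensorProduct.rid ℝ V.spoEven (Complex.reLm.lTensor V.spoEven X) ∈ V.posCone}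

/-- An oriented symplectic basis of `V`: a symplectic basis of `V₀` (the pairs
`(e (inl i), e (inr i))` span orthogonal symplectic planes) and an oriented symplectic basis
of `V₁`. -/
structure OrientedBasis where
  e : Module.Basis (Fin (m / 2) ⊕ Fin (m / 2)) ℝ V₀
  f : OddSymplecticBasis V.B₁ n
  symplectic : ∀ i j, V.B₀ (e (Sum.inl i)) (e (Sum.inr j)) = if i = j then 1 else 0
  isotropic_left : ∀ i j, V.B₀ (e (Sum.inl i)) (e (Sum.inl j)) = 0
  isotropic_right : ∀ i j, V.B₀ (e (Sum.inr i)) (e (Sum.inr j)) = 0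
  oriented : f.volume = V.orientation

variable {V} {P : Type*} [Ring P] [Algebra ℝ P] {𝒜 : ZMod 2 → Submodule ℝ P} [GradedAlgebra 𝒜]

/-- `s = ∫_V d_V(v) φ(v)`, where `d_V` is the Liouville integral computed in the given oriented
symplectic basis, and `φ` is a function on `V` with values in `P_ℂ`; the integral converges
absolutely. -/
def HasLiouvilleIntegral (b : V.OrientedBasis) (φ : V₀ → PForms V₁ 𝒜) (s : ℂ ⊗[ℝ] P) : Prop :=
  ∀ ℓ : (ℂ ⊗[ℝ] P) →ₗ[ℂ] ℂ,
    MeasureTheory.Integrable (fun x : Fin (m / 2) ⊕ Fin (m / 2) → ℝ =>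
      ℓ (b.f.berezinP 𝒜 (φ (∑ i, x i • b.e i)))) ∧
    ℓ s = ((2 * Real.pi : ℝ) ^ (m / 2) : ℂ)⁻¹ *
      ∫ x : Fin (m / 2) ⊕ Fin (m / 2) → ℝ, ℓ (b.f.berezinP 𝒜 (φ (∑ i, x i • b.e i)))

variable [Module.Finite ℝ V₀] [Module.Finite ℝ V₁]

/-- The moment map `μ(X, v) = -½ B(v, Xv) = -½ Σ B(g_i, G_k g_j) z^j Z^k z^i`, for a `P`-point
`X = Σ G_k Z^k` of the complexification of `spo(V)`, as a function on `V`.  The generic point of `V`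
is `v = Σ g_i z^i = v₀ + Σ u_j η^j`, where `v₀` runs over `V₀` and `(η^j)` is the basis dual to
the basis `(u_j)` of `V₁`. -/
def moment (u : Module.Basis (Fin n) ℝ V₁) (X : SuperPointC V.spoEven V.spoOdd 𝒜) (v₀ : V₀) :
    PForms V₁ 𝒜 :=
  let η : Fin n → PForms V₁ 𝒜 := fun j =>
    PForms.ofForm 𝒜 (Complex.ofRealCLM.toLinearMap ∘ₗ u.coord j)
  let G := Module.finBasis ℝ V.spoEven
  let H := Module.finBasis ℝ V.spoOdd
  let y : Fin (Module.finrank ℝ V.spoEven) → PForms V₁ 𝒜 := fun k =>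
    PForms.ofScalar V₁ 𝒜 (pointCoord (G.coord k) X.1 : cpxGrading 𝒜 0)
  let z : Fin (Module.finrank ℝ V.spoOdd) → PForms V₁ 𝒜 := fun k =>
    PForms.ofScalar V₁ 𝒜 (pointCoord (H.coord k) X.2 : cpxGrading 𝒜 1)
  (-(1 / 2) : ℂ) •
    ((∑ k, (V.B₀ v₀ ((G k).1.1 v₀) : ℂ) • y k) +
      (∑ k, ∑ i, ∑ j, (V.B₁ (u i) ((G k).1.2 (u j)) : ℂ) • (η j * y k * η i)) +
      (∑ k, ∑ j, (V.B₀ v₀ ((H k).1.2 (u j)) : ℂ) • (η j * z k)) +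
      ∑ k, ∑ i, (V.B₁ (u i) ((H k).1.1 v₀) : ℂ) • (z k * η i))

/-- `s = ∫_V d_V(v) exp(-½ B(v, Xv))`, the integral being convergent and its value being the same in
every oriented symplectic basis. -/
def IsGaussianIntegral (h : NearSuperalgebra 𝒜) (X : SuperPointC V.spoEven V.spoOdd 𝒜)
    (s : ℂ ⊗[ℝ] P) : Prop :=
  ∀ b : V.OrientedBasis,
    HasLiouvilleIntegral b (fun v₀ => PForms.exp h (moment b.f.u X v₀)) s

/-- `F` is an analytic function on the supermanifold `spo(V)` defined in `𝒱⁺`, whose value at every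
`P`-point `X` with body in `𝒱⁺` is `∫_V d_V(v) exp(-½ B(v, Xv))`. -/
def IsSuperPfaffian.{w, u, v} {V₀ : Type u} {V₁ : Type v} [AddCommGroup V₀] [Module ℝ V₀]
    [Module.Finite ℝ V₀] [AddCommGroup V₁] [Module ℝ V₁] [Module.Finite ℝ V₁] {m n : ℕ}
    (V : OrientedSymplecticSuperspace V₀ V₁ m n)
    (F : V.spoEven → CForms V.spoOdd) : Prop :=
  IsAnalyticSuper V.posCone F ∧
    ∀ (P : Type w) [Ring P] [Algebra ℝ P] (𝒜 : ZMod 2 → Submodule ℝ P) [GradedAlgebra 𝒜]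
      (h : NearSuperalgebra 𝒜) (X : SuperPoint V.spoEven V.spoOdd 𝒜),
      X.body h ∈ V.posCone → IsGaussianIntegral h X.toC (superValue h F X)

/-- `F` is a holomorphic function on the complexification of `spo(V)` defined in
`𝒱⁺ × i spo(V)₀`, whose value at every `P`-point `X` with body in this set is
`∫_V d_V(v) exp(-½ B(v, Xv))`. -/
def IsHolomorphicSuperPfaffian.{w, u, v} {V₀ : Type u} {V₁ : Type v} [AddCommGroup V₀] [Module ℝ V₀]
    [Module.Finite ℝ V₀] [AddCommGroup V₁] [Module ℝ V₁] [Module.Finite ℝ V₁] {m n : ℕ}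
    (V : OrientedSymplecticSuperspace V₀ V₁ m n)
    (F : V.spoEven ⊗[ℝ] ℂ → CForms V.spoOdd) : Prop :=
  IsHolomorphicSuper V.posTube F ∧
    ∀ (P : Type w) [Ring P] [Algebra ℝ P] (𝒜 : ZMod 2 → Submodule ℝ P) [GradedAlgebra 𝒜]
      (h : NearSuperalgebra 𝒜) (X : SuperPointC V.spoEven V.spoOdd 𝒜),
      X.body h ∈ V.posTube → IsGaussianIntegral h X (superValueC h F X)

end OrientedSymplecticSuperspace

end Symplectic

end

universe w

/-! In coordinates the exponent `-½ B(v, Xv)` is affine in the even coordinates `y_k` of `X`: it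
equals `Σ y_k (Q_k + ω_k)` plus a mixed term. Here `Q_k` is a real quadratic polynomial in the even
coordinates `x` of `v`, `ω_k` is quadratic in the odd coordinates of `V`, and the mixed term is
linear in `x` with coefficients that are products of an odd coordinate and an odd parameter. The
`ω_k`, the mixed coefficients and the souls of the `y_k` all commute and are nilpotent. If `t_k` is
the body of `y_k`, the integrand is therefore the scalar Gaussian `exp(Σ t_k Q_k(x))` times a
polynomial in `x` with coefficients in a superalgebra (`exp_moment`). The integral converges exactly
where one expects: `Re t` must make the form on `V₀` positive definite.

The dependence on `t` is the heart of the matter. Expanding the exponential under the integral sign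
shows that Gaussian moments are analytic (`analyticAt_gaussInt`), and differentiating in `t_k`
inserts the factor `Q_k + ω_k` (`hasFDerivAt_gaussAlg`). Hence Taylor's formula with nilpotent
increments `s_k` resums to the insertion of `exp(Σ s_k (Q_k + ω_k))` (`sum_gaussAlg_eq`), which is
precisely the soul part of the integrand. So the value of the function at a `P`-point is the
integral at that point.

For the odd directions, the integral is computed once with the coordinates `ζ^k` of the odd part of
`spo(V)` as parameters. Substituting the odd coordinates of a point is an algebra morphism that
commutes with the Berezin and the Gaussian integrals (`map_gaussAlg`, `oddValue_genericIntegral`).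

The result does not depend on the basis: a change of symplectic basis of `V₀` has determinant of
absolute value 1, and the Berezin integral is alternating of top degree in the basis, hence fixed by
the volume element (`berezin_eq_of_volume_eq`, `HasLiouvilleIntegral.change_basis`). Uniqueness
follows by evaluation at a point with values in an exterior algebra whose odd coordinates are free
generators: such an evaluation has a left inverse (`paramLift_oddValue`). -/

noncomputable section

/-! ### Exponentials of nilpotent elements -/

section NilpotentExp

variable {A B : Type*} [Ring A] [Algebra ℂ A] [Ring B] [Algebra ℂ B]

/-- The exponential series of a nilpotent element. -/
def nilExp (a : A) : A := ∑ᶠ k : ℕ, ((k.factorial : ℂ)⁻¹) • a ^ k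

theorem nilExp_eq_sum {a : A} {K : ℕ} (h : a ^ K = 0) :
    nilExp a = ∑ k ∈ Finset.range K, ((k.factorial : ℂ)⁻¹) • a ^ k := by
  refine finsum_eq_sum_of_support_subset _ fun k hk => ?_
  by_contra hk'
  simp only [Finset.coe_range, Set.mem_Iio, not_lt] at hk'
  exact hk (by simp [pow_eq_zero_of_le hk' h])

theorem nilExp_add_of_commute {a b : A} (hab : Commute a b) (ha : IsNilpotent a)
    (hb : IsNilpotent b) : nilExp (a + b) = nilExp a * nilExp b := by
  let _ : Module ℚ A := Module.compHom A (algebraMap ℚ ℂ)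
  have key : ∀ {c : A}, IsNilpotent c → nilExp c = IsNilpotent.exp c := by
    rintro c ⟨K, hK⟩
    rw [nilExp_eq_sum hK, IsNilpotent.exp_eq_sum hK]
    refine Finset.sum_congr rfl fun k _ => ?_
    change _ = (algebraMap ℚ ℂ ((k.factorial : ℚ)⁻¹)) • c ^ k
    simp
  rw [key ha, key hb, key (hab.isNilpotent_add ha hb), IsNilpotent.exp_add_of_commute hab ha hb]

theorem map_nilExp (f : A →ₐ[ℂ] B) {a : A} (ha : IsNilpotent a) : f (nilExp a) = nilExp (f a) := by
  obtain ⟨K, hK⟩ := ha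
  rw [nilExp_eq_sum hK, nilExp_eq_sum (K := K) (by rw [← map_pow, hK, map_zero])]
  simp

theorem Commute.nilExp_right {a b : A} (h : Commute a b) : Commute a (nilExp b) := by
  unfold nilExp
  by_cases hf : (Function.support fun k : ℕ => ((k.factorial : ℂ)⁻¹) • b ^ k).Finite
  · rw [finsum_eq_sum _ hf]
    exact Commute.sum_right _ _ _ fun k _ => (h.pow_right k).smul_right _
  · rw [finsum_of_infinite_support hf]; exact Commute.zero_right a

end NilpotentExp

/-! ### Products of commuting families -/

section Products

variable {A : Type*} [Ring A]

theorem sum_pow_eq_sum_ofFn_prod {d : ℕ} (x : Fin d → A) (k : ℕ) :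
    (∑ j, x j) ^ k = ∑ a : Fin k → Fin d, (List.ofFn fun i => x (a i)).prod := by
  induction k with
  | zero => simp
  | succ k ih =>
    rw [pow_succ', ih, Finset.sum_mul_sum, ← Finset.sum_product',
      ← (Fin.consEquiv fun _ : Fin (k + 1) => Fin d).sum_comp]
    simp [Fin.consEquiv, List.ofFn_succ]

theorem ofFn_prod_commute {k : ℕ} {x : Fin k → A} {b : A} (h : ∀ i, Commute b (x i)) :
    Commute b (List.ofFn x).prod := by
  refine Commute.list_prod_right _ _ fun c hc => ?_
  obtain ⟨i, rfl⟩ := (List.mem_ofFn' _ _).1 hc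
  exact h i

theorem ofFn_prod_mul {k : ℕ} {x y : Fin k → A} (h : ∀ i j, Commute (x i) (y j)) :
    (List.ofFn fun i => x i * y i).prod = (List.ofFn x).prod * (List.ofFn y).prod := by
  induction k with
  | zero => simp
  | succ k ih =>
    simp only [List.ofFn_succ, List.prod_cons]
    rw [ih fun i j => h _ _]
    have : Commute (y 0) (List.ofFn fun i : Fin k => x i.succ).prod :=
      ofFn_prod_commute fun i => (h _ _).symm
    rw [mul_assoc, mul_assoc, ← mul_assoc (y 0), this.eq, mul_assoc]

/-- Products of sufficiently many members of a finite commuting family of nilpotents vanish. -/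
theorem exists_ofFn_prod_eq_zero {R : Type*} [CommRing R] [Algebra R A] {d : ℕ} {x : Fin d → A}
    (hc : ∀ i j, Commute (x i) (x j))
    (hx : ∀ i, IsNilpotent (x i)) :
    ∃ K : ℕ, ∀ k, K ≤ k → ∀ a : Fin k → Fin d, (List.ofFn fun i => x (a i)).prod = 0 := by
  have : IsMulCommutative (Algebra.adjoin R (Set.range x)) :=
    Algebra.isMulCommutative_adjoin R (by rintro _ ⟨i, rfl⟩ _ ⟨j, rfl⟩; exact hc i j)
  let _ : CommRing (Algebra.adjoin R (Set.range x)) :=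
    { (inferInstance : Ring (Algebra.adjoin R (Set.range x))) with
      mul_comm := this.is_comm.comm }
  let x' : Fin d → Algebra.adjoin R (Set.range x) :=
    fun i => ⟨x i, Algebra.subset_adjoin ⟨i, rfl⟩⟩
  have hx' : ∀ i, IsNilpotent (x' i) := fun i => by
    obtain ⟨K, hK⟩ := hx i
    exact ⟨K, Subtype.ext (by simpa [x'] using hK)⟩
  -- In the commutative subalgebra generated by the family, an ideal generated by finitely many
  -- nilpotents is nilpotent; its exponent bounds the length of all nonzero products at once.
  obtain ⟨K, hK⟩ : IsNilpotent (Ideal.span (Set.range x')) := by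
    rw [Ideal.FG.isNilpotent_iff_le_nilradical
      (Submodule.fg_span (Set.finite_range x')), Ideal.span_le]
    rintro _ ⟨i, rfl⟩
    exact hx' i
  refine ⟨K, fun k hk a => ?_⟩
  have h1 : (List.ofFn fun i => x' (a i)).prod ∈ Ideal.span (Set.range x') ^ k := by
    clear hk
    induction k with
    | zero => simp
    | succ k ih =>
      rw [List.ofFn_succ, List.prod_cons, pow_succ']
      exact Ideal.mul_mem_mul (Ideal.subset_span ⟨_, rfl⟩) (ih _)
  have h2 : (List.ofFn fun i => x' (a i)).prod = 0 := by
    have := Ideal.pow_le_pow_right hk h1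
    rw [hK] at this
    simpa using this
  have h3 := congrArg (Algebra.adjoin R (Set.range x)).val h2
  rw [map_list_prod, List.map_ofFn] at h3
  simpa [Function.comp_def, x'] using h3

end Products

/-! ### The exponential of a linear family of commuting nilpotents -/

section LinearFamily

variable {A : Type*} [Ring A] [Algebra ℂ A] {d : ℕ} {ω : Fin d → A}

theorem isNilpotent_sum_smul (hc : ∀ i j, Commute (ω i) (ω j)) (hn : ∀ i, IsNilpotent (ω i))
    (t : Fin d → ℂ) : IsNilpotent (∑ k, t k • ω k) :=
  Commute.isNilpotent_sum (fun i _ => (hn i).smul _)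
    fun i j _ _ => ((hc i j).smul_left _).smul_right _

/-- A single truncation order serves every `t`, so the exponential is a polynomial in `t`;
analyticity follows. -/
theorem exists_nilExp_sum_smul_eq (hc : ∀ i j, Commute (ω i) (ω j))
    (hn : ∀ i, IsNilpotent (ω i)) :
    ∃ K : ℕ, 2 ≤ K ∧ ∀ t : Fin d → ℂ, nilExp (∑ k, t k • ω k) =
      ∑ k ∈ Finset.range K, ((k.factorial : ℂ)⁻¹) • ∑ a : Fin k → Fin d,
        (∏ i, t (a i)) • (List.ofFn fun i => ω (a i)).prod := by
  obtain ⟨K, hK⟩ := exists_ofFn_prod_eq_zero (R := ℂ) hc hn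
  have h : ∀ (t : Fin d → ℂ) (k : ℕ), (∑ k, t k • ω k) ^ k =
      ∑ a : Fin k → Fin d, (∏ i, t (a i)) • (List.ofFn fun i => ω (a i)).prod := by
    intro t k
    rw [sum_pow_eq_sum_ofFn_prod]
    refine Finset.sum_congr rfl fun a _ => ?_
    simp only [Algebra.smul_def]
    rw [ofFn_prod_mul fun i j => Algebra.commutes _ _, ← List.prod_ofFn, map_list_prod,
      List.map_ofFn]
    rfl
  refine ⟨K + 2, by omega, fun t => ?_⟩
  rw [nilExp_eq_sum (K := K + 2)]
  · simp only [h]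
  · rw [h]
    exact Finset.sum_eq_zero fun a _ => by rw [hK _ (by omega), smul_zero]

theorem nilExp_sum_smul_add (hc : ∀ i j, Commute (ω i) (ω j)) (hn : ∀ i, IsNilpotent (ω i))
    (t s : Fin d → ℂ) : nilExp (∑ k, (t + s) k • ω k) =
      nilExp (∑ k, t k • ω k) * nilExp (∑ k, s k • ω k) := by
  rw [← nilExp_add_of_commute _ (isNilpotent_sum_smul hc hn t) (isNilpotent_sum_smul hc hn s)]
  · simp [add_smul, Finset.sum_add_distrib]
  · exact Commute.sum_left _ _ _ fun i _ => Commute.sum_right _ _ _ fun j _ =>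
      ((hc i j).smul_left _).smul_right _

theorem analyticAt_nilExp (hc : ∀ i j, Commute (ω i) (ω j)) (hn : ∀ i, IsNilpotent (ω i))
    (ℓ : A →ₗ[ℂ] ℂ) (t : Fin d → ℂ) :
    AnalyticAt ℂ (fun t : Fin d → ℂ => ℓ (nilExp (∑ k, t k • ω k))) t := by
  obtain ⟨K, -, hK⟩ := exists_nilExp_sum_smul_eq hc hn
  simp only [hK, map_sum, map_smul, smul_eq_mul]
  refine Finset.analyticAt_fun_sum _ fun k _ => analyticAt_const.mul ?_
  refine Finset.analyticAt_fun_sum _ fun a _ => AnalyticAt.mul ?_ analyticAt_const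
  refine Finset.analyticAt_fun_prod _ fun i _ => ?_
  exact (ContinuousLinearMap.proj (R := ℂ) (φ := fun _ : Fin d => ℂ) (a i)).analyticAt t

/-- Differentiability being known, only the directional derivatives matter. Along the `j`-th axis
the exponential factors as `exp(h ω_j)` times a constant, a polynomial in `h` whose linear
coefficient is the derivative. -/
theorem hasFDerivAt_nilExp (hc : ∀ i j, Commute (ω i) (ω j)) (hn : ∀ i, IsNilpotent (ω i))
    (ℓ : A →ₗ[ℂ] ℂ) (t : Fin d → ℂ) :
    HasFDerivAt (fun t : Fin d → ℂ => ℓ (nilExp (∑ k, t k • ω k)))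
      (∑ k, ℓ (ω k * nilExp (∑ k, t k • ω k)) •
        (ContinuousLinearMap.proj k : (Fin d → ℂ) →L[ℂ] ℂ)) t := by
  have hd := (analyticAt_nilExp hc hn ℓ t).differentiableAt
  suffices h : (∑ k, ℓ (ω k * nilExp (∑ k, t k • ω k)) •
      (ContinuousLinearMap.proj k : (Fin d → ℂ) →L[ℂ] ℂ)) = fderiv ℂ _ t from h ▸ hd.hasFDerivAt
  apply ContinuousLinearMap.coe_injective
  apply (Pi.basisFun ℂ (Fin d)).ext
  intro j
  obtain ⟨K, hK⟩ := hn j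
  have h1 : HasDerivAt (fun h : ℂ => t + h • (Pi.single j (1 : ℂ) : Fin d → ℂ))
      (Pi.single j 1) 0 := by
    simpa using ((hasDerivAt_id (0 : ℂ)).smul_const (Pi.single j (1 : ℂ) : Fin d → ℂ)).const_add t
  have h2 := HasFDerivAt.comp_hasDerivAt_of_eq (0 : ℂ) hd.hasFDerivAt h1 (by simp)
  have h3 : (fun t : Fin d → ℂ => ℓ (nilExp (∑ k, t k • ω k))) ∘
      (fun h : ℂ => t + h • (Pi.single j (1 : ℂ) : Fin d → ℂ)) = fun h =>
      ∑ k ∈ Finset.range (K + 2), ((k.factorial : ℂ)⁻¹) * (h ^ k *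
        ℓ (ω j ^ k * nilExp (∑ k, t k • ω k))) := by
    funext h
    simp only [Function.comp]
    rw [add_comm t, nilExp_sum_smul_add hc hn]
    have : ∑ k, (h • (Pi.single j (1 : ℂ) : Fin d → ℂ)) k • ω k = h • ω j := by
      rw [Finset.sum_eq_single j] <;> simp +contextual
    rw [this, nilExp_eq_sum (K := K + 2) (by rw [smul_pow, pow_add (ω j), hK]; simp),
      Finset.sum_mul,
      map_sum]
    refine Finset.sum_congr rfl fun k _ => ?_
    rw [smul_pow, smul_mul_assoc, smul_mul_assoc, map_smul, map_smul, smul_eq_mul, smul_eq_mul]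
  rw [h3] at h2
  have h4 : HasDerivAt (fun h : ℂ => ∑ k ∈ Finset.range (K + 2), ((k.factorial : ℂ)⁻¹) * (h ^ k *
        ℓ (ω j ^ k * nilExp (∑ k, t k • ω k))))
      (∑ k ∈ Finset.range (K + 2), ((k.factorial : ℂ)⁻¹) * ((k : ℂ) * 0 ^ (k - 1) *
        ℓ (ω j ^ k * nilExp (∑ k, t k • ω k)))) 0 :=
    HasDerivAt.fun_sum fun k _ => ((hasDerivAt_pow k (0 : ℂ)).mul_const _).const_mul _
  have h5 := h2.unique h4
  simp only [ContinuousLinearMap.coe_coe, Pi.basisFun_apply]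
  -- At `h = 0` only the term of degree 1 survives; the truncation at `K + 2` guarantees that this
  -- index is in the range.
  rw [h5, Finset.sum_eq_single (s := Finset.range (K + 2)) 1]
  · simp [Pi.single_apply]
  · intro k _ hk
    rcases k with _ | _ | k <;> simp_all
  · simp

end LinearFamily

end

noncomputable section

/-! ### Gaussian integrals of polynomials -/

section Gaussian

open MeasureTheory Filter Topology

variable {ι : Type*} {d : ℕ}

/-- The value of a complex polynomial at a real point. -/
def evalReal (v : ι → ℝ) : MvPolynomial ι ℂ →ₐ[ℂ] ℂ := MvPolynomial.aeval fun i => (v i : ℂ)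

theorem continuous_evalReal (p : MvPolynomial ι ℂ) : Continuous fun v => evalReal v p := by
  induction p using MvPolynomial.induction_on with
  | C a => simpa [evalReal] using continuous_const
  | add p q hp hq => simp only [map_add]; exact hp.add hq
  | mul_X p i hp =>
    simp only [map_mul]
    refine hp.mul ?_
    simp only [evalReal, MvPolynomial.aeval_X]
    fun_prop

variable [Fintype ι]

/-- The polynomial `-½ Σ b_{ij} X_i X_j`. -/
def quadPoly (b : ι → ι → ℝ) : MvPolynomial ι ℂ :=
  MvPolynomial.C (-(1 / 2)) *
    ∑ i, ∑ j, MvPolynomial.C (b i j : ℂ) * MvPolynomial.X i * MvPolynomial.X j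

theorem evalReal_quadPoly (b : ι → ι → ℝ) (v : ι → ℝ) :
    evalReal v (quadPoly b) = ((-(1 / 2) * ∑ i, ∑ j, b i j * v i * v j : ℝ) : ℂ) := by
  simp [evalReal, quadPoly]

/-- For a monomial the integrand is a product of one-variable functions, and the moments of a
Gaussian on the line are finite. -/
theorem integrable_evalReal_mul_exp {c : ℝ} (hc : 0 < c) (p : MvPolynomial ι ℂ) :
    Integrable fun v : ι → ℝ => evalReal v p * (Real.exp (-c * ∑ i, v i ^ 2) : ℂ) := by
  induction p using MvPolynomial.induction_on' with
  | add p q hp hq => simp only [map_add, add_mul]; exact hp.add hq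
  | monomial s a =>
    have h1 : ∀ n : ℕ, Integrable fun x : ℝ => ((x ^ n * Real.exp (-c * x ^ 2) : ℝ) : ℂ) := by
      intro n
      have := integrable_rpow_mul_exp_neg_mul_sq hc (s := n) (by linarith [n.cast_nonneg (α := ℝ)])
      simp only [Real.rpow_natCast] at this
      exact this.ofReal
    have := MeasureTheory.Integrable.fintype_prod (ι := ι) (μ := fun _ => (volume : Measure ℝ))
      (f := fun i x => ((x ^ (s i) * Real.exp (-c * x ^ 2) : ℝ) : ℂ)) fun i => h1 _
    refine (this.const_mul a).congr (Eventually.of_forall fun v => ?_)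
    simp only [Finset.mul_sum, Real.exp_sum]
    simp [evalReal, MvPolynomial.aeval_monomial, Finset.prod_mul_distrib, Finsupp.prod_fintype,
      mul_assoc]

variable (b : Fin d → ι → ι → ℝ)

/-- The real part of the quadratic form `Σ t_k b_k`. -/
def realQuad (t : Fin d → ℂ) (v : ι → ℝ) : ℝ := ∑ k, (t k).re * ∑ i, ∑ j, b k i j * v i * v j

/-- The parameters for which the Gaussian integral converges. -/
def gaussDomain : Set (Fin d → ℂ) := {t | ∀ v : ι → ℝ, v ≠ 0 → 0 < realQuad b t v}

theorem continuous_realQuad :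
    Continuous fun z : (Fin d → ℂ) × (ι → ℝ) => realQuad b z.1 z.2 := by
  unfold realQuad
  fun_prop

theorem realQuad_smul (t : Fin d → ℂ) (r : ℝ) (v : ι → ℝ) :
    realQuad b t (r • v) = r ^ 2 * realQuad b t v := by
  simp only [realQuad, Finset.mul_sum, Pi.smul_apply, smul_eq_mul]
  refine Finset.sum_congr rfl fun k _ => Finset.sum_congr rfl fun i _ =>
    Finset.sum_congr rfl fun j _ => by ring

variable {b}

/-- Positivity on the compact unit sphere gives a lower bound there which persists for nearby
parameters, and homogeneity carries it to all vectors. Uniformity near `x` is what dominated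
convergence needs. -/
theorem exists_le_realQuad {x : Fin d → ℂ} (hx : x ∈ gaussDomain b) :
    ∃ c > 0, ∀ᶠ t in 𝓝 x, ∀ v, c * ∑ i, v i ^ 2 ≤ realQuad b t v := by
  have hK : IsCompact (Metric.sphere (0 : ι → ℝ) 1) := isCompact_sphere _ _
  obtain ⟨c, hc, hcK⟩ : ∃ c > 0, ∀ v ∈ Metric.sphere (0 : ι → ℝ) 1, c < realQuad b x v := by
    -- The sphere is empty when there are no coordinates, that is for `V₀ = 0`.
    rcases (Metric.sphere (0 : ι → ℝ) 1).eq_empty_or_nonempty with h | h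
    · exact ⟨1, one_pos, by simp [h]⟩
    · obtain ⟨v, hv, hmin⟩ := hK.exists_isMinOn h
        ((continuous_realQuad b).comp (Continuous.prodMk_right x)).continuousOn
      have hv0 : 0 < realQuad b x v := hx v (by rintro rfl; simp at hv)
      exact ⟨realQuad b x v / 2, by linarith, fun w hw => by
        have := hmin hw; simp only [Set.mem_ofPred_eq, Function.comp] at this; linarith⟩
  have hev : ∀ᶠ t in 𝓝 x, ∀ v ∈ Metric.sphere (0 : ι → ℝ) 1, c < realQuad b t v := by
    refine hK.eventually_forall_of_forall_eventually fun v hv => ?_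
    exact (continuous_realQuad b).continuousAt.eventually_const_lt (hcK v hv)
  -- The norm is the supremum norm, so the sum of squares is at most `card ι` times its square; the
  -- added 1 keeps `N` positive when `ι` is empty.
  set N : ℝ := (Fintype.card ι : ℝ) + 1
  have hN : 0 < N := by positivity
  refine ⟨c / N, by positivity, hev.mono fun t ht v => ?_⟩
  rcases eq_or_ne v 0 with rfl | hv
  · simp [realQuad]
  have hv' : 0 < ‖v‖ := norm_pos_iff.2 hv
  have h1 := ht (‖v‖⁻¹ • v) (by simp [norm_smul, hv'.ne'])
  rw [realQuad_smul] at h1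
  have h2 : c * ‖v‖ ^ 2 ≤ realQuad b t v := by
    rw [inv_pow, inv_mul_eq_div, lt_div_iff₀ (by positivity)] at h1
    exact h1.le
  have h3 : ∑ i, v i ^ 2 ≤ N * ‖v‖ ^ 2 := by
    calc ∑ i, v i ^ 2 ≤ ∑ _i : ι, ‖v‖ ^ 2 := Finset.sum_le_sum fun i _ => by
          rw [← sq_abs]; exact pow_le_pow_left₀ (abs_nonneg _) (norm_le_pi_norm v i) 2
      _ ≤ N * ‖v‖ ^ 2 := by
          simp only [Finset.sum_const, Finset.card_univ, nsmul_eq_mul, N]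
          nlinarith [sq_nonneg ‖v‖]
  calc c / N * ∑ i, v i ^ 2 ≤ c / N * (N * ‖v‖ ^ 2) := by gcongr
    _ = c * ‖v‖ ^ 2 := by field_simp
    _ ≤ _ := h2

theorem isOpen_gaussDomain : IsOpen (gaussDomain b) := by
  rw [isOpen_iff_mem_nhds]
  intro x hx
  obtain ⟨c, hc, h⟩ := exists_le_realQuad hx
  filter_upwards [h] with t ht v hv
  refine lt_of_lt_of_le (mul_pos hc ?_) (ht v)
  obtain ⟨i, hi⟩ := Function.ne_iff.1 hv
  exact Finset.sum_pos' (fun i _ => sq_nonneg _) ⟨i, Finset.mem_univ _, by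
    simpa [sq_pos_iff] using hi⟩

variable (b)

/-- The integrand `exp(Σ t_k Q_k(v))`, where `Q_k = -½ b_k`. -/
def gaussian (t : Fin d → ℂ) (v : ι → ℝ) : ℂ :=
  Complex.exp (∑ k, t k * evalReal v (quadPoly (b k)))

theorem continuous_gaussian (t : Fin d → ℂ) : Continuous (gaussian b t) := by
  unfold gaussian
  exact Complex.continuous_exp.comp
    (continuous_finsetSum _ fun k _ => continuous_const.mul (continuous_evalReal _))

theorem norm_gaussian (t : Fin d → ℂ) (v : ι → ℝ) :
    ‖gaussian b t v‖ = Real.exp (-(1 / 2) * realQuad b t v) := by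
  rw [gaussian, Complex.norm_exp]
  congr 1
  simp only [evalReal_quadPoly, Complex.re_sum, Complex.re_mul_ofReal, realQuad, Finset.mul_sum]
  refine Finset.sum_congr rfl fun k _ => Finset.sum_congr rfl fun i _ =>
    Finset.sum_congr rfl fun j _ => by ring

/-- The Gaussian integral of a polynomial. -/
def gaussInt (p : MvPolynomial ι ℂ) (t : Fin d → ℂ) : ℂ := ∫ v, gaussian b t v * evalReal v p

variable {b}

theorem exists_norm_gaussian_le {x : Fin d → ℂ} (hx : x ∈ gaussDomain b) :
    ∃ c > 0, ∀ᶠ t in 𝓝 x, ∀ v, ‖gaussian b t v‖ ≤ Real.exp (-c * ∑ i, v i ^ 2) := by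
  obtain ⟨c, hc, h⟩ := exists_le_realQuad hx
  refine ⟨c / 2, by positivity, h.mono fun t ht v => ?_⟩
  rw [norm_gaussian]
  exact Real.exp_le_exp.2 (by linarith [ht v])

theorem integrable_gaussian_mul {t : Fin d → ℂ} (ht : t ∈ gaussDomain b) (p : MvPolynomial ι ℂ) :
    Integrable fun v => gaussian b t v * evalReal v p := by
  obtain ⟨c, hc, h⟩ := exists_norm_gaussian_le ht
  refine (integrable_evalReal_mul_exp hc p).mono
    ((continuous_gaussian b t).mul (continuous_evalReal p)).aestronglyMeasurable
    (Eventually.of_forall fun v => ?_)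
  rw [norm_mul, norm_mul, mul_comm, Complex.norm_real, Real.norm_of_nonneg (Real.exp_pos _).le]
  gcongr
  exact h.self_of_nhds v

theorem gaussInt_add {t : Fin d → ℂ} (ht : t ∈ gaussDomain b) (p q : MvPolynomial ι ℂ) :
    gaussInt b (p + q) t = gaussInt b p t + gaussInt b q t := by
  simp only [gaussInt, map_add, mul_add]
  exact integral_add (integrable_gaussian_mul ht p) (integrable_gaussian_mul ht q)

theorem gaussInt_smul (t : Fin d → ℂ) (c : ℂ) (p : MvPolynomial ι ℂ) :
    gaussInt b (c • p) t = c * gaussInt b p t := by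
  simp only [gaussInt, map_smul, smul_eq_mul, mul_left_comm _ c]
  exact integral_const_mul _ _

/-- Differentiation under the integral sign: near `t` all Gaussians are dominated by one fixed
Gaussian, against which every polynomial is integrable. -/
theorem hasFDerivAt_gaussInt {t : Fin d → ℂ} (ht : t ∈ gaussDomain b) (p : MvPolynomial ι ℂ) :
    HasFDerivAt (gaussInt b p)
      (∑ k, gaussInt b (quadPoly (b k) * p) t •
        (ContinuousLinearMap.proj k : (Fin d → ℂ) →L[ℂ] ℂ)) t := by
  obtain ⟨c, hc, h⟩ := exists_norm_gaussian_le ht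
  let π : Fin d → (Fin d → ℂ) →L[ℂ] ℂ := fun k => ContinuousLinearMap.proj k
  let F' : (Fin d → ℂ) → (ι → ℝ) → ((Fin d → ℂ) →L[ℂ] ℂ) := fun x v =>
    ∑ k, (gaussian b x v * evalReal v (quadPoly (b k) * p)) • π k
  have key := hasFDerivAt_integral_of_dominated_of_fderiv_le (𝕜 := ℂ) (μ := volume)
    (F := fun x v => gaussian b x v * evalReal v p) (F' := F') (x₀ := t)
    (bound := fun v => ∑ k, ‖evalReal v (quadPoly (b k) * p) * (Real.exp (-c * ∑ i, v i ^ 2) : ℂ)‖ *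
      ‖π k‖) h
    (Eventually.of_forall fun x =>
      ((continuous_gaussian b x).mul (continuous_evalReal p)).aestronglyMeasurable)
    (integrable_gaussian_mul ht p) ?_ ?_ ?_ ?_
  · refine key.congr_fderiv ?_
    simp only [F']
    rw [integral_finsetSum]
    · exact Finset.sum_congr rfl fun k _ => integral_smul_const _ _
    · exact fun k _ => (integrable_gaussian_mul ht _).smul_const _
  · exact (continuous_finsetSum _ fun k _ => ((continuous_gaussian b t).mul
      (continuous_evalReal _)).smul continuous_const).aestronglyMeasurable
  · refine Eventually.of_forall fun v x hx => (norm_sum_le _ _).trans ?_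
    refine Finset.sum_le_sum fun k _ => ?_
    rw [norm_smul, norm_mul, norm_mul, mul_comm ‖gaussian b x v‖, Complex.norm_real,
      Real.norm_of_nonneg (Real.exp_pos _).le]
    gcongr
    exact hx v
  · exact integrable_finsetSum _ fun k _ => (integrable_evalReal_mul_exp hc _).norm.mul_const _
  · refine Eventually.of_forall fun v x _ => ?_
    have h1 : HasFDerivAt (fun x : Fin d → ℂ => ∑ k, x k * evalReal v (quadPoly (b k)))
        (∑ k, evalReal v (quadPoly (b k)) • π k) x :=
      HasFDerivAt.fun_sum fun k _ => (π k).hasFDerivAt.mul_const _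
    refine (h1.cexp.mul_const (evalReal v p)).congr_fderiv ?_
    simp only [F', gaussian, Finset.smul_sum, smul_smul, map_mul]
    refine Finset.sum_congr rfl fun k _ => ?_
    congr 1
    ring

theorem exists_sum_norm_quadPoly_le (b : Fin d → ι → ι → ℝ) :
    ∃ C ≥ 0, ∀ v : ι → ℝ, ∑ k, ‖evalReal v (quadPoly (b k))‖ ≤ C * ∑ i, v i ^ 2 := by
  refine ⟨∑ k, ∑ i, ∑ j, |b k i j|, by positivity, fun v => ?_⟩
  rw [Finset.sum_mul]
  refine Finset.sum_le_sum fun k _ => ?_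
  rw [evalReal_quadPoly, Complex.norm_real, Real.norm_eq_abs, abs_mul, Finset.sum_mul]
  have h : |∑ i, ∑ j, b k i j * v i * v j| ≤ ∑ i, (∑ j, |b k i j|) * ∑ i, v i ^ 2 := by
    refine (Finset.abs_sum_le_sum_abs _ _).trans (Finset.sum_le_sum fun i _ => ?_)
    rw [Finset.sum_mul]
    refine (Finset.abs_sum_le_sum_abs _ _).trans (Finset.sum_le_sum fun j _ => ?_)
    rw [mul_assoc, abs_mul]
    refine mul_le_mul_of_nonneg_left ?_ (abs_nonneg _)
    have h1 : ∀ i, v i ^ 2 ≤ ∑ i, v i ^ 2 := fun i =>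
      Finset.single_le_sum (f := fun i => v i ^ 2) (fun i _ => sq_nonneg _) (Finset.mem_univ i)
    rw [abs_mul]
    nlinarith [h1 i, h1 j, sq_nonneg (|v i| - |v j|), sq_abs (v i), sq_abs (v j)]
  have h2 : |(-(1 / 2) : ℝ)| ≤ 1 := by norm_num [abs_of_nonpos]
  calc _ ≤ 1 * |∑ i, ∑ j, b k i j * v i * v j| := by gcongr
    _ ≤ _ := by rw [one_mul]; exact h

/-- The Taylor series of `gaussInt b p` at `x`. -/
def gaussSeries (b : Fin d → ι → ι → ℝ) (p : MvPolynomial ι ℂ) (x : Fin d → ℂ) :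
    FormalMultilinearSeries ℂ (Fin d → ℂ) ℂ := fun n =>
  ∑ a : Fin n → Fin d, ((n.factorial : ℂ)⁻¹ * gaussInt b ((∏ i, quadPoly (b (a i))) * p) x) •
    (ContinuousMultilinearMap.mkPiAlgebraFin ℂ n ℂ).compContinuousLinearMap
      fun i => ContinuousLinearMap.proj (a i)

theorem gaussSeries_apply (b : Fin d → ι → ι → ℝ) (p : MvPolynomial ι ℂ) (x : Fin d → ℂ) (n : ℕ)
    (y : Fin n → Fin d → ℂ) : gaussSeries b p x n y = ∑ a : Fin n → Fin d,
      ((n.factorial : ℂ)⁻¹ * gaussInt b ((∏ i, quadPoly (b (a i))) * p) x) * ∏ i, y i (a i) := by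
  simp [gaussSeries, List.prod_ofFn]

theorem sum_mul_prod_pow {R : Type*} [CommSemiring R] (q y : Fin d → R) (n : ℕ) :
    ∑ a : Fin n → Fin d, (∏ i, q (a i)) * ∏ i, y (a i) = (∑ k, y k * q k) ^ n := by
  rw [Finset.sum_pow', Fintype.piFinset_univ]
  refine Finset.sum_congr rfl fun a _ => ?_
  rw [← Finset.prod_mul_distrib]
  exact Finset.prod_congr rfl fun i _ => mul_comm _ _

/-- On the diagonal the sum over multi-indices collapses to the `n`-th term of the exponential
series of `Σ y_k Q_k(v)`, under the integral sign. -/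
theorem gaussSeries_apply_diag {x : Fin d → ℂ} (hx : x ∈ gaussDomain b) (p : MvPolynomial ι ℂ)
    (n : ℕ) (y : Fin d → ℂ) : gaussSeries b p x n (fun _ => y) = ∫ v,
      (∑ k, y k * evalReal v (quadPoly (b k))) ^ n / n.factorial *
        (gaussian b x v * evalReal v p) := by
  have h : ∀ a : Fin n → Fin d,
      ((n.factorial : ℂ)⁻¹ * gaussInt b ((∏ i, quadPoly (b (a i))) * p) x) * ∏ i, y (a i) =
      ∫ v, ((n.factorial : ℂ)⁻¹ * ∏ i, y (a i)) *
        (gaussian b x v * evalReal v ((∏ i, quadPoly (b (a i))) * p)) := fun a => by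
    rw [integral_const_mul, gaussInt]; ring
  rw [gaussSeries_apply, Finset.sum_congr rfl fun a _ => h a,
    ← integral_finsetSum _ fun a _ => (integrable_gaussian_mul hx _).const_mul _]
  refine integral_congr_ae (Eventually.of_forall fun v => ?_)
  simp only [map_mul, map_prod]
  rw [← sum_mul_prod_pow, Finset.sum_div, Finset.sum_mul]
  exact Finset.sum_congr rfl fun a _ => by ring

theorem Complex.hasSum_pow_div_factorial (z : ℂ) :
    HasSum (fun n : ℕ => z ^ n / n.factorial) (Complex.exp z) := by
  rw [Complex.exp_eq_exp_ℂ]; exact NormedSpace.expSeries_div_hasSum_exp z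

theorem Real.hasSum_pow_div_factorial (z : ℝ) :
    HasSum (fun n : ℕ => z ^ n / n.factorial) (Real.exp z) := by
  rw [Real.exp_eq_exp_ℝ]; exact NormedSpace.expSeries_div_hasSum_exp z

/-- Convergence comes from expanding `exp(Σ y_k Q_k(v))` under the integral. Since `|Q_k(v)|` grows
at most like `|v|²`, for small `y` the dominating factor `exp(r S(v))` costs only part of the
Gaussian decay. -/
theorem analyticAt_gaussInt {x : Fin d → ℂ} (hx : x ∈ gaussDomain b) (p : MvPolynomial ι ℂ) :
    AnalyticAt ℂ (gaussInt b p) x := by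
  obtain ⟨c, hc, hg⟩ := exists_norm_gaussian_le hx
  replace hg := hg.self_of_nhds
  obtain ⟨C, hC, hS⟩ := exists_sum_norm_quadPoly_le b
  set S : (ι → ℝ) → ℝ := fun v => ∑ k, ‖evalReal v (quadPoly (b k))‖ with hSdef
  have hS0 : ∀ v, 0 ≤ S v := fun v => by positivity
  have hScont : Continuous S := continuous_finsetSum _ fun k _ => (continuous_evalReal _).norm
  -- With this radius `r S(v) ≤ (c/2) Σ v_i²`, half of the available decay; `C + 1` replaces `C` to
  -- allow `C = 0`.
  let r : NNReal := ⟨c / (2 * (C + 1)), by positivity⟩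
  have hr : (r : ℝ) = c / (2 * (C + 1)) := rfl
  have hr0 : 0 < (r : ℝ) := by rw [hr]; positivity
  let w : (ι → ℝ) → ℝ := fun v => ‖gaussian b x v‖ * ‖evalReal v p‖
  have hw0 : ∀ v, 0 ≤ w v := fun v => by positivity
  have hwcont : Continuous w := (continuous_gaussian b x).norm.mul (continuous_evalReal p).norm
  have hInt : Integrable fun v => Real.exp (r * S v) * w v := by
    refine (integrable_evalReal_mul_exp (half_pos hc) p).mono
      (by fun_prop) (Eventually.of_forall fun v => ?_)
    have h1 : r * S v ≤ c / 2 * ∑ i, v i ^ 2 := by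
      have h2 : 0 ≤ ∑ i, v i ^ 2 := by positivity
      calc r * S v ≤ r * (C * ∑ i, v i ^ 2) := by gcongr; exact hS v
        _ ≤ r * ((C + 1) * ∑ i, v i ^ 2) := by gcongr; linarith
        _ = c / 2 * ∑ i, v i ^ 2 := by rw [hr]; field_simp
    rw [Real.norm_of_nonneg (mul_nonneg (Real.exp_pos _).le (hw0 v)), norm_mul, Complex.norm_real,
      Real.norm_of_nonneg (Real.exp_pos _).le, mul_comm ‖evalReal v p‖, ← mul_assoc]
    refine mul_le_mul_of_nonneg_right ?_ (norm_nonneg _)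
    calc Real.exp (r * S v) * ‖gaussian b x v‖
        ≤ Real.exp (c / 2 * ∑ i, v i ^ 2) * Real.exp (-c * ∑ i, v i ^ 2) := by
          gcongr; exact hg v
      _ = Real.exp (-(c / 2) * ∑ i, v i ^ 2) := by rw [← Real.exp_add]; congr 1; ring
  have hpow : ∀ n v, (r * S v) ^ n / n.factorial * w v ≤ Real.exp (r * S v) * w v := fun n v => by
    gcongr
    exact Real.pow_div_factorial_le_exp _ (by positivity) n
  have hbound : ∀ n, ‖gaussSeries b p x n‖ * (r : ℝ) ^ n ≤ ∫ v, Real.exp (r * S v) * w v := by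
    intro n
    have h1 : ‖gaussSeries b p x n‖ ≤ ∑ a : Fin n → Fin d,
        ‖(n.factorial : ℂ)⁻¹ * gaussInt b ((∏ i, quadPoly (b (a i))) * p) x‖ := by
      refine ContinuousMultilinearMap.opNorm_le_bound (by positivity) fun y => ?_
      rw [gaussSeries_apply, Finset.sum_mul]
      refine (norm_sum_le _ _).trans (Finset.sum_le_sum fun a _ => ?_)
      rw [norm_mul, norm_prod]
      gcongr with i
      exact norm_le_pi_norm _ _
    have hi : ∀ a : Fin n → Fin d, Integrable fun v =>
        ‖gaussian b x v * evalReal v ((∏ i, quadPoly (b (a i))) * p)‖ :=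
      fun a => (integrable_gaussian_mul hx _).norm
    have h2 : ∑ a : Fin n → Fin d,
        ‖(n.factorial : ℂ)⁻¹ * gaussInt b ((∏ i, quadPoly (b (a i))) * p) x‖ ≤
        (n.factorial : ℝ)⁻¹ * ∫ v, ∑ a : Fin n → Fin d,
          ‖gaussian b x v * evalReal v ((∏ i, quadPoly (b (a i))) * p)‖ := by
      rw [integral_finsetSum _ fun a _ => hi a, Finset.mul_sum]
      refine Finset.sum_le_sum fun a _ => ?_
      rw [norm_mul, norm_inv, Complex.norm_natCast]
      gcongr
      exact norm_integral_le_integral_norm _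
    calc ‖gaussSeries b p x n‖ * (r : ℝ) ^ n
        ≤ (n.factorial : ℝ)⁻¹ * (∫ v, ∑ a : Fin n → Fin d,
          ‖gaussian b x v * evalReal v ((∏ i, quadPoly (b (a i))) * p)‖) * (r : ℝ) ^ n := by
          gcongr; exact h1.trans h2
      _ = ∫ v, (n.factorial : ℝ)⁻¹ * (∑ a : Fin n → Fin d,
          ‖gaussian b x v * evalReal v ((∏ i, quadPoly (b (a i))) * p)‖) * (r : ℝ) ^ n := by
          rw [integral_mul_const, integral_const_mul]
      _ ≤ _ := by
          refine integral_mono ?_ hInt fun v => ?_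
          · exact ((integrable_finsetSum _ fun a _ => hi a).const_mul _).mul_const _
          · refine le_trans (le_of_eq ?_) (hpow n v)
            -- Summing the norms over all multi-indices gives exactly the `n`-th power of `S`, so
            -- that the bound by the exponential series loses nothing.
            have h3 : ∑ a : Fin n → Fin d,
                ‖gaussian b x v * evalReal v ((∏ i, quadPoly (b (a i))) * p)‖ = S v ^ n * w v := by
              rw [hSdef, Finset.sum_pow', Fintype.piFinset_univ, Finset.sum_mul]
              refine Finset.sum_congr rfl fun a _ => ?_
              simp only [w, norm_mul, map_mul, map_prod, norm_prod]
              ring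
            simp only [h3]
            rw [mul_pow]; ring
  refine ⟨gaussSeries b p x, r, ?_, by simpa using hr0, fun {y} hy => ?_⟩
  · exact FormalMultilinearSeries.le_radius_of_bound _ _ hbound
  have hy' : ∀ k, ‖y k‖ ≤ r := fun k => (norm_le_pi_norm y k).trans (by
    have : ‖y‖ < r := by simpa [edist_zero_right, enorm_eq_nnnorm, ← NNReal.coe_lt_coe] using hy
    exact this.le)
  have hz : ∀ v, ‖∑ k, y k * evalReal v (quadPoly (b k))‖ ≤ r * S v := fun v => by
    rw [hSdef, Finset.mul_sum]
    refine (norm_sum_le _ _).trans (Finset.sum_le_sum fun k _ => ?_)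
    rw [norm_mul]
    gcongr
    exact hy' k
  have hadd : ∀ v, gaussian b (x + y) v * evalReal v p = Complex.exp
      (∑ k, y k * evalReal v (quadPoly (b k))) * (gaussian b x v * evalReal v p) := fun v => by
    simp only [gaussian, Pi.add_apply, add_mul, Finset.sum_add_distrib, Complex.exp_add]
    ring
  have hsumR : ∀ v, HasSum (fun n : ℕ => (r * S v) ^ n / n.factorial * w v)
      (Real.exp (r * S v) * w v) := fun v => (Real.hasSum_pow_div_factorial (r * S v)).mul_right (w v)
  simp only [gaussSeries_apply_diag hx]
  -- Sum and integral are exchanged: the partial sums are dominated by `exp(r S(v)) w(v)`.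
  refine hasSum_integral_of_dominated_convergence
    (bound := fun n v => (r * S v) ^ n / n.factorial * w v) ?_ ?_ ?_ ?_ ?_
  · intro n
    refine Continuous.aestronglyMeasurable (Continuous.mul ?_
      ((continuous_gaussian b x).mul (continuous_evalReal p)))
    exact ((continuous_finsetSum _ fun k _ => continuous_const.mul
      (continuous_evalReal _)).pow n).div_const _
  · refine fun n => Eventually.of_forall fun v => ?_
    rw [norm_mul, norm_mul, norm_div, norm_pow, Complex.norm_natCast]
    refine mul_le_mul_of_nonneg_right ?_ (hw0 v)
    gcongr
    exact hz v
  · exact Eventually.of_forall fun v => (hsumR v).summable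
  · simpa only [fun v => (hsumR v).tsum_eq] using hInt
  · refine Eventually.of_forall fun v => ?_
    rw [hadd]
    exact (Complex.hasSum_pow_div_factorial _).mul_right _

end Gaussian

end

noncomputable section

/-! ### Taylor's formula for families of functions closed under differentiation -/

section Family

variable {𝕜 E : Type*} [NontriviallyNormedField 𝕜] [NormedAddCommGroup E] [NormedSpace 𝕜 E] {d : ℕ}
  {U : Set (Fin d → 𝕜)} {g : List (Fin d) → (Fin d → 𝕜) → E}

/-- The functions are indexed by words and a partial derivative prefixes a letter. The family is
closed under differentiation, so one derivative for every member yields all orders by induction. -/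
theorem contDiffOn_of_family (hU : IsOpen U)
    (hg : ∀ l, ∀ t ∈ U, HasFDerivAt (g l)
      (∑ k, (ContinuousLinearMap.proj k : (Fin d → 𝕜) →L[𝕜] 𝕜).smulRight (g (k :: l) t)) t)
    (n : ℕ) (l : List (Fin d)) : ContDiffOn 𝕜 n (g l) U := by
  induction n generalizing l with
  | zero => exact contDiffOn_zero.2 fun t ht => (hg l t ht).continuousAt.continuousWithinAt
  | succ n ih =>
    rw [show ((n + 1 : ℕ) : WithTop ℕ∞) = (n : WithTop ℕ∞) + 1 by norm_cast,
      contDiffOn_succ_iff_fderiv_of_isOpen hU]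
    refine ⟨fun t ht => (hg l t ht).differentiableAt.differentiableWithinAt, by simp, ?_⟩
    refine ContDiffOn.congr ?_ fun t ht => (hg l t ht).fderiv
    refine ContDiffOn.sum fun k _ => ?_
    exact contDiffOn_const.smulRight (ih _)

theorem iteratedFDeriv_of_family (hU : IsOpen U)
    (hg : ∀ l, ∀ t ∈ U, HasFDerivAt (g l)
      (∑ k, (ContinuousLinearMap.proj k : (Fin d → 𝕜) →L[𝕜] 𝕜).smulRight (g (k :: l) t)) t)
    (l : List (Fin d)) (n : ℕ) (a : Fin n → Fin d) {t : Fin d → 𝕜} (ht : t ∈ U) :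
    iteratedFDeriv 𝕜 n (g l) t (fun i => Pi.single (a i) 1) = g (List.ofFn a ++ l) t := by
  induction n generalizing t with
  | zero => simp
  | succ n ih =>
    have hd : DifferentiableAt 𝕜 (iteratedFDeriv 𝕜 n (g l)) t := by
      have h1 : ContDiffAt 𝕜 ((n + 1 : ℕ) : WithTop ℕ∞) (g l) t :=
        (contDiffOn_of_family hU hg (n + 1) l).contDiffAt (hU.mem_nhds ht)
      exact h1.differentiableAt_iteratedFDeriv (by exact_mod_cast n.lt_succ_self)
    rw [iteratedFDeriv_succ_apply_left]
    let e : Fin n → Fin d → 𝕜 := fun i => Pi.single (a i.succ) 1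
    have h2 : HasFDerivAt (fun y => iteratedFDeriv 𝕜 n (g l) y e)
        ((ContinuousMultilinearMap.apply 𝕜 (fun _ : Fin n => Fin d → 𝕜) E e).comp
          (fderiv 𝕜 (iteratedFDeriv 𝕜 n (g l)) t)) t :=
      (ContinuousMultilinearMap.apply 𝕜 (fun _ : Fin n => Fin d → 𝕜) E e).hasFDerivAt.comp t
        hd.hasFDerivAt
    have h3 : (fun y => iteratedFDeriv 𝕜 n (g l) y e) =ᶠ[nhds t]
        g (List.ofFn (fun i => a i.succ) ++ l) := by
      filter_upwards [hU.mem_nhds ht] with y hy using ih _ hy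
    have h4 := (h2.congr_of_eventuallyEq h3.symm).unique (hg _ t ht)
    have h5 := congrArg (fun f => f (Pi.single (a 0) 1)) h4
    simp only [ContinuousLinearMap.comp_apply, ContinuousMultilinearMap.apply_apply] at h5
    change (fderiv 𝕜 (iteratedFDeriv 𝕜 n (g l)) t) (Pi.single (a 0) 1) e = _
    rw [h5]
    simp [Pi.single_apply, List.ofFn_succ]

/-- If one element `D(a)` represents the mixed derivatives through every linear form, the
coordinates in the auxiliary basis reassemble and Taylor's formula becomes an identity in the
algebra. The bound `K` makes the series a finite sum. -/
theorem taylorValueAlg_eq_sum {𝕜 : Type*} [NontriviallyNormedField 𝕜] [NormedSpace 𝕜 ℂ]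
    {C : Type*} [Ring C] [Algebra ℂ C] [Module.Finite ℂ C] {d : ℕ}
    {g : (Fin d → 𝕜) → C} {x : Fin d → 𝕜} {s : Fin d → C}
    {D : List (Fin d) → C}
    (hD : ∀ (ℓ : C →ₗ[ℂ] ℂ) (k : ℕ) (a : Fin k → Fin d),
      iteratedFDeriv 𝕜 k (fun t => ℓ (g t)) x (fun i => Pi.single (a i) 1) = ℓ (D (List.ofFn a)))
    {K : ℕ} (hK : ∀ k, K ≤ k → ∀ a : Fin k → Fin d, (List.ofFn fun i => s (a i)).prod = 0) :
    taylorValueAlg 𝕜 g x s = ∑ k ∈ Finset.range K, ((k.factorial : ℂ)⁻¹) •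
      ∑ a : Fin k → Fin d, D (List.ofFn a) * (List.ofFn fun i => s (a i)).prod := by
  have h1 : ∀ r, taylorValue 𝕜 (fun t => (Module.finBasis ℂ C).coord r (g t)) x s =
      ∑ k ∈ Finset.range K, ((k.factorial : ℂ)⁻¹) • ∑ a : Fin k → Fin d,
        (Module.finBasis ℂ C).coord r (D (List.ofFn a)) • (List.ofFn fun i => s (a i)).prod := by
    intro r
    rw [taylorValue]
    simp only [hD]
    refine finsum_eq_sum_of_support_subset _ fun k hk => ?_
    by_contra hk'
    simp only [Finset.coe_range, Set.mem_Iio, not_lt] at hk'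
    exact hk (by simp [hK k hk'])
  rw [taylorValueAlg]
  simp only [h1, Finset.mul_sum, mul_smul_comm, Finset.smul_sum]
  rw [Finset.sum_comm]
  refine Finset.sum_congr rfl fun k _ => ?_
  rw [Finset.sum_comm]
  refine Finset.sum_congr rfl fun a _ => ?_
  rw [← Finset.smul_sum]
  congr 1
  conv_rhs => rw [← (Module.finBasis ℂ C).sum_repr (D (List.ofFn a)), Finset.sum_mul]
  exact Finset.sum_congr rfl fun r _ => by simp

end Family

/-! ### Gaussian integrals with values in an algebra -/

section GaussAlgebra

open MeasureTheory Filter Topology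

variable {ι : Type*} [Fintype ι] {d : ℕ} {A C : Type*} [Ring A] [Algebra ℂ A] [Ring C] [Algebra ℂ C]

open Classical in
/-- The Gaussian integral as a linear form on polynomials. -/
def gaussForm (b : Fin d → ι → ι → ℝ) (t : Fin d → ℂ) : MvPolynomial ι ℂ →ₗ[ℂ] ℂ :=
  if ht : t ∈ gaussDomain b then
    { toFun := fun p => gaussInt b p t
      map_add' := gaussInt_add ht
      map_smul' := gaussInt_smul t }
  else 0

theorem gaussForm_apply {b : Fin d → ι → ι → ℝ} {t : Fin d → ℂ} (ht : t ∈ gaussDomain b)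
    (p : MvPolynomial ι ℂ) : gaussForm b t p = gaussInt b p t := by
  simp [gaussForm, ht]

/-- `Φ ↦ ∫ exp(Σ t_k Q_k(v)) β(exp(Σ t_k ω_k) Φ(v)) dv` for a polynomial `Φ` with coefficients in an
algebra `A`. -/
def gaussAlg (b : Fin d → ι → ι → ℝ) (ω : Fin d → A) (β : A →ₗ[ℂ] C) (t : Fin d → ℂ) :
    MvPolynomial ι ℂ ⊗[ℂ] A →ₗ[ℂ] C :=
  (TensorProduct.lid ℂ C).toLinearMap ∘ₗ TensorProduct.map (gaussForm b t)
    (β ∘ₗ LinearMap.mulLeft ℂ (nilExp (∑ k, t k • ω k)))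

variable {b : Fin d → ι → ι → ℝ} {ω : Fin d → A} {β : A →ₗ[ℂ] C}

theorem gaussAlg_tmul (t : Fin d → ℂ) (p : MvPolynomial ι ℂ) (w : A) :
    gaussAlg b ω β t (p ⊗ₜ w) = gaussForm b t p • β (nilExp (∑ k, t k • ω k) * w) := by
  simp [gaussAlg]

/-- The derivative of the exponent `Σ t_k (Q_k + ω_k)` with respect to `t_k`. -/
def gaussWeight (b : Fin d → ι → ι → ℝ) (ω : Fin d → A) (k : Fin d) : MvPolynomial ι ℂ ⊗[ℂ] A :=
  quadPoly (b k) ⊗ₜ 1 + 1 ⊗ₜ ω k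

theorem analyticAt_gaussAlg (hc : ∀ i j, Commute (ω i) (ω j)) (hn : ∀ i, IsNilpotent (ω i))
    {t : Fin d → ℂ} (ht : t ∈ gaussDomain b) (ℓ : C →ₗ[ℂ] ℂ) (Φ : MvPolynomial ι ℂ ⊗[ℂ] A) :
    AnalyticAt ℂ (fun t => ℓ (gaussAlg b ω β t Φ)) t := by
  induction Φ with
  | zero => simpa using analyticAt_const
  | add Φ Ψ h1 h2 => simp only [map_add]; exact h1.add h2
  | tmul p w =>
    have h1 := (analyticAt_gaussInt ht p).mul
      (analyticAt_nilExp hc hn (ℓ ∘ₗ β ∘ₗ LinearMap.mulRight ℂ w) t)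
    refine h1.congr ?_
    -- `gaussForm` is the integral only inside the domain, so the identity is one of germs, which
    -- openness of the domain allows.
    filter_upwards [isOpen_gaussDomain.mem_nhds ht] with x hx
    simp [gaussAlg_tmul, gaussForm_apply hx]

/-- By the product rule: the scalar Gaussian contributes `Q_k ⊗ 1` and the nilpotent exponential
contributes `1 ⊗ ω_k`, together the weight. -/
theorem hasFDerivAt_gaussAlg (hc : ∀ i j, Commute (ω i) (ω j)) (hn : ∀ i, IsNilpotent (ω i))
    {t : Fin d → ℂ} (ht : t ∈ gaussDomain b) (ℓ : C →ₗ[ℂ] ℂ) (Φ : MvPolynomial ι ℂ ⊗[ℂ] A) :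
    HasFDerivAt (fun t => ℓ (gaussAlg b ω β t Φ))
      (∑ k, (ContinuousLinearMap.proj k : (Fin d → ℂ) →L[ℂ] ℂ).smulRight
        (ℓ (gaussAlg b ω β t (gaussWeight b ω k * Φ)))) t := by
  induction Φ with
  | zero => simpa using hasFDerivAt_const _ _
  | add Φ Ψ h1 h2 =>
    simp only [map_add]
    refine (h1.add h2).congr_fderiv ?_
    rw [← Finset.sum_add_distrib]
    refine Finset.sum_congr rfl fun k _ => ?_
    ext
    simp [mul_add]
  | tmul p w =>
    have h1 := (hasFDerivAt_gaussInt ht p).mul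
      (hasFDerivAt_nilExp hc hn (ℓ ∘ₗ β ∘ₗ LinearMap.mulRight ℂ w) t)
    refine (h1.congr_of_eventuallyEq ?_).congr_fderiv ?_
    · filter_upwards [isOpen_gaussDomain.mem_nhds ht] with x hx
      simp [gaussAlg_tmul, gaussForm_apply hx]
    · rw [Finset.smul_sum, Finset.smul_sum, ← Finset.sum_add_distrib]
      refine Finset.sum_congr rfl fun k _ => ?_
      -- The derivative produces `ω_k` to the left of the exponential, while the weight is inserted
      -- to its right; the two commute.
      have hk : nilExp (∑ k, t k • ω k) * (ω k * w) = ω k * nilExp (∑ k, t k • ω k) * w := by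
        have : Commute (ω k) (nilExp (∑ k, t k • ω k)) :=
          Commute.nilExp_right (Commute.sum_right _ _ _ fun j _ => (hc k j).smul_right _)
        rw [← mul_assoc, this.eq]
      refine ContinuousLinearMap.ext fun y => ?_
      simp [gaussWeight, add_mul, gaussAlg_tmul, gaussForm_apply ht, hk]
      ring

theorem iteratedFDeriv_gaussAlg (hc : ∀ i j, Commute (ω i) (ω j)) (hn : ∀ i, IsNilpotent (ω i))
    {t : Fin d → ℂ} (ht : t ∈ gaussDomain b) (ℓ : C →ₗ[ℂ] ℂ) (Φ : MvPolynomial ι ℂ ⊗[ℂ] A)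
    (k : ℕ) (a : Fin k → Fin d) :
    iteratedFDeriv ℂ k (fun t => ℓ (gaussAlg b ω β t Φ)) t (fun i => Pi.single (a i) 1) =
      ℓ (gaussAlg b ω β t (((List.ofFn a).map (gaussWeight b ω)).prod * Φ)) := by
  have := iteratedFDeriv_of_family (𝕜 := ℂ) (U := gaussDomain b) isOpen_gaussDomain
    (g := fun l t => ℓ (gaussAlg b ω β t ((l.map (gaussWeight b ω)).prod * Φ)))
    (fun l t ht => by
      simpa only [List.map_cons, List.prod_cons, mul_assoc] using hasFDerivAt_gaussAlg hc hn ht ℓ _)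
    [] k a ht
  simpa using this

/-- The coordinate vectors are real, so restriction to real parameters leaves the formula for the
partial derivatives unchanged. This makes the real and the complex Taylor values comparable. -/
theorem iteratedFDeriv_real_gaussAlg (hc : ∀ i j, Commute (ω i) (ω j))
    (hn : ∀ i, IsNilpotent (ω i)) {t : Fin d → ℝ} (ht : (fun i => (t i : ℂ)) ∈ gaussDomain b)
    (ℓ : C →ₗ[ℂ] ℂ) (Φ : MvPolynomial ι ℂ ⊗[ℂ] A) (k : ℕ) (a : Fin k → Fin d) :
    iteratedFDeriv ℝ k (fun t : Fin d → ℝ => ℓ (gaussAlg b ω β (fun i => (t i : ℂ)) Φ)) t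
        (fun i => Pi.single (a i) 1) =
      ℓ (gaussAlg b ω β (fun i => (t i : ℂ)) (((List.ofFn a).map (gaussWeight b ω)).prod * Φ)) := by
  let R : (Fin d → ℝ) →L[ℝ] (Fin d → ℂ) :=
    ContinuousLinearMap.pi fun i => Complex.ofRealCLM.comp (ContinuousLinearMap.proj i)
  have hR : ∀ t, R t = fun i => (t i : ℂ) := fun t => rfl
  have := iteratedFDeriv_of_family (𝕜 := ℝ) (U := R ⁻¹' gaussDomain b)
    (isOpen_gaussDomain.preimage R.continuous)
    (g := fun l t => ℓ (gaussAlg b ω β (R t) ((l.map (gaussWeight b ω)).prod * Φ)))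
    (fun l t ht => by
      have h1 := (hasFDerivAt_gaussAlg (β := β) hc hn ht ℓ
        ((l.map (gaussWeight b ω)).prod * Φ)).restrictScalars ℝ
      refine (h1.comp t R.hasFDerivAt).congr_fderiv (ContinuousLinearMap.ext fun y => ?_)
      simp [R, mul_assoc])
    [] k a (t := t) ht
  simpa [hR] using this

/-- The value at a real point of a polynomial with coefficients in `A`. -/
def evalAlg (v : ι → ℝ) : MvPolynomial ι ℂ ⊗[ℂ] A →ₐ[ℂ] A :=
  Algebra.TensorProduct.lift ((Algebra.ofId ℂ A).comp (evalReal v)) (AlgHom.id ℂ A)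
    fun _ _ => Algebra.commutes _ _

@[simp]
theorem evalAlg_tmul (v : ι → ℝ) (p : MvPolynomial ι ℂ) (w : A) :
    evalAlg v (p ⊗ₜ w) = evalReal v p • w := by
  rw [evalAlg, Algebra.smul_def]
  exact Algebra.TensorProduct.lift_tmul _ _ _ _ _

theorem gaussAlg_eq_integral {t : Fin d → ℂ} (ht : t ∈ gaussDomain b) (ℓ : C →ₗ[ℂ] ℂ)
    (Φ : MvPolynomial ι ℂ ⊗[ℂ] A) :
    Integrable (fun v => ℓ (β (gaussian b t v • (nilExp (∑ k, t k • ω k) * evalAlg v Φ)))) ∧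
      ℓ (gaussAlg b ω β t Φ) =
        ∫ v, ℓ (β (gaussian b t v • (nilExp (∑ k, t k • ω k) * evalAlg v Φ))) := by
  induction Φ with
  | zero => simp
  | add Φ Ψ h1 h2 =>
    simp only [map_add, mul_add, smul_add]
    exact ⟨h1.1.add h2.1, by rw [integral_add h1.1 h2.1, h1.2, h2.2]⟩
  | tmul p w =>
    have h1 : (fun v => ℓ (β (gaussian b t v • (nilExp (∑ k, t k • ω k) * evalAlg v (p ⊗ₜ w))))) =
        fun v => gaussian b t v * evalReal v p * ℓ (β (nilExp (∑ k, t k • ω k) * w)) := by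
      funext v
      simp [mul_assoc]
    rw [h1]
    refine ⟨(integrable_gaussian_mul ht p).mul_const _, ?_⟩
    rw [integral_mul_const, gaussAlg_tmul, gaussForm_apply ht, map_smul, smul_eq_mul, gaussInt]

theorem gaussAlg_mul_right {σ : C →ₐ[ℂ] A} (hβ : ∀ w c, β (w * σ c) = β w * c) (t : Fin d → ℂ)
    (Φ : MvPolynomial ι ℂ ⊗[ℂ] A) (c : C) :
    gaussAlg b ω β t (Φ * 1 ⊗ₜ σ c) = gaussAlg b ω β t Φ * c := by
  induction Φ with
  | zero => simp
  | add Φ Ψ h1 h2 => simp only [add_mul, map_add, h1, h2]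
  | tmul p w =>
    rw [Algebra.TensorProduct.tmul_mul_tmul, mul_one, gaussAlg_tmul, gaussAlg_tmul, ← mul_assoc,
      hβ, smul_mul_assoc]

/-- The increments `s` enter the integral by right linearity of `β`. They commute with weights and
with `Φ`, so the terms of order `k` form the `k`-th power of `Σ weight · s`, and the Taylor sum is
an exponential inside the integral. -/
theorem sum_gaussAlg_eq {σ : C →ₐ[ℂ] A} (hβ : ∀ w c, β (w * σ c) = β w * c)
    {s : Fin d → C} {Φ : MvPolynomial ι ℂ ⊗[ℂ] A}
    (hsω : ∀ i j, Commute (σ (s i)) (ω j)) (hsΦ : ∀ i, Commute (1 ⊗ₜ σ (s i)) Φ)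
    {K : ℕ} (hK : ∀ k, K ≤ k → ∀ a : Fin k → Fin d, (List.ofFn fun i => s (a i)).prod = 0)
    (t : Fin d → ℂ) :
    ∑ k ∈ Finset.range K, ((k.factorial : ℂ)⁻¹) • ∑ a : Fin k → Fin d,
      gaussAlg b ω β t (((List.ofFn a).map (gaussWeight b ω)).prod * Φ) *
        (List.ofFn fun i => s (a i)).prod =
      gaussAlg b ω β t (nilExp (∑ j, gaussWeight b ω j * 1 ⊗ₜ σ (s j)) * Φ) := by
  have hcomm : ∀ i j, Commute (gaussWeight b ω i) ((1 : MvPolynomial ι ℂ) ⊗ₜ[ℂ] σ (s j)) := by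
    intro i j
    refine Commute.add_left ?_ ?_
    · simp [Commute, SemiconjBy]
    · simp [Commute, SemiconjBy, (hsω j i).eq]
  have hprod : ∀ (k : ℕ) (a : Fin k → Fin d),
      (List.ofFn fun i => (1 : MvPolynomial ι ℂ) ⊗ₜ[ℂ] σ (s (a i))).prod =
        1 ⊗ₜ σ ((List.ofFn fun i => s (a i)).prod) := by
    intro k a
    have := map_list_prod ((Algebra.TensorProduct.includeRight :
      A →ₐ[ℂ] MvPolynomial ι ℂ ⊗[ℂ] A).comp σ) (List.ofFn fun i => s (a i))
    rw [List.map_ofFn] at this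
    exact this.symm
  have hpow : ∀ k, (∑ j, gaussWeight b ω j * 1 ⊗ₜ σ (s j)) ^ k = ∑ a : Fin k → Fin d,
      ((List.ofFn a).map (gaussWeight b ω)).prod * 1 ⊗ₜ σ ((List.ofFn fun i => s (a i)).prod) := by
    intro k
    rw [sum_pow_eq_sum_ofFn_prod]
    refine Finset.sum_congr rfl fun a _ => ?_
    rw [ofFn_prod_mul fun i j => hcomm _ _, hprod, List.map_ofFn]
    rfl
  have hzero : (∑ j, gaussWeight b ω j * 1 ⊗ₜ σ (s j)) ^ K = 0 := by
    rw [hpow]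
    exact Finset.sum_eq_zero fun a _ => by rw [hK K le_rfl]; simp
  rw [nilExp_eq_sum hzero, Finset.sum_mul, map_sum]
  refine Finset.sum_congr rfl fun k _ => ?_
  rw [smul_mul_assoc, map_smul, hpow, Finset.sum_mul, map_sum]
  congr 1
  refine Finset.sum_congr rfl fun a _ => ?_
  -- The increments are pulled inside on the far right, then moved past `Φ`.
  rw [← gaussAlg_mul_right hβ, mul_assoc, mul_assoc]
  congr 2
  rw [← hprod]
  exact (ofFn_prod_commute fun i => (hsΦ _).symm).eq

end GaussAlgebra

end

noncomputable section

/-! ### Quadratic expressions in anticommuting elements -/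

section Anticommuting

variable {A κ : Type*} [Ring A] [Algebra ℂ A] {θ : κ → A}

/-- The span of the products `θ_p θ_q`. -/
def quadSpan (θ : κ → A) : Submodule ℂ A :=
  Submodule.span ℂ (Set.range fun pq : κ × κ => θ pq.1 * θ pq.2)

theorem mul_mem_quadSpan (θ : κ → A) (p q : κ) : θ p * θ q ∈ quadSpan θ :=
  Submodule.subset_span ⟨(p, q), rfl⟩

theorem commute_of_mem_quadSpan {a x : A} (ha : ∀ p q, Commute a (θ p * θ q))
    (hx : x ∈ quadSpan θ) : Commute a x := by
  induction hx using Submodule.span_induction with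
  | mem x hx => obtain ⟨pq, rfl⟩ := hx; exact ha _ _
  | zero => exact Commute.zero_right a
  | add x y _ _ hx hy => exact hx.add_right hy
  | smul c x _ hx => exact hx.smul_right c

/-- Moving one generator past a product of two changes the sign twice. -/
theorem quadSpan_commute (hθ : ∀ p q, θ p * θ q = -(θ q * θ p)) {x y : A}
    (hx : x ∈ quadSpan θ) (hy : y ∈ quadSpan θ) : Commute x y := by
  have h : ∀ p q r, Commute (θ p) (θ q * θ r) := fun p q r => by
    rw [Commute, SemiconjBy, ← mul_assoc, hθ p q, neg_mul, mul_assoc, hθ p r, mul_neg, neg_neg,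
      mul_assoc]
  refine commute_of_mem_quadSpan (fun p q => ?_) hy
  exact (commute_of_mem_quadSpan (fun r s => (h p r s).mul_left (h q r s)) hx).symm

/-- Each product of two generators has square zero because generators square to zero, and sums of
commuting nilpotents are nilpotent. -/
theorem isNilpotent_of_mem_quadSpan (hθ : ∀ p q, θ p * θ q = -(θ q * θ p)) {x : A}
    (hx : x ∈ quadSpan θ) : IsNilpotent x := by
  have hsq : ∀ p, θ p * θ p = 0 := fun p => by
    have h2 : (2 : ℂ) • (θ p * θ p) = 0 := by
      rw [two_smul]; nth_rewrite 1 [hθ p p]; simp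
    simpa using h2
  induction hx using Submodule.span_induction with
  | mem x hx =>
    obtain ⟨⟨p, q⟩, rfl⟩ := hx
    refine ⟨2, ?_⟩
    simp only
    rw [pow_two, mul_assoc, ← mul_assoc (θ q), hθ q p, neg_mul, mul_neg, mul_assoc, ← mul_assoc,
      hsq]
    simp
  | zero => exact IsNilpotent.zero
  | add x y hx' hy' hx hy => exact (quadSpan_commute hθ hx' hy').isNilpotent_add hx hy
  | smul c x _ hx => exact hx.smul c

end Anticommuting

/-! ### Graded tensor products of exterior algebras with superalgebras -/

section Graded

variable {W C : Type*} [AddCommGroup W] [Module ℝ W] [Ring C] [Algebra ℂ C]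
  {𝒞 : ZMod 2 → Submodule ℂ C} [GradedAlgebra 𝒞]

theorem ExteriorAlgebra.ι_mul_ι_comm_neg {R M : Type*} [CommRing R] [AddCommGroup M] [Module R M]
    (x y : M) : ExteriorAlgebra.ι R x * ExteriorAlgebra.ι R y =
      -(ExteriorAlgebra.ι R y * ExteriorAlgebra.ι R x) :=
  eq_neg_of_add_eq_zero_left (ExteriorAlgebra.ι_add_mul_swap x y)

variable (𝒞) in
/-- A linear form on `W`, as an element of `Λ(W^*) ⊗ C`. -/
def leftForm (φ : W →ₗ[ℝ] ℂ) : GradedTensorProduct ℂ (formGrading W) 𝒞 :=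
  GradedTensorProduct.includeLeft (formGrading W) 𝒞 (ExteriorAlgebra.ι ℂ φ)

variable (W 𝒞) in
/-- An element of `C`, as an element of `Λ(W^*) ⊗ C`. -/
abbrev rightScalar : C →ₐ[ℂ] GradedTensorProduct ℂ (formGrading W) 𝒞 :=
  GradedTensorProduct.includeRight (formGrading W) 𝒞

theorem leftForm_mul_leftForm (φ ψ : W →ₗ[ℝ] ℂ) :
    leftForm 𝒞 φ * leftForm 𝒞 ψ = -(leftForm 𝒞 ψ * leftForm 𝒞 φ) := by
  simp only [leftForm, ← map_mul, ← map_neg]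
  rw [ExteriorAlgebra.ι_mul_ι_comm_neg]

theorem includeLeft_mul_rightScalar (a : CForms W) (c : C) :
    GradedTensorProduct.includeLeft (formGrading W) 𝒞 a * rightScalar W 𝒞 c =
      GradedTensorProduct.tmul ℂ a c :=
  GradedTensorProduct.tmul_one_mul_one_tmul _ _ _ _

theorem rightScalar_mul_includeLeft {i j : ZMod 2} {a : CForms W} {c : C}
    (ha : a ∈ formGrading W i) (hc : c ∈ 𝒞 j) :
    rightScalar W 𝒞 c * GradedTensorProduct.includeLeft (formGrading W) 𝒞 a =
      (-1 : ℤˣ) ^ (j * i) •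
        (GradedTensorProduct.includeLeft (formGrading W) 𝒞 a * rightScalar W 𝒞 c) := by
  rw [includeLeft_mul_rightScalar]
  have := GradedTensorProduct.tmul_coe_mul_coe_tmul (R := ℂ) (formGrading W) 𝒞 1 ⟨c, hc⟩ ⟨a, ha⟩ 1
  simpa using this

theorem rightScalar_even_commute_leftForm {c : C} (hc : c ∈ 𝒞 0) (φ : W →ₗ[ℝ] ℂ) :
    Commute (rightScalar W 𝒞 c) (leftForm 𝒞 φ) := by
  have := rightScalar_mul_includeLeft (𝒞 := 𝒞) (i := 1) (j := 0) (a := ExteriorAlgebra.ι ℂ φ)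
    (CliffordAlgebra.ι_mem_evenOdd_one _ _) hc
  simpa [Commute, SemiconjBy, leftForm] using this

theorem rightScalar_odd_mul_leftForm {c : C} (hc : c ∈ 𝒞 1) (φ : W →ₗ[ℝ] ℂ) :
    rightScalar W 𝒞 c * leftForm 𝒞 φ = -(leftForm 𝒞 φ * rightScalar W 𝒞 c) := by
  have := rightScalar_mul_includeLeft (𝒞 := 𝒞) (i := 1) (j := 1) (a := ExteriorAlgebra.ι ℂ φ)
    (CliffordAlgebra.ι_mem_evenOdd_one _ _) hc
  simpa [leftForm] using this

theorem rightScalar_odd_mul_odd {c c' : C} (h : c * c' = -(c' * c)) :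
    rightScalar W 𝒞 c * rightScalar W 𝒞 c' = -(rightScalar W 𝒞 c' * rightScalar W 𝒞 c) := by
  rw [← map_mul, h, map_neg, map_mul]

theorem tmul_mul_rightScalar (a : CForms W) (c c' : C) :
    (GradedTensorProduct.tmul ℂ a c : GradedTensorProduct ℂ (formGrading W) 𝒞) *
      rightScalar W 𝒞 c' = GradedTensorProduct.tmul ℂ a (c * c') := by
  rw [← includeLeft_mul_rightScalar, mul_assoc, ← map_mul, includeLeft_mul_rightScalar]

/-- Induction on the elements of the graded tensor product. -/
theorem gradedTensor_induction {p : GradedTensorProduct ℂ (formGrading W) 𝒞 → Prop} (h0 : p 0)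
    (htmul : ∀ a c, p (GradedTensorProduct.tmul ℂ a c)) (hadd : ∀ x y, p x → p y → p (x + y))
    (x : GradedTensorProduct ℂ (formGrading W) 𝒞) : p x :=
  TensorProduct.induction_on (motive := p) x h0 htmul hadd

variable {C' : Type*} [Ring C'] [Algebra ℂ C'] {𝒞' : ZMod 2 → Submodule ℂ C'} [GradedAlgebra 𝒞']

/-- The morphism `Λ(W^*) ⊗ C' → Λ(W^*) ⊗ C` defined by a graded morphism `C' → C`. -/
def gradedTensorMap (f : C' →ₐ[ℂ] C) (hf : ∀ i, ∀ c ∈ 𝒞' i, f c ∈ 𝒞 i) :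
    GradedTensorProduct ℂ (formGrading W) 𝒞' →ₐ[ℂ] GradedTensorProduct ℂ (formGrading W) 𝒞 :=
  GradedTensorProduct.lift _ _ (GradedTensorProduct.includeLeft (formGrading W) 𝒞)
    ((rightScalar W 𝒞).comp f) fun i j a c => by
      have := rightScalar_mul_includeLeft (𝒞 := 𝒞) a.2 (hf j c c.2)
      rw [AlgHom.comp_apply, this, smul_smul, Int.units_mul_self, one_smul]

theorem gradedTensorMap_tmul (f : C' →ₐ[ℂ] C) (hf : ∀ i, ∀ c ∈ 𝒞' i, f c ∈ 𝒞 i) (a : CForms W)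
    (c : C') : gradedTensorMap f hf (GradedTensorProduct.tmul ℂ a c) =
      GradedTensorProduct.tmul ℂ a (f c) := by
  rw [gradedTensorMap, GradedTensorProduct.lift_tmul, AlgHom.comp_apply,
    includeLeft_mul_rightScalar]

theorem gradedTensorMap_leftForm (f : C' →ₐ[ℂ] C) (hf : ∀ i, ∀ c ∈ 𝒞' i, f c ∈ 𝒞 i)
    (φ : W →ₗ[ℝ] ℂ) : gradedTensorMap f hf (leftForm 𝒞' φ) = leftForm 𝒞 φ := by
  have := gradedTensorMap_tmul f hf (ExteriorAlgebra.ι ℂ φ) 1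
  rwa [map_one] at this

theorem gradedTensorMap_rightScalar (f : C' →ₐ[ℂ] C) (hf : ∀ i, ∀ c ∈ 𝒞' i, f c ∈ 𝒞 i)
    (c : C') : gradedTensorMap f hf (rightScalar W 𝒞' c) = rightScalar W 𝒞 (f c) :=
  gradedTensorMap_tmul f hf 1 c

variable (𝒞) in
/-- The extension to `Λ(W^*) ⊗ C` of a linear form on `Λ(W^*)`. -/
def extendForm (β : CForms W →ₗ[ℂ] ℂ) : GradedTensorProduct ℂ (formGrading W) 𝒞 →ₗ[ℂ] C :=
  (TensorProduct.lid ℂ C).toLinearMap ∘ₗ β.rTensor C ∘ₗ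
    (GradedTensorProduct.of ℂ (formGrading W) 𝒞).symm.toLinearMap

theorem extendForm_tmul (β : CForms W →ₗ[ℂ] ℂ) (a : CForms W) (c : C) :
    extendForm 𝒞 β (GradedTensorProduct.tmul ℂ a c) = β a • c := by
  simp [extendForm]

theorem extendForm_mul_rightScalar (β : CForms W →ₗ[ℂ] ℂ)
    (x : GradedTensorProduct ℂ (formGrading W) 𝒞) (c : C) :
    extendForm 𝒞 β (x * rightScalar W 𝒞 c) = extendForm 𝒞 β x * c := by
  induction x using gradedTensor_induction with
  | h0 => simp
  | htmul a c' => rw [tmul_mul_rightScalar, extendForm_tmul, extendForm_tmul, smul_mul_assoc]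
  | hadd x y hx hy => rw [add_mul, map_add, map_add, hx, hy, add_mul]

theorem map_extendForm (f : C' →ₐ[ℂ] C) (hf : ∀ i, ∀ c ∈ 𝒞' i, f c ∈ 𝒞 i)
    (β : CForms W →ₗ[ℂ] ℂ) (x : GradedTensorProduct ℂ (formGrading W) 𝒞') :
    f (extendForm 𝒞' β x) = extendForm 𝒞 β (gradedTensorMap f hf x) := by
  induction x using gradedTensor_induction with
  | h0 => simp
  | htmul a c' => rw [gradedTensorMap_tmul, extendForm_tmul, extendForm_tmul, map_smul]
  | hadd x y hx hy => rw [map_add, map_add, map_add, map_add, hx, hy]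

/-- A morphism from an exterior algebra is graded if the generators are mapped to odd elements. -/
theorem ExteriorAlgebra.map_mem_of_ι {M : Type*} [AddCommGroup M] [Module ℂ M]
    (f : ExteriorAlgebra ℂ M →ₐ[ℂ] C) (hf : ∀ m, f (ExteriorAlgebra.ι ℂ m) ∈ 𝒞 1) (i : ZMod 2)
    (x : ExteriorAlgebra ℂ M)
    (hx : x ∈ CliffordAlgebra.evenOdd (0 : QuadraticForm ℂ M) i) : f x ∈ 𝒞 i := by
  suffices h : CliffordAlgebra.evenOdd (0 : QuadraticForm ℂ M) i ≤ (𝒞 i).comap f.toLinearMap from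
    h hx
  clear hx
  refine iSup_le ?_
  rintro ⟨n, rfl⟩
  rw [← Submodule.map_le_iff_le_comap, Submodule.map_pow]
  have h1 : Submodule.map f.toLinearMap
      (LinearMap.range (CliffordAlgebra.ι (0 : QuadraticForm ℂ M))) ≤ 𝒞 1 := by
    rintro _ ⟨_, ⟨m, rfl⟩, rfl⟩
    exact hf m
  induction n with
  | zero =>
    simp only [pow_zero, Nat.cast_zero, Submodule.one_le]
    exact SetLike.GradedOne.one_mem
  | succ n ih =>
    rw [pow_succ, Nat.cast_succ]
    refine Submodule.mul_le.2 fun a ha c hc => ?_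
    exact SetLike.GradedMul.mul_mem (ih ha) (h1 hc)

end Graded

/-! ### Nilpotency and commutation in near superalgebras -/

namespace NearSuperalgebra

variable {P : Type*} [Ring P] [Algebra ℝ P] {𝒜 : ZMod 2 → Submodule ℝ P} [GradedAlgebra 𝒜]

theorem even_commute (h : NearSuperalgebra 𝒜) {a : ℂ ⊗[ℝ] P} (ha : a ∈ cpxGrading 𝒜 0)
    {i : ZMod 2} {b : ℂ ⊗[ℝ] P} (hb : b ∈ cpxGrading 𝒜 i) : Commute a b := by
  simp only [cpxGrading, Submodule.baseChange_eq_span] at ha hb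
  induction ha using Submodule.span_induction with
  | zero => exact Commute.zero_left _
  | add x y _ _ hx hy => exact hx.add_left hy
  | smul c x _ hx => exact hx.smul_left c
  | mem x hx =>
    obtain ⟨p, hp, rfl⟩ := hx
    induction hb using Submodule.span_induction with
    | zero => exact Commute.zero_right _
    | add x y _ _ hx hy => exact hx.add_right hy
    | smul c x _ hx => exact hx.smul_right c
    | mem y hy =>
      obtain ⟨q, hq, rfl⟩ := hy
      have := h.comm 0 i p q hp hq
      simp only [zero_mul, uzpow_zero, one_smul] at this
      simp [Commute, SemiconjBy, this]

/-- Write the minimal polynomial of `p` as `X^k g` with `g(0) ≠ 0`. The body of `g(p)` is `g(0)`, so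
`g(p)` is a unit by locality, and `p^k g(p) = 0` forces `p^k = 0`. -/
theorem isNilpotent_of_body_eq_zero (h : NearSuperalgebra 𝒜) {p : P} (hp : h.body p = 0) :
    IsNilpotent p := by
  have := h.finite
  have := h.isLocal
  have hInt : IsIntegral ℝ p := Algebra.IsIntegral.isIntegral p
  have hne : minpoly ℝ p ≠ 0 := minpoly.ne_zero hInt
  obtain ⟨g, hg, hg0⟩ := Polynomial.exists_eq_pow_rootMultiplicity_mul_and_not_dvd
    (minpoly ℝ p) hne 0
  set k := (minpoly ℝ p).rootMultiplicity 0
  simp only [Polynomial.C_0, sub_zero] at hg hg0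
  have hev : p ^ k * Polynomial.aeval p g = 0 := by
    have := minpoly.aeval ℝ p
    rw [hg] at this
    simpa using this
  have hbody : h.body (Polynomial.aeval p g) ≠ 0 := by
    rw [← Polynomial.aeval_algHom_apply, hp, Polynomial.aeval_def, Polynomial.eval₂_at_zero]
    rw [Polynomial.X_dvd_iff] at hg0
    simpa using hg0
  have hunit : IsUnit (Polynomial.aeval p g) := by
    set x := Polynomial.aeval p g
    set r := h.body x
    -- After normalizing the body of `x` to 1, locality makes `x/r` or `1 - x/r` a unit; the second
    -- has body 0 and cannot be one.
    have h1 : IsUnit (algebraMap ℝ P r⁻¹ * x) ∨ IsUnit (1 - algebraMap ℝ P r⁻¹ * x) :=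
      IsLocalRing.isUnit_or_isUnit_of_add_one (by abel)
    rcases h1 with h1 | h1
    · have h2 : IsUnit (algebraMap ℝ P r) := (isUnit_iff_ne_zero.2 hbody).map _
      have := h2.mul h1
      rwa [← mul_assoc, ← map_mul, mul_inv_cancel₀ hbody, map_one, one_mul] at this
    · have h2 := h1.map h.body
      have h3 : h.body (1 - algebraMap ℝ P r⁻¹ * x) = 0 := by
        rw [map_sub, map_one, map_mul, AlgHom.commutes]
        change 1 - r⁻¹ * r = 0
        rw [inv_mul_cancel₀ hbody, sub_self]
      rw [h3] at h2
      exact absurd h2 not_isUnit_zero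
  exact ⟨k, hunit.mul_left_eq_zero.1 hev⟩

theorem bodyC_tmul (h : NearSuperalgebra 𝒜) (c : ℂ) (p : P) :
    h.bodyC (c ⊗ₜ p) = c * (h.body p : ℂ) := by
  simp [bodyC, mul_comm]

theorem bodyC_one (h : NearSuperalgebra 𝒜) : h.bodyC 1 = 1 := by
  rw [Algebra.TensorProduct.one_def, bodyC_tmul]; simp

theorem bodyC_algebraMap (h : NearSuperalgebra 𝒜) (c : ℂ) :
    h.bodyC (algebraMap ℂ (ℂ ⊗[ℝ] P) c) = c := by
  rw [Algebra.algebraMap_eq_smul_one, map_smul, bodyC_one, smul_eq_mul, mul_one]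

/-- Every element of `(P_ℂ)_i` is `1 ⊗ p + i ⊗ q` with `p, q ∈ P_i`. -/
theorem exists_re_im {P : Type*} [Ring P] [Algebra ℝ P] {𝒜 : ZMod 2 → Submodule ℝ P}
    {i : ZMod 2} {a : ℂ ⊗[ℝ] P} (ha : a ∈ cpxGrading 𝒜 i) :
    ∃ p ∈ 𝒜 i, ∃ q ∈ 𝒜 i, a = 1 ⊗ₜ p + Complex.I ⊗ₜ q := by
  simp only [cpxGrading, Submodule.baseChange_eq_span] at ha
  induction ha using Submodule.span_induction with
  | zero => exact ⟨0, zero_mem _, 0, zero_mem _, by simp⟩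
  | add x y _ _ hx hy =>
    obtain ⟨p, hp, q, hq, rfl⟩ := hx
    obtain ⟨p', hp', q', hq', rfl⟩ := hy
    exact ⟨p + p', add_mem hp hp', q + q', add_mem hq hq', by
      simp only [TensorProduct.tmul_add]; abel⟩
  | smul c x _ hx =>
    obtain ⟨p, hp, q, hq, rfl⟩ := hx
    refine ⟨c.re • p - c.im • q, sub_mem (Submodule.smul_mem _ _ hp) (Submodule.smul_mem _ _ hq),
      c.im • p + c.re • q, add_mem (Submodule.smul_mem _ _ hp) (Submodule.smul_mem _ _ hq), ?_⟩
    have h1 : ∀ p : P, c ⊗ₜ[ℝ] p = 1 ⊗ₜ (c.re • p) + Complex.I ⊗ₜ (c.im • p) := fun p => by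
      rw [TensorProduct.tmul_smul, TensorProduct.tmul_smul, TensorProduct.smul_tmul',
        TensorProduct.smul_tmul', ← TensorProduct.add_tmul]
      congr 1
      apply Complex.ext <;> simp
    have h2 : ∀ p : P, (c * Complex.I) ⊗ₜ[ℝ] p = Complex.I ⊗ₜ (c.re • p) - 1 ⊗ₜ (c.im • p) :=
      fun p => by
      rw [TensorProduct.tmul_smul, TensorProduct.tmul_smul, TensorProduct.smul_tmul',
        TensorProduct.smul_tmul', ← TensorProduct.sub_tmul]
      congr 1
      apply Complex.ext <;> simp
    rw [smul_add, TensorProduct.smul_tmul', TensorProduct.smul_tmul', smul_eq_mul, smul_eq_mul,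
      mul_one, h1, h2]
    simp only [TensorProduct.tmul_add, TensorProduct.tmul_sub]
    abel
  | mem x hx =>
    obtain ⟨p, hp, rfl⟩ := hx
    exact ⟨p, hp, 0, zero_mem _, by simp⟩

/-- The real and imaginary parts are even with body 0, hence nilpotent, and they commute. -/
theorem isNilpotent_of_bodyC_eq_zero (h : NearSuperalgebra 𝒜) {a : ℂ ⊗[ℝ] P}
    (ha : a ∈ cpxGrading 𝒜 0) (hb : h.bodyC a = 0) : IsNilpotent a := by
  obtain ⟨p, hp, q, hq, rfl⟩ := exists_re_im ha
  rw [map_add, bodyC_tmul, bodyC_tmul, Complex.ext_iff] at hb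
  simp only [Complex.add_re, Complex.add_im, Complex.mul_re, Complex.mul_im, Complex.one_re,
    Complex.one_im, Complex.I_re, Complex.I_im, Complex.ofReal_re, Complex.ofReal_im,
    Complex.zero_re, Complex.zero_im] at hb
  obtain ⟨K, hK⟩ := h.isNilpotent_of_body_eq_zero (p := p) (by linarith [hb.1])
  obtain ⟨L, hL⟩ := h.isNilpotent_of_body_eq_zero (p := q) (by linarith [hb.2])
  have hcomm : Commute ((1 : ℂ) ⊗ₜ[ℝ] p) (Complex.I ⊗ₜ[ℝ] q) :=
    h.even_commute (Submodule.tmul_mem_baseChange_of_mem _ hp)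
      (Submodule.tmul_mem_baseChange_of_mem _ hq)
  exact hcomm.isNilpotent_add ⟨K, by simp [hK]⟩ ⟨L, by simp [hL]⟩

end NearSuperalgebra

end

noncomputable section

/-! ### Compatibility of Gaussian integrals with algebra morphisms -/

section Naturality

variable {ι : Type*} [Fintype ι] {d : ℕ} {A C A' C' : Type*} [Ring A] [Algebra ℂ A] [Ring C]
  [Algebra ℂ C] [Ring A'] [Algebra ℂ A'] [Ring C'] [Algebra ℂ C']

/-- This serves to specialize the generic odd parameters: `Θ` acts on the integrand and `f` on the
value of the integral. -/
theorem map_gaussAlg {b : Fin d → ι → ι → ℝ} {ω' : Fin d → A'} {β' : A' →ₗ[ℂ] C'}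
    {β : A →ₗ[ℂ] C} (f : C' →ₗ[ℂ] C) (Θ : A' →ₐ[ℂ] A) (hf : ∀ x, f (β' x) = β (Θ x))
    {t : Fin d → ℂ} (hω : IsNilpotent (∑ k, t k • ω' k)) (Φ : MvPolynomial ι ℂ ⊗[ℂ] A') :
    f (gaussAlg b ω' β' t Φ) = gaussAlg b (fun k => Θ (ω' k)) β t
      (Algebra.TensorProduct.map (AlgHom.id ℂ (MvPolynomial ι ℂ)) Θ Φ) := by
  induction Φ with
  | zero => simp
  | add Φ Ψ h1 h2 => simp only [map_add, h1, h2]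
  | tmul p w =>
    rw [gaussAlg_tmul, map_smul, hf, map_mul, map_nilExp Θ hω, Algebra.TensorProduct.map_tmul,
      gaussAlg_tmul]
    simp

end Naturality

/-! ### Coordinates of points -/

section Coordinates

variable {E M N : Type*} [AddCommGroup E] [Module ℝ E]
  [AddCommGroup M] [Module ℝ M] [AddCommGroup N] [Module ℝ N]

theorem pointCoord_tmul (ℓ : E →ₗ[ℝ] ℝ) (x : E) (y : M) : pointCoord ℓ (x ⊗ₜ[ℝ] y) = ℓ x • y := by
  simp [pointCoord]

theorem pointCoord_lTensor (ℓ : E →ₗ[ℝ] ℝ) (f : M →ₗ[ℝ] N) (Y : E ⊗[ℝ] M) :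
    pointCoord ℓ (f.lTensor E Y) = f (pointCoord ℓ Y) := by
  induction Y with
  | zero => simp
  | add Y Z h1 h2 => simp only [map_add, h1, h2]
  | tmul x y => simp [pointCoord_tmul]

variable [Module.Finite ℝ E]

theorem sum_tmul_pointCoord (Y : E ⊗[ℝ] M) :
    ∑ k, Module.finBasis ℝ E k ⊗ₜ[ℝ] pointCoord ((Module.finBasis ℝ E).coord k) Y = Y := by
  induction Y with
  | zero => simp
  | add Y Z h1 h2 =>
    simp only [map_add, TensorProduct.tmul_add, Finset.sum_add_distrib, h1, h2]
  | tmul x y =>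
    simp only [pointCoord_tmul, TensorProduct.tmul_smul, TensorProduct.smul_tmul']
    rw [← TensorProduct.sum_tmul]
    congr 1
    exact (Module.finBasis ℝ E).sum_repr x

theorem pointCoord_ofCoordC (t : Fin (Module.finrank ℝ E) → ℂ) (a : Fin (Module.finrank ℝ E)) :
    pointCoord ((Module.finBasis ℝ E).coord a) (ofCoordC E t) = t a := by
  simp [ofCoordC, pointCoord_tmul, Finsupp.single_apply]

theorem ofCoordC_ofReal (t : Fin (Module.finrank ℝ E) → ℝ) :
    ofCoordC E (fun a => (t a : ℂ)) = ofCoord E t ⊗ₜ[ℝ] (1 : ℂ) := by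
  simp only [ofCoordC, ofCoord, TensorProduct.sum_tmul]
  refine Finset.sum_congr rfl fun a _ => ?_
  rw [← TensorProduct.smul_tmul', ← TensorProduct.tmul_smul]
  congr 1
  simp

theorem ofCoord_coord (x : E) :
    ofCoord E (fun a => (Module.finBasis ℝ E).coord a x) = x :=
  (Module.finBasis ℝ E).sum_repr x

end Coordinates

/-! ### The exponent `-½ B(v, Xv)` in coordinates -/

namespace OrientedSymplecticSuperspace

variable {V₀ V₁ : Type*} [AddCommGroup V₀] [Module ℝ V₀] [Module.Finite ℝ V₀]
  [AddCommGroup V₁] [Module ℝ V₁] [Module.Finite ℝ V₁] {m n : ℕ}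
  {V : OrientedSymplecticSuperspace V₀ V₁ m n}

section Coefficients

variable {C : Type*} [Ring C] [Algebra ℂ C] (𝒞 : ZMod 2 → Submodule ℂ C) [GradedAlgebra 𝒞]
  (b : V.OrientedBasis)

/-- The coefficients of the quadratic forms `v ↦ B(v, G_k v)` on `V₀`. -/
def quadCoeff (b : V.OrientedBasis) (k : Fin (Module.finrank ℝ V.spoEven))
    (i j : Fin (m / 2) ⊕ Fin (m / 2)) : ℝ :=
  V.B₀ (b.e i) ((Module.finBasis ℝ V.spoEven k).1.1 (b.e j))

theorem sum_quadCoeff (k : Fin (Module.finrank ℝ V.spoEven)) (v : Fin (m / 2) ⊕ Fin (m / 2) → ℝ) :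
    ∑ i, ∑ j, quadCoeff b k i j * v i * v j =
      V.B₀ (∑ i, v i • b.e i) ((Module.finBasis ℝ V.spoEven k).1.1 (∑ i, v i • b.e i)) := by
  simp only [map_sum, map_smul, LinearMap.sum_apply, LinearMap.smul_apply, smul_eq_mul,
    Finset.mul_sum, quadCoeff]
  rw [Finset.sum_comm]
  exact Finset.sum_congr rfl fun i _ => Finset.sum_congr rfl fun j _ => by ring

/-- The odd coordinate `η^j`. -/
def oddGen (j : Fin n) : GradedTensorProduct ℂ (formGrading V₁) 𝒞 :=
  leftForm 𝒞 (Complex.ofRealCLM.toLinearMap ∘ₗ b.f.u.coord j)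

/-- The quadratic function `-½ B(v, G_k v)` on `V₁`. -/
def oddQuad (k : Fin (Module.finrank ℝ V.spoEven)) : GradedTensorProduct ℂ (formGrading V₁) 𝒞 :=
  (-(1 / 2) : ℂ) • ∑ i, ∑ j,
    (V.B₁ (b.f.u i) ((Module.finBasis ℝ V.spoEven k).1.2 (b.f.u j)) : ℂ) •
      (oddGen 𝒞 b j * oddGen 𝒞 b i)

/-- The coefficient of `x^i` in the part of `-½ B(v, Zv)` that is linear in `V₀`, for an odd `Z`. -/
def mixedCoeff (z : Fin (Module.finrank ℝ V.spoOdd) → C) (i : Fin (m / 2) ⊕ Fin (m / 2)) :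
    GradedTensorProduct ℂ (formGrading V₁) 𝒞 :=
  (-(1 / 2) : ℂ) •
    ((∑ k, ∑ j, (V.B₀ (b.e i) ((Module.finBasis ℝ V.spoOdd k).1.2 (b.f.u j)) : ℂ) •
        (oddGen 𝒞 b j * rightScalar V₁ 𝒞 (z k))) +
      ∑ k, ∑ j, (V.B₁ (b.f.u j) ((Module.finBasis ℝ V.spoOdd k).1.1 (b.e i)) : ℂ) •
        (rightScalar V₁ 𝒞 (z k) * oddGen 𝒞 b j))

/-- The part of `-½ B(v, Zv)` that is linear in `V₀`, as a polynomial in the coordinates `x^i`. -/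
def mixedPoly (z : Fin (Module.finrank ℝ V.spoOdd) → C) :
    MvPolynomial (Fin (m / 2) ⊕ Fin (m / 2)) ℂ ⊗[ℂ] GradedTensorProduct ℂ (formGrading V₁) 𝒞 :=
  ∑ i, MvPolynomial.X i ⊗ₜ mixedCoeff 𝒞 b z i

/-- The odd coordinates of `V` together with the odd parameters. -/
def oddFamily (z : Fin (Module.finrank ℝ V.spoOdd) → C) :
    Fin n ⊕ Fin (Module.finrank ℝ V.spoOdd) → GradedTensorProduct ℂ (formGrading V₁) 𝒞 :=
  Sum.elim (oddGen 𝒞 b) fun k => rightScalar V₁ 𝒞 (z k)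

variable {𝒞 b} {z : Fin (Module.finrank ℝ V.spoOdd) → C}

theorem oddFamily_anticomm (hz : ∀ k, z k ∈ 𝒞 1) (hzz : ∀ k l, z k * z l = -(z l * z k)) (p q) :
    oddFamily 𝒞 b z p * oddFamily 𝒞 b z q = -(oddFamily 𝒞 b z q * oddFamily 𝒞 b z p) := by
  rcases p with j | k <;> rcases q with i | l
  · exact leftForm_mul_leftForm _ _
  · rw [eq_neg_iff_add_eq_zero, add_comm, ← eq_neg_iff_add_eq_zero]
    exact rightScalar_odd_mul_leftForm (hz l) _
  · exact rightScalar_odd_mul_leftForm (hz k) _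
  · exact rightScalar_odd_mul_odd (hzz k l)

theorem oddQuad_mem_quadSpan (z : Fin (Module.finrank ℝ V.spoOdd) → C) (k) :
    oddQuad 𝒞 b k ∈ quadSpan (oddFamily 𝒞 b z) :=
  Submodule.smul_mem _ _ <| Submodule.sum_mem _ fun i _ => Submodule.sum_mem _ fun j _ =>
    Submodule.smul_mem _ _ (mul_mem_quadSpan (oddFamily 𝒞 b z) (Sum.inl j) (Sum.inl i))

theorem mixedCoeff_mem_quadSpan (i) : mixedCoeff 𝒞 b z i ∈ quadSpan (oddFamily 𝒞 b z) := by
  refine Submodule.smul_mem _ _ (Submodule.add_mem _ ?_ ?_)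
  · exact Submodule.sum_mem _ fun k _ => Submodule.sum_mem _ fun j _ =>
      Submodule.smul_mem _ _ (mul_mem_quadSpan (oddFamily 𝒞 b z) (Sum.inl j) (Sum.inr k))
  · exact Submodule.sum_mem _ fun k _ => Submodule.sum_mem _ fun j _ =>
      Submodule.smul_mem _ _ (mul_mem_quadSpan (oddFamily 𝒞 b z) (Sum.inr k) (Sum.inl j))

/-- The `oddQuad` do not involve the odd parameters; setting these to 0 gives commutation and
nilpotency of the `oddQuad` without any assumption on parameters. -/
theorem oddFamily_zero_anticomm (p q) : oddFamily (V := V) 𝒞 b 0 p * oddFamily 𝒞 b 0 q =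
    -(oddFamily 𝒞 b 0 q * oddFamily 𝒞 b 0 p) :=
  oddFamily_anticomm (fun _ => zero_mem _) (by simp) p q

theorem oddQuad_commute (k l) : Commute (oddQuad 𝒞 b k) (oddQuad 𝒞 b l) :=
  quadSpan_commute oddFamily_zero_anticomm (oddQuad_mem_quadSpan 0 k) (oddQuad_mem_quadSpan 0 l)

theorem isNilpotent_oddQuad (k) : IsNilpotent (oddQuad 𝒞 b k) :=
  isNilpotent_of_mem_quadSpan oddFamily_zero_anticomm (oddQuad_mem_quadSpan 0 k)

theorem isNilpotent_mixedPoly (hz : ∀ k, z k ∈ 𝒞 1) (hzz : ∀ k l, z k * z l = -(z l * z k)) :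
    IsNilpotent (mixedPoly 𝒞 b z) := by
  refine Commute.isNilpotent_sum (fun i _ => ?_) fun i j _ _ => ?_
  · obtain ⟨K, hK⟩ := isNilpotent_of_mem_quadSpan (oddFamily_anticomm (b := b) hz hzz)
      (mixedCoeff_mem_quadSpan i)
    exact ⟨K, by rw [Algebra.TensorProduct.tmul_pow, hK, TensorProduct.tmul_zero]⟩
  · have := quadSpan_commute (oddFamily_anticomm (b := b) hz hzz) (mixedCoeff_mem_quadSpan i)
      (mixedCoeff_mem_quadSpan j)
    simp only [Commute, SemiconjBy, Algebra.TensorProduct.tmul_mul_tmul]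
    rw [this.eq, mul_comm (MvPolynomial.X i)]

theorem evalAlg_mixedPoly (v : Fin (m / 2) ⊕ Fin (m / 2) → ℝ) :
    evalAlg v (mixedPoly 𝒞 b z) = ∑ i, (v i : ℂ) • mixedCoeff 𝒞 b z i := by
  simp [mixedPoly, evalReal]

end Coefficients

section Domain

variable (b : V.OrientedBasis)

theorem realQuad_quadCoeff (t : Fin (Module.finrank ℝ V.spoEven) → ℂ)
    (v : Fin (m / 2) ⊕ Fin (m / 2) → ℝ) :
    realQuad (quadCoeff b) t v = V.B₀ (∑ i, v i • b.e i)
      ((∑ k, (t k).re • Module.finBasis ℝ V.spoEven k : V.spoEven).1.1 (∑ i, v i • b.e i)) := by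
  simp only [realQuad, sum_quadCoeff]
  generalize ∑ i, v i • b.e i = w
  simp [Prod.fst_sum, LinearMap.sum_apply]

/-- Both conditions test the real part of `t` on vectors of `V₀`, written intrinsically or in
coordinates; in particular the domain of convergence is the same for every basis. -/
theorem mem_posTube_iff (t : Fin (Module.finrank ℝ V.spoEven) → ℂ) :
    ofCoordC V.spoEven t ∈ V.posTube ↔ t ∈ gaussDomain (quadCoeff b) := by
  have h1 : TensorProduct.rid ℝ V.spoEven
      (Complex.reLm.lTensor V.spoEven (ofCoordC V.spoEven t)) =
      ∑ k, (t k).re • Module.finBasis ℝ V.spoEven k := by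
    simp [ofCoordC]
  change TensorProduct.rid ℝ V.spoEven
      (Complex.reLm.lTensor V.spoEven (ofCoordC V.spoEven t)) ∈ V.posCone ↔ _
  rw [h1]
  constructor
  · intro h v hv
    rw [realQuad_quadCoeff]
    refine h _ fun h0 => hv ?_
    have := Fintype.linearIndependent_iff.1 b.e.linearIndependent v h0
    exact funext this
  · intro h v hv
    have h2 := h (fun i => b.e.repr v i) (fun h0 => hv (by
      rw [← b.e.sum_repr v]; exact Finset.sum_eq_zero fun i _ => by
        rw [show b.e.repr v i = 0 from congrFun h0 i, zero_smul]))
    rwa [realQuad_quadCoeff, b.e.sum_repr] at h2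

theorem mem_posCone_iff (t : Fin (Module.finrank ℝ V.spoEven) → ℝ) :
    ofCoord V.spoEven t ∈ V.posCone ↔ (fun a => (t a : ℂ)) ∈ gaussDomain (quadCoeff b) := by
  rw [← mem_posTube_iff, ofCoordC_ofReal]
  change _ ↔ TensorProduct.rid ℝ V.spoEven (Complex.reLm.lTensor V.spoEven _) ∈ V.posCone
  simp

end Domain

end OrientedSymplecticSuperspace

end

noncomputable section

/-! ### The exponential of the moment map at a point -/

namespace OrientedSymplecticSuperspace

variable {V₀ V₁ : Type*} [AddCommGroup V₀] [Module ℝ V₀] [Module.Finite ℝ V₀]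
  [AddCommGroup V₁] [Module ℝ V₁] [Module.Finite ℝ V₁] {m n : ℕ}
  {V : OrientedSymplecticSuperspace V₀ V₁ m n}
  {P : Type*} [Ring P] [Algebra ℝ P] {𝒜 : ZMod 2 → Submodule ℝ P} [GradedAlgebra 𝒜]

/-- The odd coordinates of a point of `spo(V)`. -/
def oddPointCoord (X : SuperPointC V.spoEven V.spoOdd 𝒜) (k : Fin (Module.finrank ℝ V.spoOdd)) :
    ℂ ⊗[ℝ] P :=
  (pointCoord ((Module.finBasis ℝ V.spoOdd).coord k) X.2 : cpxGrading 𝒜 1)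

theorem oddPointCoord_mem (X : SuperPointC V.spoEven V.spoOdd 𝒜) (k) :
    oddPointCoord X k ∈ cpxGrading 𝒜 1 := SetLike.coe_mem _

theorem evenCoord_mem {E₀ E₁ : Type*} [AddCommGroup E₀] [Module ℝ E₀] [Module.Finite ℝ E₀]
    [AddCommGroup E₁] [Module ℝ E₁] (X : SuperPointC E₀ E₁ 𝒜) (k) :
    evenCoord X k ∈ cpxGrading 𝒜 0 := SetLike.coe_mem _

theorem evenSoul_mem (h : NearSuperalgebra 𝒜) {E₀ E₁ : Type*} [AddCommGroup E₀] [Module ℝ E₀]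
    [Module.Finite ℝ E₀] [AddCommGroup E₁] [Module ℝ E₁] (X : SuperPointC E₀ E₁ 𝒜) (k) :
    evenSoul h X k ∈ cpxGrading 𝒜 0 :=
  sub_mem (evenCoord_mem X k) (SetLike.algebraMap_mem_graded _ _)

theorem isNilpotent_evenSoul (h : NearSuperalgebra 𝒜) {E₀ E₁ : Type*} [AddCommGroup E₀]
    [Module ℝ E₀] [Module.Finite ℝ E₀] [AddCommGroup E₁] [Module ℝ E₁]
    (X : SuperPointC E₀ E₁ 𝒜) (k) : IsNilpotent (evenSoul h X k) := by
  refine h.isNilpotent_of_bodyC_eq_zero (evenSoul_mem h X k) ?_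
  rw [evenSoul, map_sub, h.bodyC_algebraMap, sub_self]

/-- This separates the exponent into the even quadratic, odd quadratic and mixed parts. The
coordinates `y_k`, being even, can be moved to the right of the odd coordinates without sign. -/
theorem moment_eq (b : V.OrientedBasis) (X : SuperPointC V.spoEven V.spoOdd 𝒜)
    (v : Fin (m / 2) ⊕ Fin (m / 2) → ℝ) :
    moment b.f.u X (∑ i, v i • b.e i) =
      (∑ k, evalReal v (quadPoly (quadCoeff b k)) •
        rightScalar V₁ (cpxGrading 𝒜) (evenCoord X k)) +
      (∑ k, oddQuad (cpxGrading 𝒜) b k * rightScalar V₁ (cpxGrading 𝒜) (evenCoord X k)) +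
      ∑ i, (v i : ℂ) • mixedCoeff (cpxGrading 𝒜) b (oddPointCoord X) i := by
  have h1 : (-(1 / 2) : ℂ) • (∑ k, (V.B₀ (∑ i, v i • b.e i)
      ((Module.finBasis ℝ V.spoEven k).1.1 (∑ i, v i • b.e i)) : ℂ) •
        rightScalar V₁ (cpxGrading 𝒜) (evenCoord X k)) =
      ∑ k, evalReal v (quadPoly (quadCoeff b k)) •
        rightScalar V₁ (cpxGrading 𝒜) (evenCoord X k) := by
    rw [Finset.smul_sum]
    refine Finset.sum_congr rfl fun k _ => ?_
    rw [evalReal_quadPoly, sum_quadCoeff, smul_smul]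
    congr 1
    push_cast
    ring
  have h2 : (-(1 / 2) : ℂ) • (∑ k, ∑ i, ∑ j,
      (V.B₁ (b.f.u i) ((Module.finBasis ℝ V.spoEven k).1.2 (b.f.u j)) : ℂ) •
        (oddGen (cpxGrading 𝒜) b j * rightScalar V₁ (cpxGrading 𝒜) (evenCoord X k) *
          oddGen (cpxGrading 𝒜) b i)) =
      ∑ k, oddQuad (cpxGrading 𝒜) b k * rightScalar V₁ (cpxGrading 𝒜) (evenCoord X k) := by
    rw [Finset.smul_sum]
    refine Finset.sum_congr rfl fun k _ => ?_
    rw [oddQuad, smul_mul_assoc, Finset.sum_mul]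
    congr 1
    refine Finset.sum_congr rfl fun i _ => ?_
    rw [Finset.sum_mul]
    refine Finset.sum_congr rfl fun j _ => ?_
    rw [smul_mul_assoc, mul_assoc, mul_assoc]
    congr 2
    exact rightScalar_even_commute_leftForm (evenCoord_mem X k) _
  have h3 : (-(1 / 2) : ℂ) • ((∑ k, ∑ j, (V.B₀ (∑ i, v i • b.e i)
        ((Module.finBasis ℝ V.spoOdd k).1.2 (b.f.u j)) : ℂ) •
        (oddGen (cpxGrading 𝒜) b j * rightScalar V₁ (cpxGrading 𝒜) (oddPointCoord X k))) +
      ∑ k, ∑ j, (V.B₁ (b.f.u j)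
        ((Module.finBasis ℝ V.spoOdd k).1.1 (∑ i, v i • b.e i)) : ℂ) •
        (rightScalar V₁ (cpxGrading 𝒜) (oddPointCoord X k) * oddGen (cpxGrading 𝒜) b j)) =
      ∑ i, (v i : ℂ) • mixedCoeff (cpxGrading 𝒜) b (oddPointCoord X) i := by
    simp only [mixedCoeff, smul_comm _ (-(1 / 2) : ℂ)]
    rw [← Finset.smul_sum]
    congr 1
    simp only [smul_add, Finset.sum_add_distrib, Finset.smul_sum, smul_smul]
    congr 1
    · conv_rhs => rw [Finset.sum_comm]
      refine Finset.sum_congr rfl fun k _ => ?_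
      conv_rhs => rw [Finset.sum_comm]
      refine Finset.sum_congr rfl fun j _ => ?_
      rw [← Finset.sum_smul]
      congr 1
      simp only [map_sum, map_smul, LinearMap.sum_apply, LinearMap.smul_apply, smul_eq_mul]
      push_cast
      rfl
    · conv_rhs => rw [Finset.sum_comm]
      refine Finset.sum_congr rfl fun k _ => ?_
      conv_rhs => rw [Finset.sum_comm]
      refine Finset.sum_congr rfl fun j _ => ?_
      rw [← Finset.sum_smul]
      congr 1
      simp only [map_sum, map_smul, smul_eq_mul]
      push_cast
      rfl
  rw [← h1, ← h2, ← h3, ← smul_add, ← smul_add, ← add_assoc]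
  rfl

theorem body_tmul (h : NearSuperalgebra 𝒜) (a : CForms V₁) (c : ℂ ⊗[ℝ] P) :
    PForms.body h (GradedTensorProduct.tmul ℂ a c : PForms V₁ 𝒜) =
      ExteriorAlgebra.algebraMapInv a * h.bodyC c := by
  simp [PForms.body]

theorem body_includeLeft_mul (h : NearSuperalgebra 𝒜) (a : CForms V₁) (c : ℂ ⊗[ℝ] P) :
    PForms.body h (GradedTensorProduct.includeLeft (formGrading V₁) (cpxGrading 𝒜) a *
      rightScalar V₁ (cpxGrading 𝒜) c) = ExteriorAlgebra.algebraMapInv a * h.bodyC c := by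
  rw [includeLeft_mul_rightScalar, body_tmul]

theorem _root_.ExteriorAlgebra.algebraMapInv_ι {R M : Type*} [CommRing R] [AddCommGroup M]
    [Module R M] (x : M) :
    ExteriorAlgebra.algebraMapInv (ExteriorAlgebra.ι R x) = 0 := by
  simp [ExteriorAlgebra.algebraMapInv]

theorem body_rightScalar (h : NearSuperalgebra 𝒜) (c : ℂ ⊗[ℝ] P) :
    PForms.body h (rightScalar V₁ (cpxGrading 𝒜) c) = h.bodyC c := by
  rw [rightScalar, GradedTensorProduct.includeRight_apply, body_tmul, map_one, one_mul]

theorem body_oddQuad_mul (h : NearSuperalgebra 𝒜) (b : V.OrientedBasis) (k) (c : ℂ ⊗[ℝ] P) :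
    PForms.body h (oddQuad (cpxGrading 𝒜) b k * rightScalar V₁ (cpxGrading 𝒜) c) = 0 := by
  simp only [oddQuad, smul_mul_assoc, Finset.sum_mul, map_smul, map_sum, oddGen, leftForm,
    ← map_mul, body_includeLeft_mul]
  simp [ExteriorAlgebra.algebraMapInv_ι]

theorem body_mixedCoeff (h : NearSuperalgebra 𝒜) (b : V.OrientedBasis)
    (X : SuperPointC V.spoEven V.spoOdd 𝒜) (i) :
    PForms.body h (mixedCoeff (cpxGrading 𝒜) b (oddPointCoord X) i) = 0 := by
  have h1 : ∀ k j, rightScalar V₁ (cpxGrading 𝒜) (oddPointCoord X k) *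
      oddGen (cpxGrading 𝒜) b j = -(oddGen (cpxGrading 𝒜) b j *
        rightScalar V₁ (cpxGrading 𝒜) (oddPointCoord X k)) :=
    fun k j => rightScalar_odd_mul_leftForm (oddPointCoord_mem X k) _
  simp only [mixedCoeff, map_smul, map_add, map_sum, h1, map_neg]
  simp only [oddGen, leftForm, body_includeLeft_mul, ExteriorAlgebra.algebraMapInv_ι]
  simp

theorem body_moment (h : NearSuperalgebra 𝒜) (b : V.OrientedBasis)
    (X : SuperPointC V.spoEven V.spoOdd 𝒜) (v : Fin (m / 2) ⊕ Fin (m / 2) → ℝ) :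
    PForms.body h (moment b.f.u X (∑ i, v i • b.e i)) =
      ∑ k, h.bodyC (evenCoord X k) * evalReal v (quadPoly (quadCoeff b k)) := by
  rw [moment_eq]
  simp only [map_add, map_sum, map_smul, body_rightScalar, body_oddQuad_mul, body_mixedCoeff]
  simp [mul_comm]

/-- Splitting each `y_k` into body and soul, the scalar part cancels. What remains is `Σ b(y_k)
ω_k`, independent of `v`, and the value at `v` of a polynomial made of the weights times the souls
and of the mixed part. -/
theorem moment_sub_body (h : NearSuperalgebra 𝒜) (b : V.OrientedBasis)
    (X : SuperPointC V.spoEven V.spoOdd 𝒜) (v : Fin (m / 2) ⊕ Fin (m / 2) → ℝ) :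
    moment b.f.u X (∑ i, v i • b.e i) -
        algebraMap ℂ (PForms V₁ 𝒜) (PForms.body h (moment b.f.u X (∑ i, v i • b.e i))) =
      (∑ k, h.bodyC (evenCoord X k) • oddQuad (cpxGrading 𝒜) b k) +
      evalAlg v ((∑ k, gaussWeight (quadCoeff b) (oddQuad (cpxGrading 𝒜) b) k *
        1 ⊗ₜ rightScalar V₁ (cpxGrading 𝒜) (evenSoul h X k)) +
        mixedPoly (cpxGrading 𝒜) b (oddPointCoord X)) := by
  have hY : ∀ k, evenCoord X k =
      algebraMap ℂ _ (h.bodyC (evenCoord X k)) + evenSoul h X k := fun k => by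
    rw [evenSoul]; abel
  rw [body_moment, moment_eq, map_add, evalAlg_mixedPoly, ← add_assoc, add_sub_right_comm]
  congr 1
  have h1 : ∀ k, rightScalar V₁ (cpxGrading 𝒜) (evenCoord X k) =
      algebraMap ℂ _ (h.bodyC (evenCoord X k)) +
        rightScalar V₁ (cpxGrading 𝒜) (evenSoul h X k) := fun k => by
    conv_lhs => rw [hY k]
    rw [map_add, AlgHom.commutes]
  simp only [h1, map_sum, gaussWeight, add_mul, mul_add, map_add, smul_add,
    Finset.sum_add_distrib, Algebra.TensorProduct.tmul_mul_tmul, one_mul, mul_one, evalAlg_tmul,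
    map_one, one_smul]
  have h2 : ∀ k, oddQuad (cpxGrading 𝒜) b k * algebraMap ℂ _ (h.bodyC (evenCoord X k)) =
      h.bodyC (evenCoord X k) • oddQuad (cpxGrading 𝒜) b k := fun k => by
    rw [← Algebra.commutes, Algebra.smul_def]
  have h3 : ∀ k, evalReal v (quadPoly (quadCoeff b k)) •
      algebraMap ℂ (GradedTensorProduct ℂ (formGrading V₁) (cpxGrading 𝒜))
        (h.bodyC (evenCoord X k)) =
      algebraMap ℂ _ (h.bodyC (evenCoord X k) * evalReal v (quadPoly (quadCoeff b k))) := fun k => by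
    rw [Algebra.smul_def, ← map_mul, mul_comm]
  simp only [h2, h3]
  abel

section Commutation

variable {C : Type*} [Ring C] [Algebra ℂ C] {ι : Type*}

theorem tmul_commute {p q : MvPolynomial ι ℂ} {a c : C} (h : Commute a c) :
    Commute (p ⊗ₜ[ℂ] a) (q ⊗ₜ[ℂ] c) := by
  simp only [Commute, SemiconjBy, Algebra.TensorProduct.tmul_mul_tmul]
  rw [h.eq, mul_comm p]

end Commutation

section

variable (h : NearSuperalgebra 𝒜) (b : V.OrientedBasis) (X : SuperPointC V.spoEven V.spoOdd 𝒜)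

theorem oddPointCoord_anticomm (h : NearSuperalgebra 𝒜) (X : SuperPointC V.spoEven V.spoOdd 𝒜)
    (k l) :
    oddPointCoord X k * oddPointCoord X l = -(oddPointCoord X l * oddPointCoord X k) :=
  h.odd_anticomm (oddPointCoord_mem X k) (oddPointCoord_mem X l)

/-- Souls are even, so they commute with all the odd generators and with their products. -/
theorem soul_commute_quadSpan (j) {x : PForms V₁ 𝒜}
    (hx : x ∈ quadSpan (oddFamily (cpxGrading 𝒜) b (oddPointCoord X))) :
    Commute (rightScalar V₁ (cpxGrading 𝒜) (evenSoul h X j)) x := by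
  have h1 : ∀ p, Commute (rightScalar V₁ (cpxGrading 𝒜) (evenSoul h X j))
      (oddFamily (cpxGrading 𝒜) b (oddPointCoord X) p) := by
    rintro (i | k)
    · exact rightScalar_even_commute_leftForm (evenSoul_mem h X j) _
    · exact (h.even_commute (evenSoul_mem h X j) (oddPointCoord_mem X k)).map
        (rightScalar V₁ (cpxGrading 𝒜))
  exact commute_of_mem_quadSpan (fun p q => (h1 p).mul_right (h1 q)) hx

theorem soul_commute (i j) : Commute (evenSoul h X i) (evenSoul h X j) :=
  h.even_commute (evenSoul_mem h X i) (evenSoul_mem h X j)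

theorem quadSpan_commute_weight (j) {x : PForms V₁ 𝒜}
    (hx : x ∈ quadSpan (oddFamily (cpxGrading 𝒜) b (oddPointCoord X)))
    (p : MvPolynomial (Fin (m / 2) ⊕ Fin (m / 2)) ℂ) :
    Commute (p ⊗ₜ[ℂ] x) (gaussWeight (quadCoeff b) (oddQuad (cpxGrading 𝒜) b) j *
      1 ⊗ₜ rightScalar V₁ (cpxGrading 𝒜) (evenSoul h X j)) := by
  refine Commute.mul_right (Commute.add_right ?_ ?_) ?_
  · exact tmul_commute (Commute.one_right _)
  · exact tmul_commute (quadSpan_commute (oddFamily_anticomm (oddPointCoord_mem X)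
      (oddPointCoord_anticomm h X)) hx (oddQuad_mem_quadSpan _ j))
  · exact tmul_commute (soul_commute_quadSpan h b X j hx).symm

theorem quadSpan_commute_weight_one (j) (p : MvPolynomial (Fin (m / 2) ⊕ Fin (m / 2)) ℂ) :
    Commute (p ⊗ₜ[ℂ] 1) (gaussWeight (quadCoeff b) (oddQuad (cpxGrading 𝒜) b) j *
      1 ⊗ₜ rightScalar V₁ (cpxGrading 𝒜) (evenSoul h X j)) :=
  Commute.mul_right (Commute.add_right (tmul_commute (Commute.one_left _))
    (tmul_commute (Commute.one_left _))) (tmul_commute (Commute.one_left _))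

theorem soul_commute_weight (i j) :
    Commute ((1 : MvPolynomial (Fin (m / 2) ⊕ Fin (m / 2)) ℂ) ⊗ₜ[ℂ]
      rightScalar V₁ (cpxGrading 𝒜) (evenSoul h X i))
      (gaussWeight (quadCoeff b) (oddQuad (cpxGrading 𝒜) b) j) := by
  refine Commute.add_right (tmul_commute (Commute.one_right _)) ?_
  exact tmul_commute (soul_commute_quadSpan h b X i (oddQuad_mem_quadSpan _ j))

/-- The weights need not be nilpotent, because of the polynomials `Q_k`; nilpotency comes from the
souls that multiply them. -/
theorem isNilpotent_gaussWeight_sum :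
    IsNilpotent (∑ k, gaussWeight (quadCoeff b) (oddQuad (cpxGrading 𝒜) b) k *
        1 ⊗ₜ rightScalar V₁ (cpxGrading 𝒜) (evenSoul h X k)) := by
  refine Commute.isNilpotent_sum (fun k _ => ?_) fun i j _ _ => ?_
  · refine (soul_commute_weight h b X k k).symm.isNilpotent_mul_left ?_
    obtain ⟨K, hK⟩ := isNilpotent_evenSoul h X k
    exact ⟨K, by
      rw [Algebra.TensorProduct.tmul_pow, ← map_pow, hK, map_zero, TensorProduct.tmul_zero]⟩
  · have hss : Commute ((1 : MvPolynomial (Fin (m / 2) ⊕ Fin (m / 2)) ℂ) ⊗ₜ[ℂ]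
        rightScalar V₁ (cpxGrading 𝒜) (evenSoul h X i))
        ((1 : MvPolynomial (Fin (m / 2) ⊕ Fin (m / 2)) ℂ) ⊗ₜ[ℂ]
        rightScalar V₁ (cpxGrading 𝒜) (evenSoul h X j)) :=
      tmul_commute ((soul_commute h X i j).map (rightScalar V₁ (cpxGrading 𝒜)))
    refine Commute.mul_left ?_ ((soul_commute_weight h b X i j).mul_right hss)
    exact Commute.add_left (quadSpan_commute_weight_one h b X j _)
      (quadSpan_commute_weight h b X j (oddQuad_mem_quadSpan _ i) 1)

/-- The pieces of the exponent commute, so its exponential is a product: the scalar Gaussian at the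
body, the exponential of the `ω_k` at the body, and a polynomial in `v`. This is the form in which
`gaussAlg` integrates it. -/
theorem exp_moment (v : Fin (m / 2) ⊕ Fin (m / 2) → ℝ) :
    PForms.exp h (moment b.f.u X (∑ i, v i • b.e i)) =
      gaussian (quadCoeff b) (fun k => h.bodyC (evenCoord X k)) v •
        (nilExp (∑ k, h.bodyC (evenCoord X k) • oddQuad (cpxGrading 𝒜) b k) *
          evalAlg v (nilExp (∑ k, gaussWeight (quadCoeff b) (oddQuad (cpxGrading 𝒜) b) k *
              1 ⊗ₜ rightScalar V₁ (cpxGrading 𝒜) (evenSoul h X k)) *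
            nilExp (mixedPoly (cpxGrading 𝒜) b (oddPointCoord X)))) := by
  have hanti := oddFamily_anticomm (b := b) (oddPointCoord_mem X) (oddPointCoord_anticomm h X)
  have hmix := isNilpotent_mixedPoly (b := b) (oddPointCoord_mem X) (oddPointCoord_anticomm h X)
  have hW := isNilpotent_gaussWeight_sum h b X
  have hc1 : Commute (∑ k, gaussWeight (quadCoeff b) (oddQuad (cpxGrading 𝒜) b) k *
      1 ⊗ₜ rightScalar V₁ (cpxGrading 𝒜) (evenSoul h X k))
      (mixedPoly (cpxGrading 𝒜) b (oddPointCoord X)) :=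
    Commute.sum_left _ _ _ fun k _ => Commute.sum_right _ _ _ fun i _ =>
      (quadSpan_commute_weight h b X k (mixedCoeff_mem_quadSpan i) _).symm
  have hmem : ∑ k, h.bodyC (evenCoord X k) • oddQuad (cpxGrading 𝒜) b k ∈
      quadSpan (oddFamily (cpxGrading 𝒜) b (oddPointCoord X)) :=
    Submodule.sum_mem _ fun k _ => Submodule.smul_mem _ _ (oddQuad_mem_quadSpan _ k)
  have hc2 : Commute ((1 : MvPolynomial (Fin (m / 2) ⊕ Fin (m / 2)) ℂ) ⊗ₜ[ℂ]
      ∑ k, h.bodyC (evenCoord X k) • oddQuad (cpxGrading 𝒜) b k)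
      ((∑ k, gaussWeight (quadCoeff b) (oddQuad (cpxGrading 𝒜) b) k *
        1 ⊗ₜ rightScalar V₁ (cpxGrading 𝒜) (evenSoul h X k)) +
        mixedPoly (cpxGrading 𝒜) b (oddPointCoord X)) := by
    refine Commute.add_right ?_ ?_
    · exact Commute.sum_right _ _ _ fun k _ => quadSpan_commute_weight h b X k hmem 1
    · exact Commute.sum_right _ _ _ fun i _ =>
        tmul_commute (quadSpan_commute hanti hmem (mixedCoeff_mem_quadSpan i))
  have hc3 := hc2.map (evalAlg v)
  rw [evalAlg_tmul, map_one, one_smul] at hc3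
  have hsum := hc1.isNilpotent_add hW hmix
  rw [← nilExp_add_of_commute hc1 hW hmix, map_nilExp _ hsum,
    ← nilExp_add_of_commute hc3 (isNilpotent_of_mem_quadSpan hanti hmem) (hsum.map _),
    ← moment_sub_body, gaussian, ← body_moment]
  rfl

end

end OrientedSymplecticSuperspace

end

noncomputable section

/-! ### The super Pfaffian and its values at points -/

namespace OrientedSymplecticSuperspace

variable {V₀ V₁ : Type*} [AddCommGroup V₀] [Module ℝ V₀] [Module.Finite ℝ V₀]
  [AddCommGroup V₁] [Module ℝ V₁] [Module.Finite ℝ V₁] {m n : ℕ}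
  {V : OrientedSymplecticSuperspace V₀ V₁ m n}

/-- The coordinate `ζ^k` on the odd part of `spo(V)`. -/
def genericOdd (V : OrientedSymplecticSuperspace V₀ V₁ m n)
    (k : Fin (Module.finrank ℝ V.spoOdd)) : CForms V.spoOdd :=
  ExteriorAlgebra.ι ℂ (Complex.ofRealCLM.toLinearMap ∘ₗ (Module.finBasis ℝ V.spoOdd).coord k)

theorem genericOdd_mem (k) : genericOdd V k ∈ formGrading V.spoOdd 1 :=
  CliffordAlgebra.ι_mem_evenOdd_one _ _

theorem genericOdd_anticomm (k l) :
    genericOdd V k * genericOdd V l = -(genericOdd V l * genericOdd V k) :=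
  ExteriorAlgebra.ι_mul_ι_comm_neg _ _

/-- `∫_V exp(-½ B(v, Xv))` at the generic point `X` with even part of coordinates `t`, computed in a
given basis. -/
def genericIntegral (b : V.OrientedBasis) (t : Fin (Module.finrank ℝ V.spoEven) → ℂ) :
    CForms V.spoOdd :=
  gaussAlg (quadCoeff b) (oddQuad (formGrading V.spoOdd) b)
    (extendForm (formGrading V.spoOdd) b.f.berezin) t
    (((2 * Real.pi : ℝ) ^ (m / 2) : ℂ)⁻¹ •
      nilExp (mixedPoly (formGrading V.spoOdd) b (genericOdd V)))

/-- The super Pfaffian on the complexification of `spo(V)`. -/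
def superPfaffianC (b : V.OrientedBasis) (Y : V.spoEven ⊗[ℝ] ℂ) : CForms V.spoOdd :=
  genericIntegral b fun a => pointCoord ((Module.finBasis ℝ V.spoEven).coord a) Y

/-- The super Pfaffian. -/
def superPfaffian (b : V.OrientedBasis) (Y : V.spoEven) : CForms V.spoOdd :=
  superPfaffianC b (Y ⊗ₜ[ℝ] (1 : ℂ))

theorem superPfaffianC_ofCoordC (b : V.OrientedBasis) (t : Fin (Module.finrank ℝ V.spoEven) → ℂ) :
    superPfaffianC b (ofCoordC V.spoEven t) = genericIntegral b t := by
  simp only [superPfaffianC, pointCoord_ofCoordC]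

theorem superPfaffian_ofCoord (b : V.OrientedBasis) (t : Fin (Module.finrank ℝ V.spoEven) → ℝ) :
    superPfaffian b (ofCoord V.spoEven t) = genericIntegral b fun a => (t a : ℂ) := by
  rw [superPfaffian, ← ofCoordC_ofReal, superPfaffianC_ofCoordC]

theorem analyticAt_genericIntegral (b : V.OrientedBasis) (ℓ : CForms V.spoOdd →ₗ[ℂ] ℂ)
    {t : Fin (Module.finrank ℝ V.spoEven) → ℂ} (ht : t ∈ gaussDomain (quadCoeff b)) :
    AnalyticAt ℂ (fun t => ℓ (genericIntegral b t)) t :=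
  analyticAt_gaussAlg oddQuad_commute isNilpotent_oddQuad ht ℓ _

theorem isHolomorphicSuper_superPfaffianC (b : V.OrientedBasis) :
    IsHolomorphicSuper V.posTube (superPfaffianC b) := by
  intro ℓ t ht
  simp only [superPfaffianC_ofCoordC]
  exact (analyticAt_genericIntegral b ℓ
    ((mem_posTube_iff b t).1 ht)).differentiableAt.differentiableWithinAt

theorem isAnalyticSuper_superPfaffian (b : V.OrientedBasis) :
    IsAnalyticSuper V.posCone (superPfaffian b) := by
  intro ℓ t ht
  simp only [superPfaffian_ofCoord]
  let R : (Fin (Module.finrank ℝ V.spoEven) → ℝ) →L[ℝ] (Fin (Module.finrank ℝ V.spoEven) → ℂ) :=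
    ContinuousLinearMap.pi fun i => Complex.ofRealCLM.comp (ContinuousLinearMap.proj i)
  have h1 : AnalyticAt ℝ (fun t => ℓ (genericIntegral b t)) (R t) :=
    (analyticAt_genericIntegral b ℓ ((mem_posCone_iff b t).1 ht)).restrictScalars
  exact h1.comp (R.analyticAt t)

variable {P : Type*} [Ring P] [Algebra ℝ P] {𝒜 : ZMod 2 → Submodule ℝ P} [GradedAlgebra 𝒜]

theorem oddValue_genericOdd (h : NearSuperalgebra 𝒜) (X : SuperPointC V.spoEven V.spoOdd 𝒜) (k) :
    oddValue h X.2 (genericOdd V k) = oddPointCoord X k := by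
  rw [oddValue, genericOdd, ExteriorAlgebra.lift_ι_apply]
  have hk : ∀ j, (Complex.ofRealCLM.toLinearMap ∘ₗ (Module.finBasis ℝ V.spoOdd).coord k)
      (Module.finBasis ℝ V.spoOdd j) = if j = k then 1 else 0 := fun j => by
    by_cases hj : j = k <;> simp [hj]
  simp only [oddCoord, oddPointCoord, LinearMap.coe_mk, AddHom.coe_mk, hk]
  rw [Finset.sum_eq_single k (fun j _ hj => by rw [if_neg hj]; exact zero_smul ℂ _) (by simp),
    if_pos rfl]
  exact one_smul ℂ _

theorem oddValue_mem (h : NearSuperalgebra 𝒜) (X : SuperPointC V.spoEven V.spoOdd 𝒜) (i : ZMod 2)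
    (c : CForms V.spoOdd) (hc : c ∈ formGrading V.spoOdd i) :
    oddValue h X.2 c ∈ cpxGrading 𝒜 i :=
  ExteriorAlgebra.map_mem_of_ι (𝒞 := cpxGrading 𝒜) (oddValue h X.2) (fun ζ => by
    rw [oddValue, ExteriorAlgebra.lift_ι_apply]; exact oddCoord_mem X.2 ζ) i c hc

section

variable (h : NearSuperalgebra 𝒜) (b : V.OrientedBasis) (X : SuperPointC V.spoEven V.spoOdd 𝒜)

/-- Substituting the odd coordinates of `X` for the `ζ^k` preserves parity, hence extends to
`Λ(V₁^*) ⊗ -` with the rule of signs, and carries the generic integrand to the one at `X`. -/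
theorem oddValue_genericIntegral (t : Fin (Module.finrank ℝ V.spoEven) → ℂ) :
    oddValue h X.2 (genericIntegral b t) =
      gaussAlg (quadCoeff b) (oddQuad (cpxGrading 𝒜) b) (extendForm (cpxGrading 𝒜) b.f.berezin) t
        (((2 * Real.pi : ℝ) ^ (m / 2) : ℂ)⁻¹ •
          nilExp (mixedPoly (cpxGrading 𝒜) b (oddPointCoord X))) := by
  have hη : ∀ j, gradedTensorMap (oddValue h X.2) (oddValue_mem h X)
      (oddGen (formGrading V.spoOdd) b j) = oddGen (cpxGrading 𝒜) b j :=
    fun j => gradedTensorMap_leftForm _ _ _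
  have hz : ∀ k, gradedTensorMap (oddValue h X.2) (oddValue_mem h X)
      (rightScalar V₁ (formGrading V.spoOdd) (genericOdd V k)) =
        rightScalar V₁ (cpxGrading 𝒜) (oddPointCoord X k) := fun k => by
    rw [gradedTensorMap_rightScalar, oddValue_genericOdd]
  have hω : ∀ k, gradedTensorMap (oddValue h X.2) (oddValue_mem h X)
      (oddQuad (formGrading V.spoOdd) b k) = oddQuad (cpxGrading 𝒜) b k := fun k => by
    simp only [oddQuad, map_smul, map_sum, map_mul, hη]
  have hm : ∀ i, gradedTensorMap (oddValue h X.2) (oddValue_mem h X)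
      (mixedCoeff (formGrading V.spoOdd) b (genericOdd V) i) =
        mixedCoeff (cpxGrading 𝒜) b (oddPointCoord X) i := fun i => by
    simp only [mixedCoeff, map_smul, map_add, map_sum, map_mul, hη, hz]
  have := map_gaussAlg (b := quadCoeff b) (ω' := oddQuad (formGrading V.spoOdd) b)
    (β' := extendForm (formGrading V.spoOdd) b.f.berezin)
    (β := extendForm (cpxGrading 𝒜) b.f.berezin) (oddValue h X.2).toLinearMap
    (gradedTensorMap (oddValue h X.2) (oddValue_mem h X))
    (map_extendForm (oddValue h X.2) (oddValue_mem h X) b.f.berezin)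
    (isNilpotent_sum_smul oddQuad_commute isNilpotent_oddQuad t)
    (((2 * Real.pi : ℝ) ^ (m / 2) : ℂ)⁻¹ •
      nilExp (mixedPoly (formGrading V.spoOdd) b (genericOdd V)))
  rw [genericIntegral, ← AlgHom.toLinearMap_apply, this, map_smul,
    map_nilExp _ (isNilpotent_mixedPoly genericOdd_mem genericOdd_anticomm)]
  simp only [hω, mixedPoly, map_sum, Algebra.TensorProduct.map_tmul, AlgHom.id_apply, hm]

theorem exists_soul_prod_eq_zero :
    ∃ K : ℕ, ∀ k, K ≤ k → ∀ a : Fin k → Fin (Module.finrank ℝ V.spoEven),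
      (List.ofFn fun i => evenSoul h X (a i)).prod = 0 :=
  exists_ofFn_prod_eq_zero (R := ℂ) (soul_commute h X) (isNilpotent_evenSoul h X)

theorem body_eq_ofCoordC :
    X.body h = ofCoordC V.spoEven fun k => h.bodyC (evenCoord X k) := by
  conv_lhs => rw [SuperPointC.body, ← sum_tmul_pointCoord X.1]
  rw [map_sum]
  rfl

/-- The value of the super Pfaffian at a point, in terms of a Gaussian integral. -/
theorem superValueC_superPfaffianC (hX : X.body h ∈ V.posTube) :
    superValueC h (superPfaffianC b) X =
      gaussAlg (quadCoeff b) (oddQuad (cpxGrading 𝒜) b) (extendForm (cpxGrading 𝒜) b.f.berezin)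
        (fun k => h.bodyC (evenCoord X k))
        (nilExp (∑ k, gaussWeight (quadCoeff b) (oddQuad (cpxGrading 𝒜) b) k *
              1 ⊗ₜ rightScalar V₁ (cpxGrading 𝒜) (evenSoul h X k)) *
          (((2 * Real.pi : ℝ) ^ (m / 2) : ℂ)⁻¹ •
            nilExp (mixedPoly (cpxGrading 𝒜) b (oddPointCoord X)))) := by
  have := h.finite
  rw [body_eq_ofCoordC, mem_posTube_iff b] at hX
  obtain ⟨K, hK⟩ := exists_soul_prod_eq_zero h X
  rw [superValueC, taylorValueAlg_eq_sum (K := K) (D := fun l => gaussAlg (quadCoeff b)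
    (oddQuad (cpxGrading 𝒜) b) (extendForm (cpxGrading 𝒜) b.f.berezin)
    (fun k => h.bodyC (evenCoord X k))
    ((l.map (gaussWeight (quadCoeff b) (oddQuad (cpxGrading 𝒜) b))).prod *
      (((2 * Real.pi : ℝ) ^ (m / 2) : ℂ)⁻¹ •
            nilExp (mixedPoly (cpxGrading 𝒜) b (oddPointCoord X))))) _ hK]
  -- The Taylor sum in the souls is resummed under the integral; this needs the souls to commute
  -- with the `ω_j` and with the mixed exponential.
  · refine sum_gaussAlg_eq (extendForm_mul_rightScalar _) (fun i j =>
      soul_commute_quadSpan h b X i (oddQuad_mem_quadSpan _ j)) (fun i => ?_) hK _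
    refine Commute.smul_right (Commute.nilExp_right ?_) _
    exact Commute.sum_right _ _ _ fun j _ =>
      tmul_commute (soul_commute_quadSpan h b X i (mixedCoeff_mem_quadSpan j))
  · intro ℓ k a
    simp only [superPfaffianC_ofCoordC, oddValue_genericIntegral]
    exact iteratedFDeriv_gaussAlg oddQuad_commute isNilpotent_oddQuad hX ℓ _ k a

/-- The resummed Taylor value and the factored integrand of `exp_moment` involve the same
polynomial, up to the normalizing power of `2π`. -/
theorem hasLiouvilleIntegral_superPfaffianC (hX : X.body h ∈ V.posTube) :
    HasLiouvilleIntegral b (fun v₀ => PForms.exp h (moment b.f.u X v₀))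
      (superValueC h (superPfaffianC b) X) := by
  have hX' := hX
  rw [body_eq_ofCoordC, mem_posTube_iff b] at hX'
  intro ℓ
  simp only [exp_moment]
  obtain ⟨h1, h2⟩ := gaussAlg_eq_integral (β := extendForm (cpxGrading 𝒜) b.f.berezin)
    (ω := oddQuad (cpxGrading 𝒜) b) hX' ℓ
    (nilExp (∑ k, gaussWeight (quadCoeff b) (oddQuad (cpxGrading 𝒜) b) k *
              1 ⊗ₜ rightScalar V₁ (cpxGrading 𝒜) (evenSoul h X k)) *
            nilExp (mixedPoly (cpxGrading 𝒜) b (oddPointCoord X)))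
  refine ⟨h1, ?_⟩
  rw [superValueC_superPfaffianC h b X hX, mul_smul_comm, map_smul, map_smul, smul_eq_mul, h2]
  rfl

end

/-! ### Restriction to real points -/

section Real

variable (h : NearSuperalgebra 𝒜) (b : V.OrientedBasis) (X : SuperPoint V.spoEven V.spoOdd 𝒜)

theorem evenCoord_toC (k) : evenCoord X.toC k =
    1 ⊗ₜ[ℝ] ((pointCoord ((Module.finBasis ℝ V.spoEven).coord k) X.1 : 𝒜 0) : P) := by
  rw [evenCoord, SuperPoint.toC, pointCoord_lTensor]
  rfl

theorem coord_body (k) : (Module.finBasis ℝ V.spoEven).coord k (X.body h) =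
    h.body ((pointCoord ((Module.finBasis ℝ V.spoEven).coord k) X.1 : 𝒜 0) : P) := by
  conv_lhs => rw [SuperPoint.body, ← sum_tmul_pointCoord X.1]
  simp [Finsupp.single_apply]

theorem bodyC_evenCoord_toC (k) : h.bodyC (evenCoord X.toC k) =
    ((Module.finBasis ℝ V.spoEven).coord k (X.body h) : ℂ) := by
  rw [evenCoord_toC, h.bodyC_tmul, coord_body, one_mul]

theorem body_toC_mem (hX : X.body h ∈ V.posCone) : X.toC.body h ∈ V.posTube := by
  rw [body_eq_ofCoordC]
  simp only [bodyC_evenCoord_toC]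
  rw [ofCoordC_ofReal, ofCoord_coord]
  change TensorProduct.rid ℝ V.spoEven (Complex.reLm.lTensor V.spoEven _) ∈ V.posCone
  simpa using hX

/-- Real and complex Taylor expansions at a real body have the same coefficients `D` and the same
souls, so the real case reduces to the holomorphic one. -/
theorem superValue_superPfaffian (hX : X.body h ∈ V.posCone) :
    superValue h (superPfaffian b) X = superValueC h (superPfaffianC b) X.toC := by
  have := h.finite
  have hX' := body_toC_mem h X hX
  rw [body_eq_ofCoordC, mem_posTube_iff b] at hX'
  simp only [bodyC_evenCoord_toC] at hX'
  obtain ⟨K, hK⟩ := exists_soul_prod_eq_zero h X.toC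
  let D : List (Fin (Module.finrank ℝ V.spoEven)) → ℂ ⊗[ℝ] P := fun l => gaussAlg (quadCoeff b)
    (oddQuad (cpxGrading 𝒜) b) (extendForm (cpxGrading 𝒜) b.f.berezin)
    (fun k => ((Module.finBasis ℝ V.spoEven).coord k (X.body h) : ℂ))
    ((l.map (gaussWeight (quadCoeff b) (oddQuad (cpxGrading 𝒜) b))).prod *
      (((2 * Real.pi : ℝ) ^ (m / 2) : ℂ)⁻¹ •
            nilExp (mixedPoly (cpxGrading 𝒜) b (oddPointCoord X.toC))))
  rw [superValue, superValueC, taylorValueAlg_eq_sum (K := K) (D := D) _ hK,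
    taylorValueAlg_eq_sum (K := K) (D := D) _ hK]
  · intro ℓ k a
    simp only [superPfaffianC_ofCoordC, oddValue_genericIntegral, bodyC_evenCoord_toC]
    exact iteratedFDeriv_gaussAlg oddQuad_commute isNilpotent_oddQuad hX' ℓ _ k a
  · intro ℓ k a
    simp only [superPfaffian_ofCoord, oddValue_genericIntegral]
    exact iteratedFDeriv_real_gaussAlg oddQuad_commute isNilpotent_oddQuad hX' ℓ _ k a

end Real

end OrientedSymplecticSuperspace

end

noncomputable section

/-! ### Iterated contractions -/

section Contraction

variable {M : Type*} [AddCommGroup M] [Module ℂ M]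

/-- Contraction of the exterior algebra with a linear form. -/
abbrev extContract (d : Module.Dual ℂ M) : Module.End ℂ (ExteriorAlgebra ℂ M) :=
  CliffordAlgebra.contractLeft (Q := (0 : QuadraticForm ℂ M)) d

theorem extContract_prod_mul {k : ℕ} (d : Module.Dual ℂ M) (x : Fin k → M) (hx : ∀ i, d (x i) = 0)
    (y : ExteriorAlgebra ℂ M) :
    extContract d ((List.ofFn fun i => ExteriorAlgebra.ι ℂ (x i)).prod * y) =
      (-1 : ℂ) ^ k • ((List.ofFn fun i => ExteriorAlgebra.ι ℂ (x i)).prod * extContract d y) := by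
  induction k with
  | zero => simp
  | succ k ih =>
    rw [List.ofFn_succ, List.prod_cons, mul_assoc, extContract, CliffordAlgebra.contractLeft_ι_mul,
      hx, zero_smul, zero_sub]
    have := ih (fun i => x i.succ) fun i => hx _
    rw [extContract] at this
    rw [this, mul_smul_comm, pow_succ, mul_smul, neg_one_smul, smul_neg, mul_assoc]

/-- The value of `∂_1 ⋯ ∂_n` at `ξ^1 ⋯ ξ^n`. -/
def contractSign (n : ℕ) : ℂ := ∏ i ∈ Finset.range n, (-1) ^ i

theorem contractSign_ne_zero (n : ℕ) : contractSign n ≠ 0 :=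
  Finset.prod_ne_zero_iff.2 fun i _ => pow_ne_zero _ (by norm_num)

/-- The contraction applied first, by the last form, passes all the other generators before meeting
its own; each step of the induction contributes the sign `(-1)^n`. -/
theorem prod_extContract_prod {n : ℕ} (d : Fin n → Module.Dual ℂ M) (x : Fin n → M)
    (h : ∀ i j, d i (x j) = if i = j then 1 else 0) :
    (List.ofFn fun i => extContract (d i)).prod
      (List.ofFn fun i => ExteriorAlgebra.ι ℂ (x i)).prod = algebraMap ℂ _ (contractSign n) := by
  induction n with
  | zero => simp [contractSign]
  | succ n ih =>
    rw [List.ofFn_succ', List.ofFn_succ', List.concat_eq_append, List.concat_eq_append,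
      List.prod_append, List.prod_append, List.prod_singleton, List.prod_singleton,
      Module.End.mul_apply, extContract_prod_mul _ _ fun i => by
        rw [h, if_neg (Fin.castSucc_lt_last i).ne'], extContract, CliffordAlgebra.contractLeft_ι, h,
      if_pos rfl, map_one, mul_one, map_smul]
    rw [ih (fun i => d i.castSucc) (fun i => x i.castSucc) fun i j => by
      rw [h]; simp [Fin.castSucc_inj]]
    rw [contractSign, contractSign, Finset.prod_range_succ, mul_comm, map_mul, Algebra.smul_def]

/-- The degree `0` part of an iterated contraction is alternating in the linear forms. -/
def contractAlternating (n : ℕ) (φ : ExteriorAlgebra ℂ M) :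
    (Module.Dual ℂ M) [⋀^Fin n]→ₗ[ℂ] ℂ :=
  ((ExteriorAlgebra.algebraMapInv (R := ℂ)).toLinearMap ∘ₗ (LinearMap.applyₗ φ) ∘ₗ
    (ExteriorAlgebra.lift ℂ ⟨CliffordAlgebra.contractLeft (Q := (0 : QuadraticForm ℂ M)), fun d =>
      LinearMap.ext fun x => CliffordAlgebra.contractLeft_contractLeft d x⟩ :
      ExteriorAlgebra ℂ (Module.Dual ℂ M) →ₐ[ℂ] Module.End ℂ (ExteriorAlgebra ℂ M)).toLinearMap
    ).compAlternatingMap (ExteriorAlgebra.ιMulti ℂ n)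

theorem contractAlternating_apply {n : ℕ} (φ : ExteriorAlgebra ℂ M)
    (d : Fin n → Module.Dual ℂ M) : contractAlternating n φ d =
      ExteriorAlgebra.algebraMapInv ((List.ofFn fun i => extContract (d i)).prod φ) := by
  simp only [contractAlternating, LinearMap.compAlternatingMap_apply, LinearMap.comp_apply,
    AlgHom.toLinearMap_apply, LinearMap.applyₗ_apply_apply, ExteriorAlgebra.ιMulti_apply,
    map_list_prod, List.map_ofFn, Function.comp_def]
  simp only [ExteriorAlgebra.lift_ι_apply]

end Contraction

/-! ### The Berezin integral and the orientation -/

namespace OddSymplecticBasis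

variable {V₁ : Type*} [AddCommGroup V₁] [Module ℝ V₁] {B₁ : LinearMap.BilinForm ℝ V₁} {n : ℕ}

theorem c_ne_zero (f : OddSymplecticBasis B₁ n) (i : Fin n) : f.c i ≠ 0 := by
  rcases f.c_eq i with h | h <;> simp [h]

theorem evalAt_ξ (f : OddSymplecticBasis B₁ n) (i j : Fin n) :
    f.evalAt i (f.ξ j) = if i = j then 1 else 0 := by
  by_cases hij : i = j
  · subst hij
    simp [evalAt, ξ, f.c_ne_zero]
  · simp [evalAt, ξ, hij]

theorem sum_evalAt_smul_ξ (f : OddSymplecticBasis B₁ n) (η : V₁ →ₗ[ℝ] ℂ) :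
    ∑ j, f.evalAt j η • f.ξ j = η := by
  refine f.u.ext fun i => ?_
  rw [LinearMap.sum_apply, Finset.sum_eq_single i]
  · simp [evalAt, ξ, mul_right_comm, f.c_ne_zero]
  · intro j _ hj
    simp [ξ, hj.symm]
  · simp

/-- The evaluations at the `f_i` form a basis of the dual of `V₁^* ⊗ ℂ`. -/
def evalBasis (f : OddSymplecticBasis B₁ n) :
    Module.Basis (Fin n) ℂ (Module.Dual ℂ (V₁ →ₗ[ℝ] ℂ)) :=
  Module.Basis.mk (v := f.evalAt)
    (Fintype.linearIndependent_iff.2 fun g hg i => by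
      have := congrArg (fun d => d (f.ξ i)) hg
      simpa [LinearMap.sum_apply, evalAt_ξ] using this)
    (fun d _ => by
      have : d = ∑ j, d (f.ξ j) • f.evalAt j := LinearMap.ext fun η => by
        conv_lhs => rw [← f.sum_evalAt_smul_ξ η]
        simp [LinearMap.sum_apply, mul_comm]
      rw [this]
      exact Submodule.sum_mem _ fun j _ => Submodule.smul_mem _ _
        (Submodule.subset_span ⟨j, rfl⟩))

theorem berezin_eq_contractAlternating (f : OddSymplecticBasis B₁ n) (φ : CForms V₁) :
    f.berezin φ = contractAlternating n φ f.evalAt := by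
  rw [contractAlternating_apply]
  rfl

theorem berezin_volume (f : OddSymplecticBasis B₁ n) : f.berezin f.volume = contractSign n := by
  rw [berezin_eq_contractAlternating, contractAlternating_apply, volume,
    prod_extContract_prod _ _ f.evalAt_ξ]
  exact ExteriorAlgebra.algebraMap_leftInverse _ _

/-- The Berezin integral depends only on the orientation. -/
theorem berezin_eq_of_volume_eq (f g : OddSymplecticBasis B₁ n) (h : f.volume = g.volume) :
    f.berezin = g.berezin := by
  -- An alternating `n`-form on a space of dimension `n` is a multiple of the determinant, with a
  -- factor that does not depend on `φ`.
  have key : ∀ φ, g.berezin φ = f.berezin φ * f.evalBasis.det g.evalAt := fun φ => by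
    have e1 := congrArg (fun d => d g.evalAt)
      (AlternatingMap.eq_smul_basis_det f.evalBasis (contractAlternating n φ))
    have e2 : (f.evalBasis : Fin n → _) = f.evalAt := Module.Basis.coe_mk ..
    rw [berezin_eq_contractAlternating, berezin_eq_contractAlternating, ← e2]
    exact e1
  -- The factor is found at the common volume element, where both integrals take the same nonzero
  -- value.
  have h1 : f.evalBasis.det g.evalAt = 1 := by
    have h2 := key f.volume
    rw [f.berezin_volume, h, g.berezin_volume] at h2
    exact (mul_eq_left₀ (contractSign_ne_zero n)).1 h2.symm
  refine LinearMap.ext fun φ => ?_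
  rw [key, h1, mul_one]

end OddSymplecticBasis

/-! ### Independence of the oriented symplectic basis -/

namespace OrientedSymplecticSuperspace

variable {V₀ V₁ : Type*} [AddCommGroup V₀] [Module ℝ V₀]
  [AddCommGroup V₁] [Module ℝ V₁] {m n : ℕ}
  {V : OrientedSymplecticSuperspace V₀ V₁ m n}
  {P : Type*} [Ring P] [Algebra ℝ P] {𝒜 : ZMod 2 → Submodule ℝ P} [GradedAlgebra 𝒜]

theorem sum_smul_ofForm_coord (u : Module.Basis (Fin n) ℝ V₁) (g : V₁ →ₗ[ℝ] ℝ) :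
    ∑ j, (g (u j) : ℂ) • PForms.ofForm 𝒜 (Complex.ofRealCLM.toLinearMap ∘ₗ u.coord j) =
      PForms.ofForm 𝒜 (Complex.ofRealCLM.toLinearMap ∘ₗ g) := by
  simp only [PForms.ofForm, ← map_smul, ← map_sum]
  congr 2
  refine u.ext fun i => ?_
  rw [LinearMap.sum_apply, Finset.sum_eq_single i]
  · simp
  · intro j _ hj
    simp [hj.symm]
  · simp

theorem sum_sum_ofForm_coord_eq (u u' : Module.Basis (Fin n) ℝ V₁) (g : V₁ →ₗ[ℝ] V₁ →ₗ[ℝ] ℝ)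
    (y : PForms V₁ 𝒜) :
    ∑ i, ∑ j, (g (u i) (u j) : ℂ) •
        (PForms.ofForm 𝒜 (Complex.ofRealCLM.toLinearMap ∘ₗ u.coord j) * y *
          PForms.ofForm 𝒜 (Complex.ofRealCLM.toLinearMap ∘ₗ u.coord i)) =
      ∑ i, ∑ j, (g (u' i) (u' j) : ℂ) •
        (PForms.ofForm 𝒜 (Complex.ofRealCLM.toLinearMap ∘ₗ u'.coord j) * y *
          PForms.ofForm 𝒜 (Complex.ofRealCLM.toLinearMap ∘ₗ u'.coord i)) := by
  have h1 : ∀ w w' : Module.Basis (Fin n) ℝ V₁, ∀ i, ∑ j, (g (w' i) (w j) : ℂ) •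
      (PForms.ofForm 𝒜 (Complex.ofRealCLM.toLinearMap ∘ₗ w.coord j) * y *
        PForms.ofForm 𝒜 (Complex.ofRealCLM.toLinearMap ∘ₗ w'.coord i)) =
      PForms.ofForm 𝒜 (Complex.ofRealCLM.toLinearMap ∘ₗ g (w' i)) * y *
        PForms.ofForm 𝒜 (Complex.ofRealCLM.toLinearMap ∘ₗ w'.coord i) := fun w w' i => by
    rw [← sum_smul_ofForm_coord w (g (w' i)), Finset.sum_mul, Finset.sum_mul]
    simp only [smul_mul_assoc]
  have h2 : ∀ w w' : Module.Basis (Fin n) ℝ V₁, ∀ j, ∑ i, (g (w' i) (w j) : ℂ) •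
      (PForms.ofForm 𝒜 (Complex.ofRealCLM.toLinearMap ∘ₗ w.coord j) * y *
        PForms.ofForm 𝒜 (Complex.ofRealCLM.toLinearMap ∘ₗ w'.coord i)) =
      PForms.ofForm 𝒜 (Complex.ofRealCLM.toLinearMap ∘ₗ w.coord j) * y *
        PForms.ofForm 𝒜 (Complex.ofRealCLM.toLinearMap ∘ₗ g.flip (w j)) := fun w w' j => by
    rw [← sum_smul_ofForm_coord w' (g.flip (w j)), Finset.mul_sum]
    simp only [mul_smul_comm, LinearMap.flip_apply]
  -- The basis is changed in one index at a time, through the sum with mixed indices.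
  rw [Finset.sum_comm, Finset.sum_congr rfl fun j _ => h2 u u j,
    ← Finset.sum_congr rfl fun j _ => h2 u u' j, Finset.sum_comm,
    Finset.sum_congr rfl fun i _ => h1 u u' i, Finset.sum_congr rfl fun i _ => h1 u' u' i]

theorem toMatrix_eq_toMatrix (b b' : V.OrientedBasis) :
    LinearMap.BilinForm.toMatrix b.e V.B₀ = LinearMap.BilinForm.toMatrix b'.e V.B₀ := by
  ext i j
  rw [LinearMap.BilinForm.toMatrix_apply, LinearMap.BilinForm.toMatrix_apply]
  rcases i with i | i <;> rcases j with j | j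
  · rw [b.isotropic_left, b'.isotropic_left]
  · rw [b.symplectic, b'.symplectic]
  · rw [← V.alt.neg_eq, ← V.alt.neg_eq (b'.e _), b.symplectic, b'.symplectic]
  · rw [b.isotropic_right, b'.isotropic_right]

/-- Both bases have the same invertible Gram matrix `J`, and `Tᵗ J T = J` gives `det T ^ 2 = 1`. The
absolute value is all that Lebesgue measure sees. -/
theorem abs_det_toMatrix (b b' : V.OrientedBasis) : |(b'.e.toMatrix b.e).det| = 1 := by
  have h1 := LinearMap.BilinForm.toMatrix_mul_basis_toMatrix (b := b'.e) b.e V.B₀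
  have h2 := congrArg Matrix.det h1
  rw [Matrix.det_mul, Matrix.det_mul, Matrix.det_transpose, toMatrix_eq_toMatrix b b'] at h2
  have h3 : (LinearMap.BilinForm.toMatrix b'.e V.B₀).det ≠ 0 :=
    (LinearMap.BilinForm.nondegenerate_iff_det_ne_zero b'.e).1 V.nondegenerate_even
  have h4 : (b'.e.toMatrix b.e).det ^ 2 = 1 := by
    have : ((b'.e.toMatrix b.e).det ^ 2) * (LinearMap.BilinForm.toMatrix b'.e V.B₀).det =
        1 * (LinearMap.BilinForm.toMatrix b'.e V.B₀).det := by
      linear_combination h2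
    exact mul_right_cancel₀ h3 this
  rw [← abs_one (α := ℝ), ← sq_eq_sq_iff_abs_eq_abs, h4, one_pow]

open MeasureTheory in
/-- The Liouville integral does not depend on the oriented symplectic basis. -/
theorem HasLiouvilleIntegral.change_basis (b b' : V.OrientedBasis) {φ : V₀ → PForms V₁ 𝒜}
    {s : ℂ ⊗[ℝ] P} (hb : HasLiouvilleIntegral b φ s) : HasLiouvilleIntegral b' φ s := by
  have hber : b.f.berezinP 𝒜 = b'.f.berezinP 𝒜 := by
    rw [OddSymplecticBasis.berezinP, OddSymplecticBasis.berezinP,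
      b.f.berezin_eq_of_volume_eq b'.f (b.oriented.trans b'.oriented.symm)]
  set T := b'.e.toMatrix b.e with hT
  have hdet : T.det ≠ 0 := by
    have := abs_det_toMatrix b b'
    intro h0
    rw [h0] at this
    simp at this
  have hTx : ∀ x : Fin (m / 2) ⊕ Fin (m / 2) → ℝ,
      ∑ i, (Matrix.toLin' T x) i • b'.e i = ∑ i, x i • b.e i := by
    intro x
    simp only [Matrix.toLin'_apply, Matrix.mulVec, dotProduct, Finset.sum_smul]
    rw [Finset.sum_comm]
    refine Finset.sum_congr rfl fun j _ => ?_
    conv_rhs => rw [← b'.e.sum_repr (b.e j), Finset.smul_sum]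
    refine Finset.sum_congr rfl fun i _ => ?_
    rw [smul_smul, mul_comm, hT, Module.Basis.toMatrix_apply]
  have hmp : MeasurePreserving (Matrix.toLin' T) volume volume := by
    refine ⟨(LinearMap.continuous_of_finiteDimensional _).measurable, ?_⟩
    rw [Real.map_matrix_volume_pi_eq_smul_volume_pi hdet, abs_inv, abs_det_toMatrix b b']
    simp
  have hemb : MeasurableEmbedding (Matrix.toLin' T) := by
    refine (LinearMap.continuous_of_finiteDimensional _).measurableEmbedding ?_
    exact Matrix.mulVec_injective_iff_isUnit.2 ((Matrix.isUnit_iff_isUnit_det _).2 hdet.isUnit)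
  intro ℓ
  obtain ⟨h1, h2⟩ := hb ℓ
  have h3 : (fun x : Fin (m / 2) ⊕ Fin (m / 2) → ℝ =>
      ℓ (b.f.berezinP 𝒜 (φ (∑ i, x i • b.e i)))) =
      (fun x => ℓ (b'.f.berezinP 𝒜 (φ (∑ i, x i • b'.e i)))) ∘ Matrix.toLin' T := by
    funext x
    simp only [Function.comp, hTx, hber]
  rw [h3] at h1 h2
  refine ⟨(hmp.integrable_comp_emb hemb).1 h1, ?_⟩
  rw [h2]
  congr 1
  exact hmp.integral_comp hemb
    (fun x => ℓ (b'.f.berezinP 𝒜 (φ (∑ i, x i • b'.e i))))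

variable [Module.Finite ℝ V₀] [Module.Finite ℝ V₁]

/-- The moment map does not depend on the basis of `V₁`. -/
theorem moment_eq_moment (u u' : Module.Basis (Fin n) ℝ V₁)
    (X : SuperPointC V.spoEven V.spoOdd 𝒜) (v₀ : V₀) : moment u X v₀ = moment u' X v₀ := by
  have h3 : ∀ (w : Module.Basis (Fin n) ℝ V₁) (g : V₁ →ₗ[ℝ] ℝ) (z : PForms V₁ 𝒜),
      ∑ j, (g (w j) : ℂ) •
        (PForms.ofForm 𝒜 (Complex.ofRealCLM.toLinearMap ∘ₗ w.coord j) * z) =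
      PForms.ofForm 𝒜 (Complex.ofRealCLM.toLinearMap ∘ₗ g) * z := fun w g z => by
    rw [← sum_smul_ofForm_coord w g, Finset.sum_mul]
    simp only [smul_mul_assoc]
  have h4 : ∀ (w : Module.Basis (Fin n) ℝ V₁) (g : V₁ →ₗ[ℝ] ℝ) (z : PForms V₁ 𝒜),
      ∑ j, (g (w j) : ℂ) •
        (z * PForms.ofForm 𝒜 (Complex.ofRealCLM.toLinearMap ∘ₗ w.coord j)) =
      z * PForms.ofForm 𝒜 (Complex.ofRealCLM.toLinearMap ∘ₗ g) := fun w g z => by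
    rw [← sum_smul_ofForm_coord w g, Finset.mul_sum]
    simp only [mul_smul_comm]
  have e2 : ∀ (T : Module.End ℝ V₁) (y : PForms V₁ 𝒜),
      (∑ i, ∑ j, (V.B₁ (u i) (T (u j)) : ℂ) •
        (PForms.ofForm 𝒜 (Complex.ofRealCLM.toLinearMap ∘ₗ u.coord j) * y *
          PForms.ofForm 𝒜 (Complex.ofRealCLM.toLinearMap ∘ₗ u.coord i))) =
      ∑ i, ∑ j, (V.B₁ (u' i) (T (u' j)) : ℂ) •
        (PForms.ofForm 𝒜 (Complex.ofRealCLM.toLinearMap ∘ₗ u'.coord j) * y *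
          PForms.ofForm 𝒜 (Complex.ofRealCLM.toLinearMap ∘ₗ u'.coord i)) := fun T y => by
    simpa only [LinearMap.compl₂_apply] using sum_sum_ofForm_coord_eq u u' (V.B₁.compl₂ T) y
  have e3 : ∀ (T : V₁ →ₗ[ℝ] V₀) (z : PForms V₁ 𝒜),
      (∑ j, (V.B₀ v₀ (T (u j)) : ℂ) •
        (PForms.ofForm 𝒜 (Complex.ofRealCLM.toLinearMap ∘ₗ u.coord j) * z)) =
      ∑ j, (V.B₀ v₀ (T (u' j)) : ℂ) •
        (PForms.ofForm 𝒜 (Complex.ofRealCLM.toLinearMap ∘ₗ u'.coord j) * z) := fun T z =>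
    (h3 u (V.B₀ v₀ ∘ₗ T) z).trans (h3 u' (V.B₀ v₀ ∘ₗ T) z).symm
  have e4 : ∀ (v₁ : V₁) (z : PForms V₁ 𝒜),
      (∑ j, (V.B₁ (u j) v₁ : ℂ) •
        (z * PForms.ofForm 𝒜 (Complex.ofRealCLM.toLinearMap ∘ₗ u.coord j))) =
      ∑ j, (V.B₁ (u' j) v₁ : ℂ) •
        (z * PForms.ofForm 𝒜 (Complex.ofRealCLM.toLinearMap ∘ₗ u'.coord j)) := fun v₁ z =>
    (h4 u (V.B₁.flip v₁) z).trans (h4 u' (V.B₁.flip v₁) z).symm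
  unfold moment
  simp only [e2, e3, e4]

theorem isGaussianIntegral_of_basis (h : NearSuperalgebra 𝒜) (b : V.OrientedBasis)
    (X : SuperPointC V.spoEven V.spoOdd 𝒜) {s : ℂ ⊗[ℝ] P}
    (hb : HasLiouvilleIntegral b (fun v₀ => PForms.exp h (moment b.f.u X v₀)) s) :
    IsGaussianIntegral h X s := by
  intro b'
  simpa only [moment_eq_moment b.f.u b'.f.u] using hb.change_basis b b'

end OrientedSymplecticSuperspace

end

noncomputable section

/-! ### Symplectic bases -/

/-- The vectors `a_i, b_i` span mutually orthogonal hyperbolic planes. -/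
structure IsSymplecticFamily {W : Type*} [AddCommGroup W] [Module ℝ W]
    (B : LinearMap.BilinForm ℝ W) {k : ℕ} (a b : Fin k → W) : Prop where
  symplectic : ∀ i j, B (a i) (b j) = if i = j then 1 else 0
  isotropic_left : ∀ i j, B (a i) (a j) = 0
  isotropic_right : ∀ i j, B (b i) (b j) = 0

namespace IsSymplecticFamily

variable {W : Type*} [AddCommGroup W] [Module ℝ W] {B : LinearMap.BilinForm ℝ W} {k : ℕ}
  {a b : Fin k → W}

theorem symplectic' (hB : B.IsAlt) (h : IsSymplecticFamily B a b) (i j : Fin k) :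
    B (b i) (a j) = if i = j then -1 else 0 := by
  rw [← hB.neg_eq, h.symplectic]
  by_cases hij : i = j
  · simp [hij]
  · simp [hij, Ne.symm hij]

theorem linearIndependent (hB : B.IsAlt) (h : IsSymplecticFamily B a b) :
    LinearIndependent ℝ (Sum.elim a b) := by
  refine Fintype.linearIndependent_iff.2 fun g hg => ?_
  rw [Fintype.sum_sum_type] at hg
  simp only [Sum.elim_inl, Sum.elim_inr] at hg
  have h1 : ∀ j, B (∑ i, g (Sum.inl i) • a i + ∑ i, g (Sum.inr i) • b i) (b j) = g (Sum.inl j) :=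
    fun j => by simp [LinearMap.sum_apply, h.symplectic, h.isotropic_right]
  have h2 : ∀ j, B (∑ i, g (Sum.inl i) • a i + ∑ i, g (Sum.inr i) • b i) (a j) = -g (Sum.inr j) :=
    fun j => by simp [LinearMap.sum_apply, h.symplectic' hB, h.isotropic_left]
  rw [hg] at h1 h2
  rintro (j | j)
  · simpa using (h1 j).symm
  · simpa using (h2 j).symm

/-- Subtracting the projection to the span of the family. -/
theorem exists_sub_orthogonal (hB : B.IsAlt) (h : IsSymplecticFamily B a b) (w : W) :
    ∃ p ∈ Submodule.span ℝ (Set.range (Sum.elim a b)),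
      ∀ j, B (w - p) (a j) = 0 ∧ B (w - p) (b j) = 0 := by
  refine ⟨∑ i, B w (b i) • a i - ∑ i, B w (a i) • b i, ?_, fun j => ⟨?_, ?_⟩⟩
  · exact Submodule.sub_mem _
      (Submodule.sum_mem _ fun i _ => Submodule.smul_mem _ _
        (Submodule.subset_span ⟨Sum.inl i, rfl⟩))
      (Submodule.sum_mem _ fun i _ => Submodule.smul_mem _ _
        (Submodule.subset_span ⟨Sum.inr i, rfl⟩))
  · simp [LinearMap.sum_apply, h.symplectic' hB, h.isotropic_left]
  · simp [LinearMap.sum_apply, h.symplectic, h.isotropic_right]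

/-- Symplectic Gram–Schmidt: a vector outside the span, made orthogonal to the family, pairs
nontrivially with some `z` by nondegeneracy. Making `z` orthogonal as well does not change this
pairing, and rescaling completes a new hyperbolic pair. -/
theorem exists_succ [Module.Finite ℝ W] (hB : B.IsAlt) (hnd : B.Nondegenerate)
    (h : IsSymplecticFamily B a b) (hk : 2 * k < Module.finrank ℝ W) :
    ∃ a' b' : Fin (k + 1) → W, IsSymplecticFamily B a' b' := by
  have hspan : Submodule.span ℝ (Set.range (Sum.elim a b)) ≠ ⊤ := fun htop => by
    have h2 := (finrank_range_le_card (R := ℝ) (Sum.elim a b))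
    rw [Set.finrank, htop, finrank_top] at h2
    simp at h2
    omega
  obtain ⟨w, -, hw⟩ := SetLike.exists_of_lt (lt_top_iff_ne_top.2 hspan)
  obtain ⟨p, hp, hpo⟩ := h.exists_sub_orthogonal hB w
  have hx : w - p ≠ 0 := fun h0 => hw (by rwa [sub_eq_zero.1 h0])
  generalize w - p = x at hpo hx
  obtain ⟨z, hz⟩ : ∃ z, B x z ≠ 0 := by
    by_contra! hcon
    exact hx (hnd.1 x hcon)
  obtain ⟨q, hq, hqo⟩ := h.exists_sub_orthogonal hB z
  have hxq : B x q = 0 := by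
    have : Submodule.span ℝ (Set.range (Sum.elim a b)) ≤ LinearMap.ker (B x) := by
      rw [Submodule.span_le]
      rintro _ ⟨i | i, rfl⟩
      exacts [(hpo i).1, (hpo i).2]
    exact this hq
  have hxz : B x (z - q) ≠ 0 := by rwa [map_sub, hxq, sub_zero]
  generalize z - q = y at hqo hxz
  have flip : ∀ {u v}, B u v = 0 → B v u = 0 := fun {u v} huv => by
    rw [← hB.neg_eq, huv, neg_zero]
  refine ⟨Fin.snoc a x, Fin.snoc b ((B x y)⁻¹ • y), ⟨fun i j => ?_, fun i j => ?_, fun i j => ?_⟩⟩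
  · induction i using Fin.lastCases with
    | last => induction j using Fin.lastCases with
      | last => simp [hxz]
      | cast j => simp [(hpo j).2, (Fin.castSucc_lt_last j).ne']
    | cast i => induction j using Fin.lastCases with
      | last => simp [flip (hqo i).1, (Fin.castSucc_lt_last i).ne]
      | cast j => simp [h.symplectic]
  · induction i using Fin.lastCases with
    | last => induction j using Fin.lastCases with
      | last => simp [hB.self_eq_zero]
      | cast j => simp [(hpo j).1]
    | cast i => induction j using Fin.lastCases with
      | last => simp [flip (hpo i).1]
      | cast j => simp [h.isotropic_left]
  · induction i using Fin.lastCases with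
    | last => induction j using Fin.lastCases with
      | last => simp [hB.self_eq_zero]
      | cast j => simp [(hqo j).2]
    | cast i => induction j using Fin.lastCases with
      | last => simp [flip (hqo i).2]
      | cast j => simp [h.isotropic_right]

end IsSymplecticFamily

theorem exists_isSymplecticFamily {W : Type*} [AddCommGroup W] [Module ℝ W] [Module.Finite ℝ W]
    {B : LinearMap.BilinForm ℝ W} (hB : B.IsAlt) (hnd : B.Nondegenerate) (k : ℕ)
    (hk : 2 * k ≤ Module.finrank ℝ W) : ∃ a b : Fin k → W, IsSymplecticFamily B a b := by
  induction k with
  | zero => exact ⟨Fin.elim0, Fin.elim0, fun i => i.elim0, fun i => i.elim0, fun i => i.elim0⟩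
  | succ k ih =>
    obtain ⟨a, b, h⟩ := ih (by omega)
    exact h.exists_succ hB hnd (by omega)

namespace OrientedSymplecticSuperspace

variable {V₀ V₁ : Type*} [AddCommGroup V₀] [Module ℝ V₀] [Module.Finite ℝ V₀]
  [AddCommGroup V₁] [Module ℝ V₁] {m n : ℕ} (V : OrientedSymplecticSuperspace V₀ V₁ m n)

theorem nonempty_orientedBasis : Nonempty V.OrientedBasis := by
  obtain ⟨a, b, h⟩ := exists_isSymplecticFamily V.alt V.nondegenerate_even (m / 2)
    (by rw [V.finrank_even]; omega)
  -- If `m` were odd, one further pair would exist, giving `m + 1` independent vectors.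
  have heven : 2 * (m / 2) = m := by
    by_contra hne
    obtain ⟨a', b', h'⟩ := h.exists_succ V.alt V.nondegenerate_even
      (by rw [V.finrank_even]; omega)
    have := (h'.linearIndependent V.alt).fintype_card_le_finrank
    rw [V.finrank_even] at this
    simp at this
    omega
  obtain ⟨f, hf⟩ := V.exists_basis
  have hcard : Fintype.card (Fin (m / 2) ⊕ Fin (m / 2)) = Module.finrank ℝ V₀ := by
    rw [V.finrank_even]
    simp
    omega
  have hspan := (h.linearIndependent V.alt).span_eq_top_of_card_eq_finrank' hcard
  refine ⟨⟨Module.Basis.mk (h.linearIndependent V.alt) hspan.ge, f, fun i j => ?_, fun i j => ?_,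
    fun i j => ?_, hf⟩⟩
  · simpa using h.symplectic i j
  · simpa using h.isotropic_left i j
  · simpa using h.isotropic_right i j

end OrientedSymplecticSuperspace

end

noncomputable section

/-! ### The exterior algebra as a near superalgebra -/

namespace ExteriorAlgebra

section CommRing

variable {R M : Type*} [CommRing R] [AddCommGroup M] [Module R M]

/-- Moving a generator through an element applies the grading involution; supercommutativity follows
by specializing to even and odd elements. -/
theorem mul_ι_eq (a : ExteriorAlgebra R M) (x : M) :
    a * ι R x = ι R x * CliffordAlgebra.involute a := by
  induction a using CliffordAlgebra.induction with
  | algebraMap r => rw [AlgHom.commutes, Algebra.commutes]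
  | ι y =>
    rw [CliffordAlgebra.involute_ι, mul_neg]
    exact ι_mul_ι_comm_neg y x
  | mul a b ha hb => rw [mul_assoc, hb, ← mul_assoc, ha, mul_assoc, map_mul]
  | add a b ha hb => rw [add_mul, ha, hb, map_add, mul_add]

theorem commute_of_mem_even {a : ExteriorAlgebra R M}
    (ha : a ∈ CliffordAlgebra.evenOdd (0 : QuadraticForm R M) 0) (b : ExteriorAlgebra R M) :
    Commute a b := by
  induction b using CliffordAlgebra.induction with
  | algebraMap r => exact Algebra.commute_algebraMap_right r a
  | ι y =>
    have := mul_ι_eq a y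
    rwa [CliffordAlgebra.involute_eq_of_mem_even ha] at this
  | mul b c hb hc => exact hb.mul_right hc
  | add b c hb hc => exact hb.add_right hc

theorem anticomm_of_mem_odd {a b : ExteriorAlgebra R M}
    (ha : a ∈ CliffordAlgebra.evenOdd (0 : QuadraticForm R M) 1)
    (hb : b ∈ CliffordAlgebra.evenOdd (0 : QuadraticForm R M) 1) : a * b = -(b * a) := by
  induction b, hb using CliffordAlgebra.odd_induction with
  | ι y =>
    have := mul_ι_eq a y
    rwa [CliffordAlgebra.involute_eq_of_mem_odd ha, mul_neg] at this
  | add x y _ _ hx hy => rw [mul_add, hx, hy, add_mul, neg_add]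
  | ι_mul_ι_mul m₁ m₂ x _ h =>
    have h0 := commute_of_mem_even (CliffordAlgebra.ι_mul_ι_mem_evenOdd_zero 0 m₁ m₂) a
    rw [← mul_assoc, ← h0.eq, mul_assoc, h, mul_neg, ← mul_assoc]

/-- An even element is a sum of scalars and of multiples of products of two generators. These
products are central with square zero, so the multiples are nilpotent, and even elements commute. -/
theorem isNilpotent_even_sub {a : ExteriorAlgebra R M}
    (ha : a ∈ CliffordAlgebra.evenOdd (0 : QuadraticForm R M) 0) :
    IsNilpotent (a - algebraMap R _ (algebraMapInv a)) := by
  induction a, ha using CliffordAlgebra.even_induction with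
  | algebraMap r =>
    rw [algebraMap_leftInverse M r, sub_self]
    exact IsNilpotent.zero
  | add x y hx hy h1 h2 =>
    rw [map_add, map_add, add_sub_add_comm]
    refine Commute.isNilpotent_add ?_ h1 h2
    exact ((commute_of_mem_even hx _).sub_left (Algebra.commute_algebraMap_left _ _))
  | ι_mul_ι_mul m₁ m₂ x hx _ =>
    have h1 : algebraMapInv (CliffordAlgebra.ι 0 m₁ * CliffordAlgebra.ι 0 m₂ * x) = (0 : R) := by
      have h2 : algebraMapInv (CliffordAlgebra.ι 0 m₁) = (0 : R) := algebraMapInv_ι m₁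
      rw [map_mul, map_mul, h2, zero_mul, zero_mul]
    rw [h1, map_zero, sub_zero]
    refine ⟨2, ?_⟩
    have h2 : (CliffordAlgebra.ι (0 : QuadraticForm R M) m₁ * CliffordAlgebra.ι 0 m₂) ^ 2 = 0 := by
      have h3 : CliffordAlgebra.ι (0 : QuadraticForm R M) m₂ * CliffordAlgebra.ι 0 m₁ =
        -(CliffordAlgebra.ι 0 m₁ * CliffordAlgebra.ι 0 m₂) := ι_mul_ι_comm_neg m₂ m₁
      have h4 : CliffordAlgebra.ι (0 : QuadraticForm R M) m₁ * CliffordAlgebra.ι 0 m₁ = 0 :=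
        ι_sq_zero m₁
      rw [pow_two, mul_assoc, ← mul_assoc _ (CliffordAlgebra.ι 0 m₁), h3, neg_mul, mul_neg,
        ← mul_assoc, ← mul_assoc, h4, zero_mul, zero_mul, neg_zero]
    rw [(commute_of_mem_even (CliffordAlgebra.ι_mul_ι_mem_evenOdd_zero 0 m₁ m₂) x).mul_pow, h2,
      zero_mul]

end CommRing

section Real

variable {M : Type*} [AddCommGroup M] [Module ℝ M]

theorem isNilpotent_odd {a : ExteriorAlgebra ℝ M}
    (ha : a ∈ CliffordAlgebra.evenOdd (0 : QuadraticForm ℝ M) 1) : IsNilpotent a := by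
  refine ⟨2, ?_⟩
  have h := anticomm_of_mem_odd ha ha
  rw [pow_two]
  have h2 : (2 : ℝ) • (a * a) = 0 := by
    rw [two_smul]
    nth_rewrite 1 [h]
    exact neg_add_cancel _
  simpa using h2

theorem isNilpotent_sub (a : ExteriorAlgebra ℝ M) :
    IsNilpotent (a - algebraMap ℝ _ (algebraMapInv a)) := by
  obtain ⟨x, hx, y, hy, rfl⟩ := Submodule.mem_sup.1
    ((CliffordAlgebra.evenOdd_isCompl (0 : QuadraticForm ℝ M)).sup_eq_top ▸
      Submodule.mem_top (x := a))
  have hy0 : algebraMapInv y = 0 := ((isNilpotent_odd hy).map algebraMapInv).eq_zero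
  rw [map_add, hy0, add_zero, add_sub_right_comm]
  exact Commute.isNilpotent_add ((commute_of_mem_even hx _).sub_left
    (Algebra.commute_algebraMap_left _ _)) (isNilpotent_even_sub hx) (isNilpotent_odd hy)

theorem isUnit_of_algebraMapInv_ne_zero {a : ExteriorAlgebra ℝ M} (ha : algebraMapInv a ≠ 0) :
    IsUnit a := by
  have h := (isNilpotent_sub a).isUnit_add_left_of_commute
    (u := algebraMap ℝ _ (algebraMapInv a)) ((isUnit_iff_ne_zero.2 ha).map _)
    (Algebra.commute_algebraMap_right _ _)
  rwa [add_sub_cancel] at h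

variable (M) in
-- An element with nonzero scalar part is a unit plus a commuting nilpotent, hence a unit. So
-- nonunits have scalar part 0, and their sum is again a nonunit.
theorem isLocalRing : IsLocalRing (ExteriorAlgebra ℝ M) :=
  haveI : Nontrivial (ExteriorAlgebra ℝ M) :=
    (algebraMapInv (R := ℝ) (M := M)).toRingHom.domain_nontrivial
  .of_isUnit_or_isUnit_of_isUnit_add fun a b hab => by
    by_contra! hcon
    have h1 : algebraMapInv a = 0 := by
      by_contra h
      exact hcon.1 (isUnit_of_algebraMapInv_ne_zero h)
    have h2 : algebraMapInv b = 0 := by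
      by_contra h
      exact hcon.2 (isUnit_of_algebraMapInv_ne_zero h)
    have h3 := hab.map algebraMapInv
    rw [map_add, h1, h2, add_zero] at h3
    exact not_isUnit_zero h3

variable (M) in
/-- The exterior algebra of a finite dimensional real vector space is a near superalgebra. -/
def nearSuperalgebra [Module.Finite ℝ M] :
    NearSuperalgebra (CliffordAlgebra.evenOdd (0 : QuadraticForm ℝ M)) where
  finite := Module.Finite.of_basis (Module.finBasis ℝ M).ExteriorAlgebra
  isLocal := isLocalRing M
  comm i j a b ha hb := by
    have hcases : ∀ k : ZMod 2, k = 0 ∨ k = 1 := by decide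
    rcases hcases i with rfl | rfl
    · have := (commute_of_mem_even ha b).eq
      simpa using this
    · rcases hcases j with rfl | rfl
      · have := (commute_of_mem_even hb a).symm.eq
        simpa using this
      · have := anticomm_of_mem_odd ha hb
        simpa using this
  body := algebraMapInv

end Real

end ExteriorAlgebra

/-! ### A function is determined by its values at points -/

theorem taylorValueAlg_zero {𝕜 : Type*} [NontriviallyNormedField 𝕜] [NormedSpace 𝕜 ℂ]
    {A : Type*} [Ring A] [Algebra ℂ A] [Module.Finite ℂ A] {d : ℕ}
    (g : (Fin d → 𝕜) → A) (x : Fin d → 𝕜) : taylorValueAlg 𝕜 g x 0 = g x := by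
  have h : ∀ f : (Fin d → 𝕜) → ℂ, taylorValue 𝕜 f x (0 : Fin d → A) = f x • 1 := fun f => by
    rw [taylorValue, finsum_eq_single _ 0]
    · simp
    · intro k hk
      obtain ⟨k, rfl⟩ := Nat.exists_eq_succ_of_ne_zero hk
      simp [List.ofFn_succ]
  simp only [taylorValueAlg, h, mul_smul_comm, mul_one]
  exact (Module.finBasis ℂ A).sum_repr (g x)

section GenericPoint

variable {E₀ E₁ : Type*} [AddCommGroup E₀] [Module ℝ E₀] [Module.Finite ℝ E₀]
  [AddCommGroup E₁] [Module ℝ E₁] [Module.Finite ℝ E₁]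

variable (E₁) in
/-- The space of odd parameters: one for each coordinate of `E₁`. -/
abbrev OddParam : Type w := ULift.{w} (Fin (Module.finrank ℝ E₁)) → ℝ

variable (E₁) in
/-- The grading of the exterior algebra generated by the odd parameters. -/
abbrev paramGrading : ZMod 2 → Submodule ℝ (ExteriorAlgebra ℝ (OddParam.{w} E₁)) :=
  CliffordAlgebra.evenOdd (0 : QuadraticForm ℝ (OddParam.{w} E₁))

variable (E₁) in
/-- The odd parameters `θ_b`. -/
def oddParam (b : Fin (Module.finrank ℝ E₁)) : paramGrading.{w} E₁ 1 :=
  ⟨ExteriorAlgebra.ι ℝ (Pi.single (ULift.up b) 1), CliffordAlgebra.ι_mem_evenOdd_one _ _⟩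

variable (E₁) in
/-- The point `x + Σ_b H_b θ_b`, with body `x` and generic odd part. -/
def genericSuperPoint (x : E₀) : SuperPoint E₀ E₁ (paramGrading.{w} E₁) :=
  (x ⊗ₜ ⟨1, SetLike.GradedOne.one_mem⟩, ∑ b, Module.finBasis ℝ E₁ b ⊗ₜ oddParam E₁ b)

theorem body_genericSuperPoint (x : E₀) :
    (genericSuperPoint.{w} E₁ x).body (ExteriorAlgebra.nearSuperalgebra _) = x := by
  simp [SuperPoint.body, genericSuperPoint]

/-- The even part `x ⊗ 1` has no nilpotent component, so Taylor's formula at this point reduces to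
the value at `x`. -/
theorem evenSoul_genericSuperPoint (x : E₀) :
    evenSoul (ExteriorAlgebra.nearSuperalgebra _) (genericSuperPoint.{w} E₁ x).toC = 0 := by
  funext a
  have h1 : evenCoord (genericSuperPoint.{w} E₁ x).toC a =
      algebraMap ℂ _ ((Module.finBasis ℝ E₀).coord a x : ℂ) := by
    rw [evenCoord, SuperPoint.toC, pointCoord_lTensor, genericSuperPoint, pointCoord_tmul, map_smul]
    simp only [toCpxGrading, Algebra.TensorProduct.algebraMap_apply]
    simp [TensorProduct.smul_tmul']
  rw [evenSoul, h1, NearSuperalgebra.bodyC_algebraMap, sub_self]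
  rfl

theorem oddCoord_genericSuperPoint (x : E₀) (ζ : E₁ →ₗ[ℝ] ℂ) :
    oddCoord (genericSuperPoint.{w} E₁ x).toC.2 ζ =
      ∑ b, ζ (Module.finBasis ℝ E₁ b) •
        (1 ⊗ₜ[ℝ] (oddParam.{w} E₁ b : ExteriorAlgebra ℝ (OddParam.{w} E₁))) := by
  simp only [oddCoord, LinearMap.coe_mk, AddHom.coe_mk]
  refine Finset.sum_congr rfl fun b _ => ?_
  congr 1
  rw [SuperPoint.toC, pointCoord_lTensor, genericSuperPoint]
  simp only [map_sum, pointCoord_tmul]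
  rw [Finset.sum_eq_single b]
  · simp [toCpxGrading]
  · intro c _ hc
    simp [hc]
  · simp

variable (E₁) in
/-- The odd parameters as coordinates on `E₁`. -/
def paramForm : OddParam.{w} E₁ →ₗ[ℝ] CForms E₁ :=
  ∑ b : Fin (Module.finrank ℝ E₁), (LinearMap.proj (ULift.up b)).smulRight
    (ExteriorAlgebra.ι ℂ (Complex.ofRealCLM.toLinearMap ∘ₗ (Module.finBasis ℝ E₁).coord b))

theorem paramForm_apply (c : OddParam.{w} E₁) : paramForm E₁ c = ExteriorAlgebra.ι ℂ
    (∑ b, c (ULift.up b) • (Complex.ofRealCLM.toLinearMap ∘ₗ (Module.finBasis ℝ E₁).coord b)) := by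
  simp only [paramForm, LinearMap.sum_apply, LinearMap.smulRight_apply, LinearMap.proj_apply,
    map_sum]
  refine Finset.sum_congr rfl fun b _ => ?_
  exact (LinearMap.map_smul_of_tower (ExteriorAlgebra.ι ℂ) _ _).symm

variable (E₁) in
/-- The left inverse of the evaluation at a generic point. -/
def paramLift : ℂ ⊗[ℝ] ExteriorAlgebra ℝ (OddParam.{w} E₁) →ₐ[ℂ] CForms E₁ :=
  Algebra.TensorProduct.lift (Algebra.ofId ℂ _)
    (ExteriorAlgebra.lift ℝ ⟨paramForm E₁, fun c => by
      rw [paramForm_apply, ExteriorAlgebra.ι_sq_zero]⟩)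
    fun c x => by
      rw [Algebra.ofId_apply]
      exact Algebra.commute_algebraMap_left c _

/-- Both maps are algebra morphisms, so it suffices to check the generators. The evaluation at the
generic point is therefore injective: it loses nothing of the odd part of a function. -/
theorem paramLift_oddValue (x : E₀) (ω : CForms E₁) :
    paramLift.{w} E₁ (oddValue (ExteriorAlgebra.nearSuperalgebra _)
      (genericSuperPoint.{w} E₁ x).toC.2 ω) = ω := by
  have : (paramLift.{w} E₁).comp (oddValue (ExteriorAlgebra.nearSuperalgebra _)
      (genericSuperPoint.{w} E₁ x).toC.2) = AlgHom.id ℂ _ := by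
    refine ExteriorAlgebra.hom_ext (LinearMap.ext fun ζ => ?_)
    simp only [LinearMap.comp_apply, AlgHom.toLinearMap_apply, AlgHom.comp_apply, oddValue,
      ExteriorAlgebra.lift_ι_apply, oddCoord_genericSuperPoint, map_sum, map_smul, AlgHom.id_apply]
    have h1 : ∀ b, paramLift.{w} E₁
        (1 ⊗ₜ[ℝ] (oddParam.{w} E₁ b : ExteriorAlgebra ℝ (OddParam.{w} E₁))) =
        ExteriorAlgebra.ι ℂ
          (Complex.ofRealCLM.toLinearMap ∘ₗ (Module.finBasis ℝ E₁).coord b) := fun b => by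
      rw [paramLift, Algebra.TensorProduct.lift_tmul, map_one, one_mul, oddParam,
        ExteriorAlgebra.lift_ι_apply, paramForm_apply]
      congr 1
      rw [Finset.sum_eq_single b]
      · simp
      · intro c _ hc
        rw [Pi.single_eq_of_ne (by simpa using hc), zero_smul]
      · simp
    simp only [h1, ← map_smul, ← map_sum]
    congr 1
    refine (Module.finBasis ℝ E₁).ext fun c => ?_
    rw [LinearMap.sum_apply, Finset.sum_eq_single c]
    · simp
    · intro b _ hb
      simp [hb.symm]
    · simp
  exact DFunLike.congr_fun this ω

theorem superValue_genericSuperPoint (F : E₀ → CForms E₁) (x : E₀) :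
    superValue (ExteriorAlgebra.nearSuperalgebra _) F (genericSuperPoint.{w} E₁ x) =
      oddValue (ExteriorAlgebra.nearSuperalgebra _) (genericSuperPoint.{w} E₁ x).toC.2 (F x) := by
  have := (ExteriorAlgebra.nearSuperalgebra (OddParam.{w} E₁)).finite
  rw [superValue, evenSoul_genericSuperPoint, taylorValueAlg_zero, body_genericSuperPoint,
    ofCoord_coord]

end GenericPoint

/-! ### Uniqueness and existence -/

namespace OrientedSymplecticSuperspace

variable {V₀ V₁ : Type*} [AddCommGroup V₀] [Module ℝ V₀] [Module.Finite ℝ V₀]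
  [AddCommGroup V₁] [Module ℝ V₁] [Module.Finite ℝ V₁] {m n : ℕ}
  {V : OrientedSymplecticSuperspace V₀ V₁ m n}
  {P : Type*} [Ring P] [Algebra ℝ P] {𝒜 : ZMod 2 → Submodule ℝ P} [GradedAlgebra 𝒜]

/-- The condition quantifies over all oriented bases, so it determines the value only because at
least one exists; linear forms then separate points. -/
theorem IsGaussianIntegral.unique {h : NearSuperalgebra 𝒜}
    {X : SuperPointC V.spoEven V.spoOdd 𝒜} {s s' : ℂ ⊗[ℝ] P} (hs : IsGaussianIntegral h X s)
    (hs' : IsGaussianIntegral h X s') : s = s' := by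
  obtain ⟨b⟩ := V.nonempty_orientedBasis
  rw [← sub_eq_zero, ← Module.forall_dual_apply_eq_zero_iff ℂ]
  intro ℓ
  rw [map_sub, (hs b ℓ).2, (hs' b ℓ).2, sub_self]

/-- At the generic point over `x` both functions have the same value, the integral, and the left
inverse recovers their values at `x`. Analyticity plays no role here. -/
theorem IsSuperPfaffian.eqOn {F F' : V.spoEven → CForms V.spoOdd}
    (hF : IsSuperPfaffian.{w} V F) (hF' : IsSuperPfaffian.{w} V F') :
    Set.EqOn F F' V.posCone := by
  intro x hx
  have hX : (genericSuperPoint.{w} V.spoOdd x).body (ExteriorAlgebra.nearSuperalgebra _) ∈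
      V.posCone := by
    rwa [body_genericSuperPoint]
  have h := (hF.2 _ _ _ _ hX).unique (hF'.2 _ _ _ _ hX)
  rw [superValue_genericSuperPoint, superValue_genericSuperPoint] at h
  have h' := congrArg (paramLift.{w} V.spoOdd) h
  rwa [paramLift_oddValue, paramLift_oddValue] at h'

theorem isHolomorphicSuperPfaffian_superPfaffianC (b : V.OrientedBasis) :
    IsHolomorphicSuperPfaffian.{w} V (superPfaffianC b) :=
  ⟨isHolomorphicSuper_superPfaffianC b, fun _ _ _ _ _ h X hX =>
    isGaussianIntegral_of_basis h b X (hasLiouvilleIntegral_superPfaffianC h b X hX)⟩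

theorem isSuperPfaffian_superPfaffian (b : V.OrientedBasis) :
    IsSuperPfaffian.{w} V (superPfaffian b) := by
  refine ⟨isAnalyticSuper_superPfaffian b, fun _ _ _ _ _ h X hX => ?_⟩
  rw [superValue_superPfaffian h b X hX]
  exact (isHolomorphicSuperPfaffian_superPfaffianC b).2 _ _ h _ (body_toC_mem h X hX)

end OrientedSymplecticSuperspace

end

theorem mainTheorem1 {V₀ V₁ : Type*}
    [AddCommGroup V₀] [Module ℝ V₀] [Module.Finite ℝ V₀]
    [AddCommGroup V₁] [Module ℝ V₁] [Module.Finite ℝ V₁]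
    {m n : ℕ} (V : OrientedSymplecticSuperspace V₀ V₁ m n) :
    ∃ Spf : V.spoEven → CForms V.spoOdd,
      OrientedSymplecticSuperspace.IsSuperPfaffian.{w} V Spf ∧
      (∀ F : V.spoEven → CForms V.spoOdd,
        OrientedSymplecticSuperspace.IsSuperPfaffian.{w} V F → Set.EqOn F Spf V.posCone) ∧
      ∃ SpfC : V.spoEven ⊗[ℝ] ℂ → CForms V.spoOdd,
        OrientedSymplecticSuperspace.IsHolomorphicSuperPfaffian.{w} V SpfC ∧
        ∀ X ∈ V.posCone, SpfC (X ⊗ₜ[ℝ] (1 : ℂ)) = Spf X := by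
  obtain ⟨b⟩ := V.nonempty_orientedBasis
  have hSpf := OrientedSymplecticSuperspace.isSuperPfaffian_superPfaffian.{w} b
  -- Any basis may be used; the real function is by definition the restriction of the complex one,
  -- whence the final `rfl`.
  exact ⟨OrientedSymplecticSuperspace.superPfaffian b, hSpf, fun F hF => hF.eqOn hSpf,
    OrientedSymplecticSuperspace.superPfaffianC b,
    OrientedSymplecticSuperspace.isHolomorphicSuperPfaffian_superPfaffianC b, fun X _ => rfl⟩
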